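/- Conventions. An event is a read $\mathtt r(x,v)$ or a write $\mathtt w(x,v)$ of a value $v$ at a memory location (variable) $x$. A partial execution graph $(E,po)$ is a finite collection of threads, each a finite sequence of events; $E$ is the set of all events, and the program order $po$ is the strict order of events inside each thread. It is *consistent with the Relaxed memory model (with porf-acyclicity)* if there are a reads-from relation $rf$ (relating writes to reads of the same location and value, every read having exactly one incoming $rf$ edge) and a modification order $mo$ (relating writes to the same location, and a strict total order $mo_x$ on the writes to each location $x$) such that * $po\cup rf$ is acyclic (porf-acyclicity), * $mo_x;po$ is irreflexive for every location $x$ (relaxed-write-coherence), * $rf^{-1};mo_x;rf^{?};po$ is irreflexive for every location $x$ (relaxed-read-coherence). The consistency testing problem asks whether a given partial execution graph is consistent in this sense. It is 3-Writer if every location is written by at most three threads. Locations and values are named by natural numbers smaller than the number of events. The Exponential Time Hypothesis (ETH) states that there is $\delta>0$ such that no algorithm decides satisfiability of 3-CNF formulas with $N$ variables and $m$ clauses in time $2^{\delta N}\cdot(N+m)^{O(1)}$. Algorithms are deterministic (multi-stack) Turing machines. **Statement.** Under ETH, there is no algorithm that decides the consistency testing problem for the Relaxed memory model (with porf-acyclicity)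 in time $2^{o(k)}\cdot n^{O(1)}$, where $k$ is the number of threads and $n$ the number of events. This holds even if the input is restricted to 3-Writer partial execution graphs in which every location that occurs has exactly four writes; that is, there is no algorithm that on all such inputs halts within this time with the correct answer (no requirement is made on other inputs). -/

import Mathlib

open Filter Asymptotics

namespace RelaxedTesting

/-! ## Time-bounded decision procedures -/

/-- The instances `a : α` satisfying `P` are given to a machine as strings `enc a` over the alphabet
`Γ`.  `DecidesInTime enc dom P T` says that one fixed Turing machine (Mathlib's multi-stack model
`Turing.FinTM2`) halts on every instance in `dom` after at most `T a` steps, leaving the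
one-bit output that tells whether `P a` holds.  Nothing is required of its behaviour on instances
outside `dom`, so that impossibility results for a small `dom` are the strongest ones. -/
def DecidesInTime {α Γ : Type} (enc : α → List Γ) (dom : Set α) (P : α → Prop) (T : α → ℝ) :
    Prop :=
  ∃ M : Turing.TM2ComputableAux Γ Bool, ∀ a ∈ dom, ∃ t : ℕ, (t : ℝ) ≤ T a ∧
    ∃ b : Bool, (b = true ↔ P a) ∧
      Nonempty (Turing.TM2OutputsInTime M.tm
        ((enc a).map M.inputAlphabet.invFun)
        (some ([b].map M.outputAlphabet.invFun)) t)

/-! ## 3-SAT and the Exponential Time Hypothesis -/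

/-- A 3-CNF formula: a number of variables and a list of clauses of three literals each.  The
literal `(i, true)` is the variable `xᵢ` and `(i, false)` is its negation. -/
structure ThreeCNF where
  numVars : ℕ
  clauses : List (Fin 3 → Fin numVars × Bool)

namespace ThreeCNF

def Satisfiable (φ : ThreeCNF) : Prop :=
  ∃ A : Fin φ.numVars → Bool, ∀ c ∈ φ.clauses, ∃ j : Fin 3, A (c j).1 = (c j).2

/-- Symbols used to write down a 3-CNF formula. -/
inductive Sym
  | var | clause | pos | neg | idx
  deriving DecidableEq

/-- The literal on variable `i` is written as its sign followed by `i` in unary. -/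
def encodeLiteral {N : ℕ} (l : Fin N × Bool) : List Sym :=
  (if l.2 then Sym.pos else Sym.neg) :: List.replicate l.1 Sym.idx

def encodeClause {N : ℕ} (c : Fin 3 → Fin N × Bool) : List Sym :=
  Sym.clause :: (encodeLiteral (c 0) ++ encodeLiteral (c 1) ++ encodeLiteral (c 2))

/-- The number of variables in unary, followed by the clauses. -/
def encode (φ : ThreeCNF) : List Sym :=
  List.replicate φ.numVars Sym.var ++ φ.clauses.flatMap encodeClause

end ThreeCNF

/-- The Exponential Time Hypothesis: there is `δ > 0` such that satisfiability of 3-CNF formulas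
with `N` variables and `m` clauses cannot be decided in time `2 ^ (δ N) * (N + m) ^ O(1)`. -/
def ExponentialTimeHypothesis : Prop :=
  ∃ δ : ℝ, 0 < δ ∧ ∀ (C : ℝ) (c : ℕ),
    ¬ DecidesInTime ThreeCNF.encode Set.univ ThreeCNF.Satisfiable
      (fun φ => C * (2 : ℝ) ^ (δ * (φ.numVars : ℝ)) *
        ((φ.numVars + φ.clauses.length + 1 : ℕ) : ℝ) ^ c)

/-! ## Partial execution graphs -/

inductive OpKind
  | read | write
  deriving DecidableEq

/-- A memory operation `r(x, v)` or `w(x, v)`.  Memory locations and values are named by natural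
numbers. -/
structure MemOp where
  kind : OpKind
  loc : ℕ
  val : ℕ
  deriving DecidableEq

def MemOp.isWriteTo (o : MemOp) (x : ℕ) : Bool :=
  decide (o.kind = OpKind.write ∧ o.loc = x)

/-- A partial execution graph `⟨E, po⟩`, given by the sequence of operations of each thread. -/
structure PartialExec where
  threads : List (List MemOp)

namespace PartialExec

variable (X : PartialExec)

/-- The set of events `E`: an event is a thread together with a position in it. -/
def Event : Type :=
  (t : Fin X.threads.length) × Fin (X.threads.get t).length

/-- The memory operation carried out by an event. -/
def op (e : X.Event) : MemOp :=
  (X.threads.get e.1).get e.2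

def IsRead (e : X.Event) : Prop := (X.op e).kind = OpKind.read

def IsWrite (e : X.Event) : Prop := (X.op e).kind = OpKind.write

/-- The (strict) program order: the earlier and the later event of one thread. -/
def po (a b : X.Event) : Prop :=
  a.1 = b.1 ∧ (a.2 : ℕ) < (b.2 : ℕ)

/-- The number `k` of threads. -/
def numThreads : ℕ := X.threads.length

/-- The number `n` of events. -/
def numEvents : ℕ := (X.threads.map List.length).sum

/-- `rf` is a reads-from relation: it relates writes to reads of the same location and value, and
every read has exactly one write that it reads from. -/
structure IsReadsFrom (rf : X.Event → X.Event → Prop) : Prop where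
  isWrite : ∀ {w r}, rf w r → X.IsWrite w
  isRead : ∀ {w r}, rf w r → X.IsRead r
  loc_eq : ∀ {w r}, rf w r → (X.op w).loc = (X.op r).loc
  val_eq : ∀ {w r}, rf w r → (X.op w).val = (X.op r).val
  existsUnique : ∀ r, X.IsRead r → ∃! w, rf w r

/-- `mo` is a modification order: it relates writes of the same location, and it is a strict total
order on the set of writes of each location. -/
structure IsModificationOrder (mo : X.Event → X.Event → Prop) : Prop where
  isWrite_left : ∀ {a b}, mo a b → X.IsWrite a
  isWrite_right : ∀ {a b}, mo a b → X.IsWrite b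
  loc_eq : ∀ {a b}, mo a b → (X.op a).loc = (X.op b).loc
  irrefl : ∀ a, ¬ mo a a
  trans : ∀ {a b c}, mo a b → mo b c → mo a c
  total : ∀ a b, X.IsWrite a → X.IsWrite b → (X.op a).loc = (X.op b).loc → a ≠ b →
    mo a b ∨ mo b a

/-- The restriction `S_x = [E_x] ; S ; [E_x]` of a relation to the events on location `x`. -/
def restrict (S : X.Event → X.Event → Prop) (x : ℕ) (a b : X.Event) : Prop :=
  (X.op a).loc = x ∧ S a b ∧ (X.op b).loc = x

/-- porf-acyclicity: `acy(po ∪ rf)`. -/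
def PorfAcyclic (rf : X.Event → X.Event → Prop) : Prop :=
  ∀ e, ¬ Relation.TransGen (fun a b => X.po a b ∨ rf a b) e e

/-- relaxed-write-coherence: `irr(mo_x ; po)` for every location `x`. -/
def RelaxedWriteCoherent (mo : X.Event → X.Event → Prop) : Prop :=
  ∀ x e, ¬ Relation.Comp (X.restrict mo x) X.po e e

/-- relaxed-read-coherence: `irr(rf⁻¹ ; mo_x ; rf? ; po)` for every location `x`. -/
def RelaxedReadCoherent (rf mo : X.Event → X.Event → Prop) : Prop :=
  ∀ x e, ¬ Relation.Comp (flip rf)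
    (Relation.Comp (X.restrict mo x) (Relation.Comp (Relation.ReflGen rf) X.po)) e e

/-- The partial execution graph can be completed by some `rf` and `mo` to an execution graph that
satisfies the axioms of the relaxed memory model: porf-acyclicity, relaxed-write-coherence and
relaxed-read-coherence. -/
def RelaxedConsistent : Prop :=
  ∃ rf mo : X.Event → X.Event → Prop,
    X.IsReadsFrom rf ∧ X.IsModificationOrder mo ∧
      X.PorfAcyclic rf ∧ X.RelaxedWriteCoherent mo ∧ X.RelaxedReadCoherent rf mo

/-- 3-Writer: every location is written by at most three threads. -/
def IsThreeWriter : Prop :=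
  ∀ x, X.threads.countP (fun T => T.any (fun o => o.isWriteTo x)) ≤ 3

/-- Every location that occurs has exactly four writes. -/
def HasFourWritesPerLoc : Prop :=
  ∀ x, (∃ o ∈ X.threads.flatten, o.loc = x) →
    X.threads.flatten.countP (fun o => o.isWriteTo x) = 4

/-- The names of the locations and values are numbers smaller than the number of events.  Every
partial execution graph has this form after renaming locations and values; it keeps the length of
the input string polynomial in `k + n`. -/
def IsNormalized : Prop :=
  ∀ o ∈ X.threads.flatten, o.loc < X.numEvents ∧ o.val < X.numEvents

/-- Symbols used to write down a partial execution graph. -/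
inductive Sym
  | thread | read | write | loc | val
  deriving DecidableEq

/-- `r(x, v)` and `w(x, v)` are written as the kind of operation followed by `x` and `v` in
unary. -/
def encodeOp (o : MemOp) : List Sym :=
  (match o.kind with
    | OpKind.read => Sym.read
    | OpKind.write => Sym.write) ::
    (List.replicate o.loc Sym.loc ++ List.replicate o.val Sym.val)

/-- The threads one after the other, each introduced by a separator. -/
def encode : List Sym :=
  X.threads.flatMap (fun T => Sym.thread :: T.flatMap encodeOp)

end PartialExec

end RelaxedTesting

/-! The proof reduces 3-SAT with N variables and m clauses to consistency of a graph with 2N + 1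
threads: one thread per literal and one clock thread. The number of threads does not depend on m, so
a 2^{o(k)} n^{O(1)} test would decide 3-SAT in time 2^{o(N)} (N + m)^{O(1)}, contrary to ETH.

The two threads of a variable race through rounds j = 0, ..., m. At every column y each of them
writes its own truth value twice, `early` and `late`. In round j, `choice` reads the opponent's
value at column j + 1, that is, from the opponent's `early` or `late` write there. One of the two
`early` writes at this column is later in mo; the thread that made it may not read the opponent's
`early` write, by read coherence, and so must wait for the `late` one. Hence in every round some
thread is behind (`exists_behind`). The roles cannot be exchanged from one round to the next, since
the two waits would form a po ∪ rf cycle (`Behind.not_succ`); thus a thread behind in round 0 is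
behind in all rounds (`Behind.of_le`).

The clock ties the race to the clauses. Between its ticks for rounds j and j + 1 it reads a write
that only the threads of the literals of clause j make, after their `choice` of round j. A thread
behind in round j cannot provide this write: its `choice` waits for the opponent's `late` write at
column j + 1, which waits for tick j + 1, which follows the check (`exists_lit_not_behind`). Making
true the literals of threads that are not behind therefore satisfies every clause. Conversely, under
a satisfying assignment there is an explicit schedule in which the thread of the false literal lags
by a constant delay; ordering the writes to each location by time gives mo, and every po and rf edge
goes forward in time (`relaxedConsistent_of_servesChecks`).

Each location gets four writes. A clause has its third literal written twice, so some thread always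
makes two of the four, and at most three threads write to any location.

What remains is to carry out the reduction on a multi-stack machine in polynomial time. A small
structured language with a timed big-step semantics is compiled to `FinTM2` and chained with an
arbitrary decider (`DecidesInTime.of_reduction`); `reduceProg` is the reduction in this language.
Locations are numbers in unary, so their computation amounts to copying stacks. -/

namespace RelaxedTesting

/-! ## Structured programs on stacks -/

/-- Programs on stacks `k : K` over the alphabet `A`, with a register holding the symbol popped
last (`none` if the stack was empty). -/
inductive Prog (K A : Type)
  | push (k : K) (g : Option A → A)
  | pop (k : K)
  | seq (c d : Prog K A)
  | ite (p : Option A → Bool) (c d : Prog K A)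
  | loop (p : Option A → Bool) (c : Prog K A)

namespace Prog

variable {K A : Type} [DecidableEq K]

/-- `Runs c r S r' S' t`: started with register `r` and stacks `S`, the program `c` stops within
`t` steps with register `r'` and stacks `S'`. -/
inductive Runs : Prog K A → Option A → (K → List A) → Option A → (K → List A) → ℕ → Prop
  | push (k g r S) : Runs (push k g) r S r (Function.update S k (g r :: S k)) 1
  | pop (k r S) : Runs (pop k) r S (S k).head? (Function.update S k (S k).tail) 1
  | seq {c d r S r' S' r'' S'' t t'} : Runs c r S r' S' t → Runs d r' S' r'' S'' t' →
      Runs (seq c d) r S r'' S'' (t + t')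
  | ite_true {p c d r S r' S' t} : p r = true → Runs c r S r' S' t →
      Runs (ite p c d) r S r' S' (t + 1)
  | ite_false {p c d r S r' S' t} : p r = false → Runs d r S r' S' t →
      Runs (ite p c d) r S r' S' (t + 1)
  | loop_done {p c r S} : p r = false → Runs (loop p c) r S r S 1
  | loop_step {p c r S r' S' r'' S'' t t'} : p r = true → Runs c r S r' S' t →
      Runs (loop p c) r' S' r'' S'' t' → Runs (loop p c) r S r'' S'' (t + t' + 1)
  | mono {c r S r' S' t t'} : Runs c r S r' S' t → t ≤ t' → Runs c r S r' S' t'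

/-- The program points of a program. -/
def Label : Prog K A → Type
  | push _ _ => Unit
  | pop _ => Unit
  | seq c d => Label c ⊕ Label d
  | ite _ c d => Option (Label c ⊕ Label d)
  | loop _ c => Option (Label c)

@[reducible] def labelFintype : ∀ c : Prog K A, Fintype (Label c)
  | push _ _ => inferInstanceAs (Fintype Unit)
  | pop _ => inferInstanceAs (Fintype Unit)
  | seq c d =>
    letI := labelFintype c
    letI := labelFintype d
    inferInstanceAs (Fintype (Label c ⊕ Label d))
  | ite _ c d =>
    letI := labelFintype c
    letI := labelFintype d
    inferInstanceAs (Fintype (Option (Label c ⊕ Label d)))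
  | loop _ c =>
    letI := labelFintype c
    inferInstanceAs (Fintype (Option (Label c)))

instance (c : Prog K A) : Fintype (Label c) := labelFintype c

def entry : ∀ c : Prog K A, Label c
  | push _ _ => ()
  | pop _ => ()
  | seq c _ => Sum.inl (entry c)
  | ite _ _ _ => none
  | loop _ _ => none

end Prog

/-! ### Compiling programs and chaining them with a machine -/

/-- Alphabets of the stacks of a program placed next to the stacks of a machine. -/
def SumAlphabet (K A : Type) {K' : Type} (Γ : K' → Type) : K ⊕ K' → Type
  | Sum.inl _ => A
  | Sum.inr k => Γ k

def sumStore {K A K' : Type} {Γ : K' → Type} (S : K → List A) (S' : ∀ k, List (Γ k)) :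
    ∀ k, List (SumAlphabet K A Γ k)
  | Sum.inl k => S k
  | Sum.inr k => S' k

theorem sumStore_nil {K A K' : Type} {Γ : K' → Type} :
    sumStore (K := K) (A := A) (Γ := Γ) (fun _ => []) (fun _ => []) = fun _ => [] := by
  funext k
  rcases k with k | k <;> rfl

section SumStore

variable {K A K' : Type} [DecidableEq K] [DecidableEq K'] {Γ : K' → Type}

theorem update_sumStore_inl (S : K → List A) (S' : ∀ k, List (Γ k)) (k : K) (l : List A) :
    Function.update (sumStore S S') (Sum.inl k) l = sumStore (Function.update S k l) S' := by
  funext k'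
  rcases k' with k' | k'
  · by_cases h : k' = k
    · subst h
      exact (Function.update_self ..).trans (Function.update_self (f := S) ..).symm
    · exact (Function.update_of_ne (fun e => h (Sum.inl_injective e)) ..).trans
        (Function.update_of_ne (f := S) h ..).symm
  · exact Function.update_of_ne Sum.inr_ne_inl ..

theorem update_sumStore_inr (S : K → List A) (S' : ∀ k, List (Γ k)) (k : K') (l : List (Γ k)) :
    Function.update (sumStore S S') (Sum.inr k) l = sumStore S (Function.update S' k l) := by
  funext k'
  rcases k' with k' | k'
  · exact Function.update_of_ne Sum.inl_ne_inr ..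
  · by_cases h : k' = k
    · subst h
      exact (Function.update_self ..).trans (Function.update_self (f := S') ..).symm
    · exact (Function.update_of_ne (fun e => h (Sum.inr_injective e)) ..).trans
        (Function.update_of_ne (f := S') h ..).symm

end SumStore

/-- `b` is reached from `a` in at most `n` steps of `f`. -/
def ReachesIn {C : Type} (f : C → Option C) (n : ℕ) (a b : C) : Prop :=
  ∃ k ≤ n, (flip Bind.bind f)^[k] (some a) = some b

namespace ReachesIn

variable {C : Type} {f : C → Option C}

theorem single {a b : C} (h : f a = some b) : ReachesIn f 1 a b := ⟨1, le_rfl, h⟩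

theorem trans {n n' : ℕ} {a b c : C} (h : ReachesIn f n a b) (h' : ReachesIn f n' b c) :
    ReachesIn f (n + n') a c := by
  obtain ⟨k, hk, e⟩ := h
  obtain ⟨k', hk', e'⟩ := h'
  exact ⟨k' + k, by omega, by rw [Function.iterate_add_apply, e, e']⟩

theorem mono {n n' : ℕ} {a b : C} (h : ReachesIn f n a b) (hn : n ≤ n') : ReachesIn f n' a b := by
  obtain ⟨k, hk, e⟩ := h
  exact ⟨k, hk.trans hn, e⟩

end ReachesIn

namespace Prog

open Turing

section Compile

variable {K A K' Λ τ : Type} [DecidableEq K] [DecidableEq K'] {Γ : K' → Type}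

/-- The machine code of a program whose label `l` is placed at `f l` and which continues at `e`. -/
def code : ∀ (c : Prog K A) (_ : Label c → Λ) (_ : Λ), Label c →
    TM2.Stmt (SumAlphabet K A Γ) Λ (Option A × τ)
  | push k g, _, e, _ => .push (Sum.inl k) (fun v => g v.1) (.goto fun _ => e)
  | pop k, _, e, _ => .pop (Sum.inl k) (fun v x => (x, v.2)) (.goto fun _ => e)
  | seq c d, f, _, Sum.inl l => code c (fun l => f (Sum.inl l)) (f (Sum.inr (entry d))) l
  | seq _ d, f, e, Sum.inr l => code d (fun l => f (Sum.inr l)) e l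
  | ite p c d, f, _, none => .branch (fun v => p v.1)
      (.goto fun _ => f (some (Sum.inl (entry c)))) (.goto fun _ => f (some (Sum.inr (entry d))))
  | ite _ c _, f, e, some (Sum.inl l) => code c (fun l => f (some (Sum.inl l))) e l
  | ite _ _ d, f, e, some (Sum.inr l) => code d (fun l => f (some (Sum.inr l))) e l
  | loop p c, f, e, none => .branch (fun v => p v.1)
      (.goto fun _ => f (some (entry c))) (.goto fun _ => e)
  | loop _ c, f, _, some l => code c (fun l => f (some l)) (f none) l

/-- Each rule of `Runs` costs at least as many steps as its compiled code, since jumps are part of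
the statement that precedes them. The placement `f`, the exit `e` and the foreign state `v`, `U` are
quantified so that the induction can move into subprograms. -/
theorem Runs.reachesIn {m : Λ → TM2.Stmt (SumAlphabet K A Γ) Λ (Option A × τ)}
    {c : Prog K A} {r r' : Option A} {S S' : K → List A} {t : ℕ} (h : Runs c r S r' S' t) :
    ∀ (f : Label c → Λ) (e : Λ) (_ : ∀ l, m (f l) = code c f e l) (v : τ) (U : ∀ k, List (Γ k)),
      ReachesIn (TM2.step m) t ⟨some (f (entry c)), (r, v), sumStore S U⟩
        ⟨some e, (r', v), sumStore S' U⟩ := by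
  induction h with
  | push k g r S =>
    intro f e hm v U
    refine ReachesIn.single ?_
    rw [TM2.step, hm, ← update_sumStore_inl]
    rfl
  | pop k r S =>
    intro f e hm v U
    refine ReachesIn.single ?_
    rw [TM2.step, hm, ← update_sumStore_inl]
    rfl
  | @seq c d r S r' S' r'' S'' t t' _ _ ih ih' =>
    intro f e hm v U
    exact (ih _ _ (fun l => hm (Sum.inl l)) v U).trans (ih' _ _ (fun l => hm (Sum.inr l)) v U)
  | ite_true hp _ ih =>
    intro f e hm v U
    rw [Nat.add_comm]
    refine (ReachesIn.single ?_).trans (ih _ _ (fun l => hm (some (Sum.inl l))) v U)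
    rw [TM2.step, hm, entry, code, TM2.stepAux]
    simp only [hp, cond_true]
    rfl
  | ite_false hp _ ih =>
    intro f e hm v U
    rw [Nat.add_comm]
    refine (ReachesIn.single ?_).trans (ih _ _ (fun l => hm (some (Sum.inr l))) v U)
    rw [TM2.step, hm, entry, code, TM2.stepAux]
    simp only [hp, cond_false]
    rfl
  | loop_done hp =>
    intro f e hm v U
    refine ReachesIn.single ?_
    rw [TM2.step, hm, entry, code, TM2.stepAux]
    simp only [hp, cond_false]
    rfl
  | loop_step hp _ _ ih ih' =>
    intro f e hm v U
    rw [Nat.add_comm]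
    refine (ReachesIn.single ?_).trans
      ((ih _ _ (fun l => hm (some l)) v U).trans (ih' _ _ hm v U))
    rw [TM2.step, hm, entry, code, TM2.stepAux]
    simp only [hp, cond_true]
    rfl
  | mono _ ht ih =>
    intro f e hm v U
    exact (ih f e hm v U).mono ht

/-- The code of a machine that runs next to the stacks of a program. -/
def liftStmt {Λ' : Type} : TM2.Stmt Γ Λ τ →
    TM2.Stmt (SumAlphabet K A Γ) (Λ' ⊕ Λ) (Option A × τ)
  | .push k f q => .push (Sum.inr k) (fun v => f v.2) (liftStmt q)
  | .peek k f q => .peek (Sum.inr k) (fun v x => (v.1, f v.2 x)) (liftStmt q)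
  | .pop k f q => .pop (Sum.inr k) (fun v x => (v.1, f v.2 x)) (liftStmt q)
  | .load f q => .load (fun v => (v.1, f v.2)) (liftStmt q)
  | .branch p q q' => .branch (fun v => p v.2) (liftStmt q) (liftStmt q')
  | .goto f => .goto fun v => Sum.inr (f v.2)
  | .halt => .halt

def liftCfg {Λ' : Type} (r : Option A) (S : K → List A) (x : TM2.Cfg Γ Λ τ) :
    TM2.Cfg (SumAlphabet K A Γ) (Λ' ⊕ Λ) (Option A × τ) :=
  ⟨x.l.map Sum.inr, (r, x.var), sumStore S x.stk⟩

theorem stepAux_liftStmt {Λ' : Type} (r : Option A) (S : K → List A) (q : TM2.Stmt Γ Λ τ) :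
    ∀ (v : τ) (U : ∀ k, List (Γ k)),
      TM2.stepAux (liftStmt (Λ' := Λ') q) (r, v) (sumStore S U) =
        liftCfg r S (TM2.stepAux q v U) := by
  induction q with
  | push k f q ih =>
    intro v U
    rw [TM2.stepAux, ← ih, ← update_sumStore_inr]
    rfl
  | peek k f q ih => intro v U; exact ih _ _
  | pop k f q ih =>
    intro v U
    rw [TM2.stepAux, ← ih, ← update_sumStore_inr]
    rfl
  | load f q ih => intro v U; exact ih _ _
  | branch p q q' ih ih' =>
    intro v U
    rw [liftStmt, TM2.stepAux, TM2.stepAux]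
    cases h : p v <;> simp only [cond_true, cond_false, ih, ih']
  | goto f => intro v U; rfl
  | halt => intro v U; rfl

/-- The lifted machine simulates the original in lockstep, so the step count is preserved exactly
and the program's register and stacks stay frozen. -/
theorem iterate_liftCfg {Λ' : Type} {m : Λ → TM2.Stmt Γ Λ τ}
    {m' : Λ' ⊕ Λ → TM2.Stmt (SumAlphabet K A Γ) (Λ' ⊕ Λ) (Option A × τ)}
    (hm : ∀ l, m' (Sum.inr l) = liftStmt (m l)) (r : Option A) (S : K → List A) (n : ℕ) :
    ∀ x : Option (TM2.Cfg Γ Λ τ),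
      (flip Bind.bind (TM2.step m'))^[n] (x.map (liftCfg r S)) =
        ((flip Bind.bind (TM2.step m))^[n] x).map (liftCfg r S) := by
  induction n with
  | zero => intro x; rfl
  | succ n ih =>
    intro x
    rw [Function.iterate_succ_apply, Function.iterate_succ_apply, ← ih]
    congr 1
    rcases x with _ | ⟨_ | l, v, U⟩
    · rfl
    · rfl
    · have : TM2.step m' (liftCfg r S ⟨some l, v, U⟩) =
          (TM2.step m ⟨some l, v, U⟩).map (liftCfg r S) := by
        rw [TM2.step, Option.map_some, ← stepAux_liftStmt, ← hm]
        rfl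
      exact this

end Compile

/-- Run the program `c`, move its stack `kout` to the input stack of `M` and then run `M`. -/
def thenMachine {K A B : Type} [DecidableEq K] [Fintype K] [Fintype A] [Inhabited A] (c : Prog K A)
    (kin kout : K) (conv : A → B) (M : TM2ComputableAux B Bool) : TM2ComputableAux A Bool where
  tm :=
    { K := K ⊕ M.tm.K
      kDecidableEq := letI := M.tm.kDecidableEq; inferInstance
      kFin := letI := M.tm.kFin; inferInstance
      k₀ := Sum.inl kin
      k₁ := Sum.inr M.tm.k₁
      Γ := SumAlphabet K A M.tm.Γ
      Λ := (Label c ⊕ Unit) ⊕ M.tm.Λ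
      main := Sum.inl (Sum.inl (entry c))
      ΛFin := letI := M.tm.ΛFin; inferInstance
      σ := Option A × M.tm.σ
      initialState := (none, M.tm.initialState)
      σFin := letI := M.tm.σFin; inferInstance
      Γk₀Fin := inferInstanceAs (Fintype A)
      m := fun l => match l with
        | Sum.inl (Sum.inl l) =>
          code c (fun l => Sum.inl (Sum.inl l)) (Sum.inl (Sum.inr ())) l
        | Sum.inl (Sum.inr ()) =>
          .pop (Sum.inl kout) (fun v x => (x, v.2)) <|
          .branch (fun v => v.1.isSome)
            (.push (Sum.inr M.tm.k₀)
              (fun v => M.inputAlphabet.invFun (conv (v.1.getD default)))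
              (.goto fun _ => Sum.inl (Sum.inr ())))
            (.goto fun _ => Sum.inr M.tm.main)
        | Sum.inr l => liftStmt (M.tm.m l) }
  inputAlphabet := Equiv.refl A
  outputAlphabet := M.outputAlphabet


theorem initList_eq (M : FinTM2) (s : List (M.Γ M.k₀)) :
    initList M s = ⟨some M.main, M.initialState, Function.update (fun _ => []) M.k₀ s⟩ := by
  unfold initList
  congr 1
  funext k
  by_cases h : k = M.k₀
  · subst h; simp
  · simp [h]

theorem haltList_eq (M : FinTM2) (s : List (M.Γ M.k₁)) :
    haltList M s = ⟨none, M.initialState, Function.update (fun _ => []) M.k₁ s⟩ := by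
  unfold haltList
  congr 1
  funext k
  by_cases h : k = M.k₁
  · subst h; simp
  · simp [h]

theorem thenMachine_step {K A B : Type} [DecidableEq K] [Fintype K] [Fintype A] [Inhabited A]
    (c : Prog K A) (kin kout : K) (conv : A → B) (M : TM2ComputableAux B Bool) (r : Option A)
    (v : M.tm.σ) (S : K → List A) (U : ∀ k, List (M.tm.Γ k)) :
    (thenMachine c kin kout conv M).tm.step
        ⟨some (Sum.inl (Sum.inr ())), (r, v), sumStore S U⟩ =
      some (cond (S kout).head?.isSome
        ⟨some (Sum.inl (Sum.inr ())), ((S kout).head?, v),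
          sumStore (Function.update S kout (S kout).tail) (Function.update U M.tm.k₀
            (M.inputAlphabet.invFun (conv ((S kout).head?.getD default)) :: U M.tm.k₀))⟩
        ⟨some (Sum.inr M.tm.main), ((S kout).head?, v),
          sumStore (Function.update S kout (S kout).tail) U⟩) := by
  rw [← update_sumStore_inr, ← update_sumStore_inl]
  rfl

/-- Moving a stack symbol by symbol reverses it; the accumulator `l` is what has already arrived. A
program that builds its output by pushing leaves it reversed, so the two reversals cancel. -/
theorem thenMachine_move {K A B : Type} [DecidableEq K] [Fintype K] [Fintype A] [Inhabited A]
    (c : Prog K A) (kin kout : K) (conv : A → B) (M : TM2ComputableAux B Bool) (v : M.tm.σ)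
    (o : List A) : ∀ (r : Option A) (l : List B),
      ReachesIn (thenMachine c kin kout conv M).tm.step (o.length + 1)
        ⟨some (Sum.inl (Sum.inr ())), (r, v), sumStore (Function.update (fun _ => []) kout o)
          (Function.update (fun _ => []) M.tm.k₀ (l.map M.inputAlphabet.invFun))⟩
        ⟨some (Sum.inr M.tm.main), (none, v), sumStore (fun _ => [])
          (Function.update (fun _ => []) M.tm.k₀
            ((o.reverse.map conv ++ l).map M.inputAlphabet.invFun))⟩ := by
  induction o with
  | nil =>
    intro r l
    refine ReachesIn.single ?_
    rw [thenMachine_step]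
    simp
    rfl
  | cons a o ih =>
    intro r l
    have h := ih (some a) (conv a :: l)
    rw [List.length_cons, Nat.add_comm]
    refine (ReachesIn.single ?_).trans (by simpa using h)
    rw [thenMachine_step]
    simp
    rfl

/-- Three runs are concatenated: the program, the transfer, the decider. The program has to clean up
its register and all other stacks, because `haltList` demands the initial state and empty stacks
apart from the output at the end. -/
theorem thenMachine_outputs {K A B : Type} [DecidableEq K] [Fintype K] [Fintype A] [Inhabited A]
    {c : Prog K A} {kin kout : K} {conv : A → B} {M : TM2ComputableAux B Bool} {s o : List A}
    {t t' : ℕ} {b : List (M.tm.Γ M.tm.k₁)}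
    (hc : Runs c none (Function.update (fun _ => []) kin s) none
      (Function.update (fun _ => []) kout o) t)
    (hM : Nonempty (TM2OutputsInTime M.tm ((o.reverse.map conv).map M.inputAlphabet.invFun)
      (some b) t')) :
    Nonempty (TM2OutputsInTime (thenMachine c kin kout conv M).tm s (some b)
      (t + (o.length + 1) + t')) := by
  let X := thenMachine c kin kout conv M
  have h1 := hc.reachesIn (m := X.tm.m) (fun l => Sum.inl (Sum.inl l))
    (Sum.inl (Sum.inr ())) (fun l => rfl) M.tm.initialState (fun _ => [])
  have h2 := thenMachine_move c kin kout conv M M.tm.initialState o none []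
  -- With an empty accumulator the update of the empty store is trivial, which makes the start of
  -- the transfer agree with the end of the program.
  rw [List.map_nil, Function.update_eq_self M.tm.k₀ (fun k => ([] : List (M.tm.Γ k))),
    List.append_nil] at h2
  obtain ⟨⟨⟨k3, e3⟩, hk3⟩⟩ := hM
  have e3' := iterate_liftCfg (m := M.tm.m) (m' := X.tm.m) (fun l => rfl) none (fun _ : K => [])
    k3 (some (initList M.tm ((o.reverse.map conv).map M.inputAlphabet.invFun)))
  have e3'' := e3'.trans (congrArg (Option.map (liftCfg none (fun _ : K => ([] : List A)))) e3)
  have h3 : ReachesIn X.tm.step t'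
      (liftCfg none (fun _ => []) (initList M.tm ((o.reverse.map conv).map M.inputAlphabet.invFun)))
      (liftCfg none (fun _ => []) (haltList M.tm b)) := ⟨k3, hk3, e3''⟩
  have hs' : Function.update (fun k => ([] : List (SumAlphabet K A M.tm.Γ k))) (Sum.inl kin) s =
      sumStore (Γ := M.tm.Γ) (Function.update (fun _ => []) kin s) (fun _ => []) := by
    rw [← update_sumStore_inl, sumStore_nil]
  have hb' : Function.update (fun k => ([] : List (SumAlphabet K A M.tm.Γ k))) (Sum.inr M.tm.k₁) b =
      sumStore (Γ := M.tm.Γ) (fun _ : K => ([] : List A))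
        (Function.update (fun _ => []) M.tm.k₁ b) := by
    rw [← update_sumStore_inr, sumStore_nil]
  have hs : initList X.tm s = ⟨some (Sum.inl (Sum.inl (entry c))), (none, M.tm.initialState),
      sumStore (Function.update (fun _ => []) kin s) (fun _ => [])⟩ :=
    (initList_eq X.tm s).trans (congrArg (fun U => (⟨some X.tm.main, X.tm.initialState, U⟩ :
      X.tm.Cfg)) hs')
  have hb : haltList X.tm b = liftCfg none (fun _ => []) (haltList M.tm b) := by
    rw [haltList_eq M.tm]
    exact (haltList_eq X.tm b).trans (congrArg (fun U => (⟨none, X.tm.initialState, U⟩ :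
      X.tm.Cfg)) hb')
  rw [initList_eq] at h3
  obtain ⟨k, hk, e⟩ := (h1.trans h2).trans h3
  exact ⟨⟨⟨k, (congrArg (fun z => (flip Bind.bind X.tm.step)^[k] (some z)) hs).trans
    (e.trans (congrArg some hb.symm))⟩, hk⟩⟩

end Prog

/-- A program that reduces `P` to `P'` turns a decision procedure for `P'` into one for `P`. -/
theorem DecidesInTime.of_reduction {α β K A B : Type} [DecidableEq K] [Fintype K] [Fintype A]
    [Inhabited A] {enc : α → List A} {dom : Set α} {P : α → Prop} {enc' : β → List B}
    {dom' : Set β} {P' : β → Prop} {T' : β → ℝ} (h : DecidesInTime enc' dom' P' T')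
    (red : α → β) (hdom : ∀ a ∈ dom, red a ∈ dom') (hP : ∀ a ∈ dom, P' (red a) ↔ P a)
    (c : Prog K A) (kin kout : K) (conv : A → B) (o : α → List A) (R : α → ℕ)
    (hc : ∀ a ∈ dom, Prog.Runs c none (Function.update (fun _ => []) kin (enc a)) none
      (Function.update (fun _ => []) kout (o a)) (R a))
    (ho : ∀ a ∈ dom, (o a).reverse.map conv = enc' (red a)) :
    DecidesInTime enc dom P
      (fun a => ((R a + ((enc' (red a)).length + 1) : ℕ) : ℝ) + T' (red a)) := by
  obtain ⟨M, hM⟩ := h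
  refine ⟨Prog.thenMachine c kin kout conv M, fun a ha => ?_⟩
  obtain ⟨t, ht, b, hb, hrun⟩ := hM (red a) (hdom a ha)
  refine ⟨R a + ((o a).length + 1) + t, ?_, b, hb.trans (hP a ha), ?_⟩
  · have hl : (enc' (red a)).length = (o a).length := by simp [← ho a ha]
    simp only [hl]
    push_cast
    linarith
  · have := Prog.thenMachine_outputs (hc a ha) (by rw [ho a ha]; exact hrun)
    have e : (enc a).map (Prog.thenMachine c kin kout conv M).inputAlphabet.invFun = enc a :=
      List.map_id _
    rw [e]
    exact this

/-! ## Partial execution graphs whose events carry names -/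

section Named

variable {O G : Type}

/-- The partial execution graph with a thread for every `o ∈ os`, in which the events with the names
`gen o` carry out the operations given by `op`. -/
def namedExec (os : List O) (gen : O → List G) (op : G → MemOp) : PartialExec :=
  ⟨os.map fun o => (gen o).map op⟩

/-- The names `gen o` determine the thread `o` and are listed in increasing order of `key`. -/
structure IsNaming (os : List O) (gen : O → List G) (own : G → O) (key : G → ℕ) : Prop where
  nodup : os.Nodup
  own_eq : ∀ o ∈ os, ∀ g ∈ gen o, own g = o
  sorted : ∀ o ∈ os, (gen o).Pairwise fun a b => key a < key b

variable {os : List O} {gen : O → List G} {op : G → MemOp} {own : G → O} {key : G → ℕ}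

theorem namedExec_fst_lt (e : (namedExec os gen op).Event) : (e.1 : ℕ) < os.length := by
  have := e.1.2
  simpa [namedExec] using this

theorem namedExec_snd_lt (e : (namedExec os gen op).Event) :
    (e.2 : ℕ) < (gen (os[(e.1 : ℕ)]'(namedExec_fst_lt e))).length := by
  have := e.2.2
  simpa [namedExec] using this

/-- The name of an event. -/
def nameOf (e : (namedExec os gen op).Event) : G :=
  (gen (os[(e.1 : ℕ)]'(namedExec_fst_lt e)))[(e.2 : ℕ)]'(namedExec_snd_lt e)

theorem op_nameOf (e : (namedExec os gen op).Event) :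
    (namedExec os gen op).op e = op (nameOf e) := by
  simp [PartialExec.op, namedExec, nameOf]

theorem nameOf_mem (e : (namedExec os gen op).Event) :
    nameOf e ∈ gen (os[(e.1 : ℕ)]'(namedExec_fst_lt e)) := List.getElem_mem _

theorem exists_nameOf {o : O} (ho : o ∈ os) {g : G} (hg : g ∈ gen o) :
    ∃ e : (namedExec os gen op).Event, nameOf e = g := by
  obtain ⟨t, ht, rfl⟩ := List.getElem_of_mem ho
  obtain ⟨p, hp, rfl⟩ := List.getElem_of_mem hg
  exact ⟨⟨⟨t, by simpa [namedExec] using ht⟩, ⟨p, by simpa [namedExec] using hp⟩⟩, rfl⟩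

namespace IsNaming

theorem own_nameOf (h : IsNaming os gen own key) (e : (namedExec os gen op).Event) :
    own (nameOf e) = os[(e.1 : ℕ)]'(namedExec_fst_lt e) :=
  h.own_eq _ (List.getElem_mem _) _ (nameOf_mem e)

theorem own_mem (h : IsNaming os gen own key) (e : (namedExec os gen op).Event) :
    own (nameOf e) ∈ os := by
  rw [h.own_nameOf]
  exact List.getElem_mem _

theorem nameOf_mem_own (h : IsNaming os gen own key) (e : (namedExec os gen op).Event) :
    nameOf e ∈ gen (own (nameOf e)) := by
  rw [h.own_nameOf]
  exact nameOf_mem e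

theorem fst_eq_iff (h : IsNaming os gen own key) (a b : (namedExec os gen op).Event) :
    a.1 = b.1 ↔ own (nameOf a) = own (nameOf b) := by
  rw [h.own_nameOf, h.own_nameOf, h.nodup.getElem_inj_iff, Fin.ext_iff]

theorem key_lt_iff (h : IsNaming os gen own key) {a b : (namedExec os gen op).Event}
    (hab : a.1 = b.1) : key (nameOf a) < key (nameOf b) ↔ (a.2 : ℕ) < (b.2 : ℕ) := by
  obtain ⟨t, p⟩ := a
  obtain ⟨t', q⟩ := b
  obtain rfl : t = t' := hab
  have hs := List.pairwise_iff_getElem.1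
    (h.sorted _ (List.getElem_mem (namedExec_fst_lt (⟨t, p⟩ : (namedExec os gen op).Event))))
  have hp := namedExec_snd_lt (⟨t, p⟩ : (namedExec os gen op).Event)
  have hq := namedExec_snd_lt (⟨t, q⟩ : (namedExec os gen op).Event)
  refine ⟨fun hlt => ?_, fun hlt => hs _ _ hp hq hlt⟩
  rcases lt_trichotomy (p : ℕ) (q : ℕ) with h1 | h1 | h1
  · exact h1
  · obtain rfl : p = q := Fin.ext h1
    exact absurd hlt (lt_irrefl _)
  · exact absurd (hs _ _ hq hp h1) (not_lt.2 hlt.le)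

/-- This replaces positions in lists by a comparison of keys, so that all later cycle arguments
become arithmetic. -/
theorem po_iff (h : IsNaming os gen own key) (a b : (namedExec os gen op).Event) :
    (namedExec os gen op).po a b ↔
      own (nameOf a) = own (nameOf b) ∧ key (nameOf a) < key (nameOf b) := by
  rw [← h.fst_eq_iff, PartialExec.po]
  exact and_congr_right fun hab => (h.key_lt_iff hab).symm

theorem nameOf_injective (h : IsNaming os gen own key) :
    Function.Injective (nameOf : (namedExec os gen op).Event → G) := by
  intro a b hab
  have h1 : a.1 = b.1 := (h.fst_eq_iff a b).2 (by rw [hab])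
  have h2 : ¬ (a.2 : ℕ) < (b.2 : ℕ) := by rw [← h.key_lt_iff h1, hab]; exact lt_irrefl _
  have h3 : ¬ (b.2 : ℕ) < (a.2 : ℕ) := by rw [← h.key_lt_iff h1.symm, hab]; exact lt_irrefl _
  obtain ⟨t, p⟩ := a
  obtain ⟨t', q⟩ := b
  obtain rfl : t = t' := h1
  obtain rfl : p = q := Fin.ext (by simp only at h2 h3; omega)
  rfl

end IsNaming

end Named

/-! ## The partial execution graph of a formula -/

/-- The clauses of a 3-CNF formula with `N` variables. -/
abbrev Clause (N : ℕ) : Type := Fin 3 → Fin N × Bool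

/-- Names of events: the events of the thread of the literal `(i, b)`, and the events `tick` and
`check` of the clock thread. -/
inductive Ev
  | early (i : ℕ) (b : Bool) (y : ℕ)
  | late (i : ℕ) (b : Bool) (y : ℕ)
  | sync (i : ℕ) (b : Bool) (j : ℕ)
  | choice (i : ℕ) (b : Bool) (j : ℕ)
  | lit (i : ℕ) (b : Bool) (j : ℕ) (k : ℕ)
  | tick (j : ℕ) (k : ℕ)
  | check (j : ℕ)

namespace Ev

/-- The operations: location `j` serves to synchronise with the clock, location `W + j` to check
clause `j`, and the locations `(i + 2) * W + y` belong to variable `i`. -/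
def op (W : ℕ) : Ev → MemOp
  | early i b y => ⟨.write, (i + 2) * W + y, b.toNat⟩
  | late i b y => ⟨.write, (i + 2) * W + y, b.toNat⟩
  | sync _ _ j => ⟨.read, j, 0⟩
  | choice i b j => ⟨.read, (i + 2) * W + (j + 1), (!b).toNat⟩
  | lit _ _ j _ => ⟨.write, W + j, 0⟩
  | tick j _ => ⟨.write, j, 0⟩
  | check j => ⟨.read, W + j, 0⟩

def own : Ev → Option (ℕ × Bool)
  | early i b _ => some (i, b)
  | late i b _ => some (i, b)
  | sync i b _ => some (i, b)
  | choice i b _ => some (i, b)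
  | lit i b _ _ => some (i, b)
  | tick _ _ => none
  | check _ => none

/-- Keys also serve as a schedule. In round j a literal thread runs `early (j + 2)`, `sync`,
`choice`, `late` at 100j + 200, 210, 220, 230 and its clause writes at 240 to 270; the clock ticks
at 100j + 200 to 203 and checks at 100j + 280. -/
def key : Ev → ℕ
  | early _ _ y => 100 * y
  | late _ _ y => 100 * y + 230
  | sync _ _ j => 100 * j + 210
  | choice _ _ j => 100 * j + 220
  | lit _ _ j k => 100 * j + 240 + 10 * k
  | tick j k => 100 * j + 200 + k
  | check j => 100 * j + 280

@[simp] theorem key_early (i b y) : key (early i b y) = 100 * y := rfl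
@[simp] theorem key_late (i b y) : key (late i b y) = 100 * y + 230 := rfl
@[simp] theorem key_sync (i b j) : key (sync i b j) = 100 * j + 210 := rfl
@[simp] theorem key_choice (i b j) : key (choice i b j) = 100 * j + 220 := rfl
@[simp] theorem key_lit (i b j k) : key (lit i b j k) = 100 * j + 240 + 10 * k := rfl
@[simp] theorem key_tick (j k) : key (tick j k) = 100 * j + 200 + k := rfl
@[simp] theorem key_check (j) : key (check j) = 100 * j + 280 := rfl
@[simp] theorem own_early (i b y) : own (early i b y) = some (i, b) := rfl
@[simp] theorem own_late (i b y) : own (late i b y) = some (i, b) := rfl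
@[simp] theorem own_sync (i b j) : own (sync i b j) = some (i, b) := rfl
@[simp] theorem own_choice (i b j) : own (choice i b j) = some (i, b) := rfl
@[simp] theorem own_lit (i b j k) : own (lit i b j k) = some (i, b) := rfl
@[simp] theorem own_tick (j k) : own (tick j k) = none := rfl
@[simp] theorem own_check (j) : own (check j) = none := rfl

end Ev

open Ev

/-- The literal of a clause to which the `k`-th write for this clause belongs. -/
def slot (k : ℕ) : Fin 3 := if k ≤ 1 then 2 else if k = 2 then 1 else 0

section Threads

variable {N : ℕ}

def IsLit (i : ℕ) (b : Bool) (l : Fin N × Bool) : Prop := (l.1 : ℕ) = i ∧ l.2 = b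

instance (i : ℕ) (b : Bool) (l : Fin N × Bool) : Decidable (IsLit i b l) :=
  inferInstanceAs (Decidable (_ ∧ _))

/-- The third literal is written twice so that a clause has four writes in all. Literals come in
reverse order because the program meets the input reversed. -/
def litEvents (i : ℕ) (b : Bool) (j : ℕ) (c : Clause N) : List Ev :=
  (if IsLit i b (c 2) then [lit i b j 0, lit i b j 1] else []) ++
    ((if IsLit i b (c 1) then [lit i b j 2] else []) ++
      (if IsLit i b (c 0) then [lit i b j 3] else []))

/-- The `early` write is one column ahead of the one that `choice j` concerns. A trailing thread
blocked at `choice j` waits for the leader's `late (j + 1)`; just before that write the leader runs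
`choice (j + 1)`, which needs the trailing thread's `early (j + 2)` to be there already. -/
def coreEvents (i : ℕ) (b : Bool) (j : ℕ) : List Ev :=
  [early i b (j + 2), sync i b j, choice i b j, late i b j]

/-- The part of the thread of `(i, b)` that starts with clause `j`. -/
def litThreadFrom (i : ℕ) (b : Bool) : ℕ → List (Clause N) → List Ev
  | j, [] => [late i b (j + 1), late i b (j + 2)]
  | j, c :: cs => litEvents i b j c ++ (coreEvents i b (j + 1) ++ litThreadFrom i b (j + 1) cs)

/-- The two initial `early` writes, like the two final `late` ones in `litThreadFrom`, complete the
columns that the rounds do not cover, so that each column is written exactly twice. -/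
def litThread (i : ℕ) (b : Bool) (cs : List (Clause N)) : List Ev :=
  [early i b 0, early i b 1] ++ (coreEvents i b 0 ++ litThreadFrom i b 0 cs)

def ticks (j : ℕ) : List Ev := [tick j 0, tick j 1, tick j 2, tick j 3]

/-- The check of clause j precedes the ticks of round j + 1, so no thread passes `sync (j + 1)`
before clause j has been served. -/
def clockFrom : ℕ → List (Clause N) → List Ev
  | _, [] => []
  | j, _ :: cs => check j :: (ticks (j + 1) ++ clockFrom (j + 1) cs)

def clockThread (cs : List (Clause N)) : List Ev := ticks 0 ++ clockFrom 0 cs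

def threadOf (cs : List (Clause N)) : Option (ℕ × Bool) → List Ev
  | some (i, b) => litThread i b cs
  | none => clockThread cs

def owners (N : ℕ) : List (Option (ℕ × Bool)) :=
  (List.range N).flatMap (fun i => [some (i, true), some (i, false)]) ++ [none]

/-- The partial execution graph of a list of clauses. -/
def clauseExec (cs : List (Clause N)) : PartialExec :=
  namedExec (owners N) (threadOf cs) (op (cs.length + 3))

theorem mem_owners_some {i : ℕ} {b : Bool} : some (i, b) ∈ owners N ↔ i < N := by
  cases b <;> simp [owners]

theorem mem_owners_none : none ∈ owners N := by simp [owners]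

theorem nodup_owners : (owners N).Nodup := by
  rw [owners, List.nodup_append]
  refine ⟨?_, by simp, ?_⟩
  swap
  · simp only [List.mem_flatMap, List.mem_cons, List.not_mem_nil, or_false]
    rintro a ⟨i, _, rfl | rfl⟩ _ rfl <;> simp
  rw [List.nodup_flatMap]
  refine ⟨by simp, ?_⟩
  refine (List.nodup_range (n := N)).imp ?_
  intro a b hab x
  simp
  rintro (rfl | rfl) <;> simp [hab]

theorem own_of_mem_litThreadFrom {i : ℕ} {b : Bool} {e : Ev} (cs : List (Clause N)) :
    ∀ j, e ∈ litThreadFrom i b j cs → own e = some (i, b) := by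
  induction cs with
  | nil =>
    intro j h
    simp only [litThreadFrom, List.mem_cons, List.not_mem_nil, or_false] at h
    rcases h with rfl | rfl <;> rfl
  | cons c cs ih =>
    intro j h
    simp only [litThreadFrom, List.mem_append] at h
    rcases h with h | h | h
    · simp only [litEvents, List.mem_append, List.mem_ite_nil_right, List.mem_cons, List.not_mem_nil,
        or_false] at h
      rcases h with ⟨_, rfl | rfl⟩ | ⟨_, rfl⟩ | ⟨_, rfl⟩ <;> rfl
    · simp only [coreEvents, List.mem_cons, List.not_mem_nil, or_false] at h
      rcases h with rfl | rfl | rfl | rfl <;> rfl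
    · exact ih _ h

theorem own_of_mem_clockFrom {e : Ev} (cs : List (Clause N)) :
    ∀ j, e ∈ clockFrom j cs → own e = none := by
  induction cs with
  | nil => intro j h; simp [clockFrom] at h
  | cons c cs ih =>
    intro j h
    simp only [clockFrom, ticks, List.mem_append, List.mem_cons, List.not_mem_nil, or_false] at h
    rcases h with rfl | (rfl | rfl | rfl | rfl) | h
    iterate 5 rfl
    exact ih _ h

theorem own_of_mem_threadOf {cs : List (Clause N)} {o : Option (ℕ × Bool)} {e : Ev}
    (h : e ∈ threadOf cs o) : own e = o := by
  rcases o with _ | ⟨i, b⟩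
  · simp only [threadOf, clockThread, ticks, List.mem_append, List.mem_cons, List.not_mem_nil,
      or_false] at h
    rcases h with (rfl | rfl | rfl | rfl) | h
    iterate 4 rfl
    exact own_of_mem_clockFrom _ _ h
  · simp only [threadOf, litThread, coreEvents, List.mem_append, List.mem_cons, List.not_mem_nil,
      or_false] at h
    rcases h with (rfl | rfl) | (rfl | rfl | rfl | rfl) | h
    iterate 6 rfl
    exact own_of_mem_litThreadFrom _ _ h

theorem le_key_litThreadFrom {i : ℕ} {b : Bool} {e : Ev} (cs : List (Clause N)) :
    ∀ j, e ∈ litThreadFrom i b j cs → 100 * j + 240 ≤ key e := by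
  induction cs with
  | nil =>
    intro j h
    simp only [litThreadFrom, List.mem_cons, List.not_mem_nil, or_false] at h
    rcases h with rfl | rfl <;> dsimp <;> omega
  | cons c cs ih =>
    intro j h
    simp only [litThreadFrom, List.mem_append] at h
    rcases h with h | h | h
    · simp only [litEvents, List.mem_append, List.mem_ite_nil_right, List.mem_cons, List.not_mem_nil,
        or_false] at h
      rcases h with ⟨_, rfl | rfl⟩ | ⟨_, rfl⟩ | ⟨_, rfl⟩ <;> dsimp <;> omega
    · simp only [coreEvents, List.mem_cons, List.not_mem_nil, or_false] at h
      rcases h with rfl | rfl | rfl | rfl <;> dsimp <;> omega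
    · have := ih _ h
      omega

theorem sorted_litThreadFrom (i : ℕ) (b : Bool) (cs : List (Clause N)) :
    ∀ j, (litThreadFrom i b j cs).Pairwise fun a b => key a < key b := by
  induction cs with
  | nil => intro j; simp [litThreadFrom]
  | cons c cs ih =>
    intro j
    rw [litThreadFrom, List.pairwise_append, List.pairwise_append]
    refine ⟨?_, ⟨?_, ih _, ?_⟩, ?_⟩
    · unfold litEvents
      split_ifs <;> simp
    · simp [coreEvents]
      omega
    · intro a ha e he
      have := le_key_litThreadFrom _ _ he
      simp only [coreEvents, List.mem_cons, List.not_mem_nil, or_false] at ha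
      rcases ha with rfl | rfl | rfl | rfl <;> dsimp <;> omega
    · intro a ha e he
      have h1 : key a < 100 * j + 280 := by
        simp only [litEvents, List.mem_append, List.mem_ite_nil_right, List.mem_cons,
          List.not_mem_nil, or_false] at ha
        rcases ha with ⟨_, rfl | rfl⟩ | ⟨_, rfl⟩ | ⟨_, rfl⟩ <;> dsimp <;> omega
      rw [List.mem_append] at he
      rcases he with he | he
      · simp only [coreEvents, List.mem_cons, List.not_mem_nil, or_false] at he
        rcases he with rfl | rfl | rfl | rfl <;> dsimp <;> omega
      · have := le_key_litThreadFrom _ _ he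
        omega

theorem le_key_clockFrom {e : Ev} (cs : List (Clause N)) :
    ∀ j, e ∈ clockFrom j cs → 100 * j + 280 ≤ key e := by
  induction cs with
  | nil => intro j h; simp [clockFrom] at h
  | cons c cs ih =>
    intro j h
    simp only [clockFrom, ticks, List.mem_append, List.mem_cons, List.not_mem_nil, or_false] at h
    rcases h with rfl | (rfl | rfl | rfl | rfl) | h
    iterate 5 (dsimp; omega)
    have := ih _ h
    omega

theorem sorted_clockFrom (cs : List (Clause N)) :
    ∀ j, (clockFrom j cs).Pairwise fun a b => key a < key b := by
  induction cs with
  | nil => intro j; simp [clockFrom]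
  | cons c cs ih =>
    intro j
    rw [clockFrom, List.pairwise_cons, List.pairwise_append]
    refine ⟨?_, by simp [ticks], ih _, ?_⟩
    · intro e he
      rw [List.mem_append] at he
      rcases he with he | he
      · simp only [ticks, List.mem_cons, List.not_mem_nil, or_false] at he
        rcases he with rfl | rfl | rfl | rfl <;> dsimp <;> omega
      · have := le_key_clockFrom _ _ he
        dsimp
        omega
    · intro a ha e he
      have := le_key_clockFrom _ _ he
      simp only [ticks, List.mem_cons, List.not_mem_nil, or_false] at ha
      rcases ha with rfl | rfl | rfl | rfl <;> dsimp <;> omega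

theorem sorted_threadOf (cs : List (Clause N)) (o : Option (ℕ × Bool)) :
    (threadOf cs o).Pairwise fun a b => key a < key b := by
  rcases o with _ | ⟨i, b⟩
  · rw [threadOf, clockThread, List.pairwise_append]
    refine ⟨by simp [ticks], sorted_clockFrom _ _, ?_⟩
    intro a ha e he
    have := le_key_clockFrom _ _ he
    simp only [ticks, List.mem_cons, List.not_mem_nil, or_false] at ha
    rcases ha with rfl | rfl | rfl | rfl <;> dsimp <;> omega
  · rw [threadOf, litThread, List.pairwise_append, List.pairwise_append]
    refine ⟨by simp, ⟨by simp [coreEvents], sorted_litThreadFrom _ _ _ _, ?_⟩, ?_⟩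
    · intro a ha e he
      have := le_key_litThreadFrom _ _ he
      simp only [coreEvents, List.mem_cons, List.not_mem_nil, or_false] at ha
      rcases ha with rfl | rfl | rfl | rfl <;> dsimp <;> omega
    · intro a ha e he
      have h1 : key a ≤ 100 := by
        simp only [List.mem_cons, List.not_mem_nil, or_false] at ha
        rcases ha with rfl | rfl <;> dsimp <;> omega
      rw [List.mem_append] at he
      rcases he with he | he
      · simp only [coreEvents, List.mem_cons, List.not_mem_nil, or_false] at he
        rcases he with rfl | rfl | rfl | rfl <;> dsimp <;> omega
      · have := le_key_litThreadFrom _ _ he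
        omega

theorem isNaming_threadOf (cs : List (Clause N)) : IsNaming (owners N) (threadOf cs) own key :=
  ⟨nodup_owners, fun _ _ _ h => own_of_mem_threadOf h, fun o _ => sorted_threadOf cs o⟩

end Threads

/-! ### Which events occur -/

section Membership

variable {N : ℕ}

/-- The names of the events of `clauseExec cs`. -/
def IsName (cs : List (Clause N)) : Ev → Prop
  | early i _ y => i < N ∧ y ≤ cs.length + 2
  | late i _ y => i < N ∧ y ≤ cs.length + 2
  | sync i _ j => i < N ∧ j ≤ cs.length
  | choice i _ j => i < N ∧ j ≤ cs.length
  | lit i b j k => i < N ∧ k < 4 ∧ ∃ c, cs[j]? = some c ∧ IsLit i b (c (slot k))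
  | tick j k => j ≤ cs.length ∧ k < 4
  | check j => j < cs.length

theorem lit_mem_litEvents {i j j' k : ℕ} {b : Bool} {c : Clause N} :
    lit i b j' k ∈ litEvents i b j c ↔ j' = j ∧ k < 4 ∧ IsLit i b (c (slot k)) := by
  simp only [litEvents, List.mem_append, List.mem_ite_nil_right, List.mem_cons, List.not_mem_nil,
    or_false, lit.injEq, true_and]
  constructor
  · rintro (⟨h, ⟨rfl, rfl⟩ | ⟨rfl, rfl⟩⟩ | ⟨h, rfl, rfl⟩ | ⟨h, rfl, rfl⟩) <;>
      exact ⟨rfl, by omega, h⟩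
  · rintro ⟨rfl, hk, h⟩
    interval_cases k <;> simp_all [slot]

theorem mem_litEvents_of {i j : ℕ} {b : Bool} {c : Clause N} {e : Ev}
    (h : e ∈ litEvents i b j c) : ∃ k, e = lit i b j k := by
  simp only [litEvents, List.mem_append, List.mem_ite_nil_right, List.mem_cons, List.not_mem_nil,
    or_false] at h
  rcases h with ⟨_, rfl | rfl⟩ | ⟨_, rfl⟩ | ⟨_, rfl⟩ <;> exact ⟨_, rfl⟩

theorem early_mem_litThreadFrom {i y : ℕ} {b : Bool} (cs : List (Clause N)) :
    ∀ j, early i b y ∈ litThreadFrom i b j cs ↔ j + 3 ≤ y ∧ y ≤ j + 2 + cs.length := by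
  induction cs with
  | nil => intro j; simp [litThreadFrom]; omega
  | cons c cs ih =>
    intro j
    have h : early i b y ∉ litEvents i b j c := fun h => by
      obtain ⟨k, hk⟩ := mem_litEvents_of h
      cases hk
    simp only [litThreadFrom, List.mem_append, h, coreEvents, ih, List.mem_cons, List.not_mem_nil,
      early.injEq, reduceCtorEq, List.length_cons, true_and, false_or, or_false]
    omega

theorem late_mem_litThreadFrom {i y : ℕ} {b : Bool} (cs : List (Clause N)) :
    ∀ j, late i b y ∈ litThreadFrom i b j cs ↔ j + 1 ≤ y ∧ y ≤ j + 2 + cs.length := by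
  induction cs with
  | nil => intro j; simp [litThreadFrom]; omega
  | cons c cs ih =>
    intro j
    have h : late i b y ∉ litEvents i b j c := fun h => by
      obtain ⟨k, hk⟩ := mem_litEvents_of h
      cases hk
    simp only [litThreadFrom, List.mem_append, h, coreEvents, ih, List.mem_cons, List.not_mem_nil,
      late.injEq, reduceCtorEq, List.length_cons, true_and, false_or, or_false]
    omega

theorem sync_mem_litThreadFrom {i y : ℕ} {b : Bool} (cs : List (Clause N)) :
    ∀ j, sync i b y ∈ litThreadFrom i b j cs ↔ j + 1 ≤ y ∧ y ≤ j + cs.length := by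
  induction cs with
  | nil => intro j; simp [litThreadFrom]
  | cons c cs ih =>
    intro j
    have h : sync i b y ∉ litEvents i b j c := fun h => by
      obtain ⟨k, hk⟩ := mem_litEvents_of h
      cases hk
    simp only [litThreadFrom, List.mem_append, h, coreEvents, ih, List.mem_cons, List.not_mem_nil,
      sync.injEq, reduceCtorEq, List.length_cons, true_and, false_or, or_false]
    omega

theorem choice_mem_litThreadFrom {i y : ℕ} {b : Bool} (cs : List (Clause N)) :
    ∀ j, choice i b y ∈ litThreadFrom i b j cs ↔ j + 1 ≤ y ∧ y ≤ j + cs.length := by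
  induction cs with
  | nil => intro j; simp [litThreadFrom]
  | cons c cs ih =>
    intro j
    have h : choice i b y ∉ litEvents i b j c := fun h => by
      obtain ⟨k, hk⟩ := mem_litEvents_of h
      cases hk
    simp only [litThreadFrom, List.mem_append, h, coreEvents, ih, List.mem_cons, List.not_mem_nil,
      choice.injEq, reduceCtorEq, List.length_cons, true_and, false_or, or_false]
    omega

theorem lit_mem_litThreadFrom {i j' k : ℕ} {b : Bool} (cs : List (Clause N)) :
    ∀ j, lit i b j' k ∈ litThreadFrom i b j cs ↔
      j ≤ j' ∧ k < 4 ∧ ∃ c, cs[j' - j]? = some c ∧ IsLit i b (c (slot k)) := by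
  induction cs with
  | nil => intro j; simp [litThreadFrom]
  | cons c cs ih =>
    intro j
    simp only [litThreadFrom, List.mem_append, lit_mem_litEvents, coreEvents, ih, List.mem_cons,
      List.not_mem_nil, reduceCtorEq, false_or]
    rcases lt_trichotomy j' j with h | rfl | h
    · constructor
      · rintro (⟨h', _⟩ | ⟨h', _⟩) <;> omega
      · rintro ⟨h', _⟩; omega
    · constructor
      · rintro (⟨_, h1, h2⟩ | ⟨h', _⟩)
        · exact ⟨le_rfl, h1, c, by simp, h2⟩
        · omega
      · rintro ⟨_, h1, c', h2, h3⟩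
        simp only [Nat.sub_self, List.getElem?_cons_zero, Option.some.injEq] at h2
        subst h2
        exact Or.inl ⟨rfl, h1, h3⟩
    · have e : j' - j = (j' - (j + 1)) + 1 := by omega
      rw [e, List.getElem?_cons_succ]
      constructor
      · rintro (⟨rfl, _⟩ | ⟨_, h'⟩)
        · omega
        · exact ⟨h.le, h'⟩
      · rintro ⟨_, h'⟩
        exact Or.inr ⟨h, h'⟩

theorem tick_mem_clockFrom {y k : ℕ} (cs : List (Clause N)) :
    ∀ j, tick y k ∈ clockFrom j cs ↔ j + 1 ≤ y ∧ y ≤ j + cs.length ∧ k < 4 := by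
  induction cs with
  | nil => intro j; simp [clockFrom]; omega
  | cons c cs ih =>
    intro j
    simp only [clockFrom, List.mem_append, ticks, ih, List.mem_cons, List.not_mem_nil,
      tick.injEq, reduceCtorEq, List.length_cons, false_or, or_false]
    omega

theorem check_mem_clockFrom {y : ℕ} (cs : List (Clause N)) :
    ∀ j, check y ∈ clockFrom j cs ↔ j ≤ y ∧ y < j + cs.length := by
  induction cs with
  | nil => intro j; simp [clockFrom]
  | cons c cs ih =>
    intro j
    simp only [clockFrom, List.mem_append, ticks, ih, List.mem_cons, List.not_mem_nil,
      check.injEq, reduceCtorEq, List.length_cons, false_or, or_false]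
    omega

/-- From here on the occurrence of an event is a matter of index ranges, and no recursion over the
clause list is needed to find one. -/
theorem isName_iff (cs : List (Clause N)) (e : Ev) :
    IsName cs e ↔ own e ∈ owners N ∧ e ∈ threadOf cs (own e) := by
  cases e with
  | early i b y =>
    simp only [IsName, own_early, mem_owners_some, threadOf, litThread, List.mem_append, coreEvents,
      early_mem_litThreadFrom, List.mem_cons, List.not_mem_nil, early.injEq, reduceCtorEq]
    refine and_congr_right fun _ => ?_
    simp
    omega
  | late i b y =>
    simp only [IsName, own_late, mem_owners_some, threadOf, litThread, List.mem_append, coreEvents,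
      late_mem_litThreadFrom, List.mem_cons, List.not_mem_nil, late.injEq, reduceCtorEq]
    refine and_congr_right fun _ => ?_
    simp
    omega
  | sync i b y =>
    simp only [IsName, own_sync, mem_owners_some, threadOf, litThread, List.mem_append, coreEvents,
      sync_mem_litThreadFrom, List.mem_cons, List.not_mem_nil, sync.injEq, reduceCtorEq]
    refine and_congr_right fun _ => ?_
    simp
    omega
  | choice i b y =>
    simp only [IsName, own_choice, mem_owners_some, threadOf, litThread, List.mem_append,
      coreEvents, choice_mem_litThreadFrom, List.mem_cons, List.not_mem_nil, choice.injEq,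
      reduceCtorEq]
    refine and_congr_right fun _ => ?_
    simp
    omega
  | lit i b j k =>
    simp [IsName, mem_owners_some, threadOf, litThread, coreEvents, lit_mem_litThreadFrom]
  | tick j k =>
    simp only [IsName, own_tick, mem_owners_none, threadOf, clockThread, List.mem_append, ticks,
      tick_mem_clockFrom, List.mem_cons, List.not_mem_nil, tick.injEq, or_false, true_and]
    omega
  | check j =>
    simp [IsName, mem_owners_none, threadOf, clockThread, ticks, check_mem_clockFrom]

theorem isName_nameOf (cs : List (Clause N)) (e : (clauseExec cs).Event) :
    IsName cs (nameOf e) :=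
  (isName_iff cs _).2 ⟨(isNaming_threadOf cs).own_mem e, (isNaming_threadOf cs).nameOf_mem_own e⟩

theorem exists_event {cs : List (Clause N)} {g : Ev} (h : IsName cs g) :
    ∃ e : (clauseExec cs).Event, nameOf e = g :=
  exists_nameOf ((isName_iff cs g).1 h).1 ((isName_iff cs g).1 h).2

end Membership

/-! ### Locations -/

namespace Ev

def row : Ev → ℕ
  | early i _ _ => i + 2
  | late i _ _ => i + 2
  | sync _ _ _ => 0
  | choice i _ _ => i + 2
  | lit _ _ _ _ => 1
  | tick _ _ => 0
  | check _ => 1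

def col : Ev → ℕ
  | early _ _ y => y
  | late _ _ y => y
  | sync _ _ j => j
  | choice _ _ j => j + 1
  | lit _ _ j _ => j
  | tick j _ => j
  | check j => j

theorem loc_eq (W : ℕ) (e : Ev) : (op W e).loc = row e * W + col e := by
  cases e <;> simp [op, row, col]

end Ev

theorem IsName.col_lt {N : ℕ} {cs : List (Clause N)} {e : Ev} (h : IsName cs e) :
    col e < cs.length + 3 := by
  cases e with
  | lit i b j k =>
    obtain ⟨_, _, c, hc, _⟩ := h
    obtain ⟨hj, _⟩ := List.getElem?_eq_some_iff.1 hc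
    simp only [col]
    omega
  | _ => simp only [IsName] at h; simp only [col]; omega

/-- Columns are smaller than the width, so the row is recovered as a quotient. -/
theorem loc_eq_iff {N : ℕ} {cs : List (Clause N)} {e e' : Ev} (h : IsName cs e)
    (h' : IsName cs e') : (op (cs.length + 3) e).loc = (op (cs.length + 3) e').loc ↔
      row e = row e' ∧ col e = col e' := by
  rw [loc_eq, loc_eq]
  refine ⟨fun he => ?_, fun ⟨h1, h2⟩ => by rw [h1, h2]⟩
  have h1 := h.col_lt
  have h2 := h'.col_lt
  have hd := congrArg (· / (cs.length + 3)) he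
  simp only [Nat.add_comm _ (col _), Nat.add_mul_div_right _ _ (Nat.succ_pos (cs.length + 2)),
    Nat.div_eq_of_lt h1, Nat.div_eq_of_lt h2, Nat.zero_add] at hd
  refine ⟨hd, ?_⟩
  rw [hd] at he
  omega

/-! ### A satisfying assignment yields a consistent execution -/

section Sound

variable {N : ℕ}

namespace Ev

/-- A linear order of execution: the thread of a literal made true by `A` runs ahead of that of its
negation. -/
def time (A : ℕ → Bool) (e : Ev) : ℕ :=
  key e + match own e with
    | some (i, b) => if A i = b then 0 else 115
    | none => 0

/-- The write from which a read reads, where `J j` names a write made by the thread of a true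
literal of clause `j`. -/
def src (A : ℕ → Bool) (J : ℕ → Ev) : Ev → Ev
  | sync _ _ j => tick j 3
  | choice i b j => if A i = b then early i (!b) (j + 1) else late i (!b) (j + 1)
  | check j => J j
  | e => e

end Ev

theorem time_lt_of_key_lt (A : ℕ → Bool) {e e' : Ev} (ho : own e = own e')
    (hk : key e < key e') : time A e < time A e' := by
  unfold time
  rw [ho]
  omega

variable {cs : List (Clause N)} {A : ℕ → Bool} {J : ℕ → Ev}

/-- `J j` names a write made for clause `j` by the thread of a literal that is true under `A`. -/
def ServesChecks (cs : List (Clause N)) (A : ℕ → Bool) (J : ℕ → Ev) : Prop :=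
  ∀ j < cs.length, ∃ i b k, J j = lit i b j k ∧ A i = b ∧ IsName cs (lit i b j k)

/-- The only delicate reads are the `choice` events, and they dictate the delay: it must lie
strictly between 110 and 120, whence 115. -/
theorem src_spec (hJ : ServesChecks cs A J) {e : Ev} (he : IsName cs e)
    (hr : (op (cs.length + 3) e).kind = .read) :
    IsName cs (src A J e) ∧ (op (cs.length + 3) (src A J e)).kind = .write ∧
      row (src A J e) = row e ∧ col (src A J e) = col e ∧
      (op (cs.length + 3) (src A J e)).val = (op (cs.length + 3) e).val ∧
      time A (src A J e) < time A e := by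
  cases e with
  | early => cases hr
  | late => cases hr
  | lit => cases hr
  | tick => cases hr
  | sync i b j =>
    simp only [IsName] at he
    refine ⟨⟨he.2, by omega⟩, rfl, rfl, rfl, rfl, ?_⟩
    simp only [src, time, own_tick, own_sync, key_tick, key_sync]
    omega
  | choice i b j =>
    simp only [IsName] at he
    by_cases h : A i = b
    · simp only [src, h, if_true]
      refine ⟨⟨he.1, by omega⟩, rfl, rfl, rfl, rfl, ?_⟩
      -- The leader reads the delayed `early` write: 100j + 100 + 115 < 100j + 220.
      simp only [time, own_early, own_choice, key_early, key_choice, h, if_true]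
      split_ifs <;> omega
    · simp only [src, h, if_false]
      have h' : A i = !b := by cases hA : A i <;> cases b <;> simp_all
      refine ⟨⟨he.1, by omega⟩, rfl, rfl, rfl, rfl, ?_⟩
      -- The trailing thread reads the leader's `late` write: 100j + 330 < 100j + 220 + 115.
      simp only [time, own_late, own_choice, key_late, key_choice, h', if_true]
      simp
      omega
  | check j =>
    obtain ⟨i, b, k, h1, h2, h3⟩ := hJ j he
    simp only [src, h1]
    refine ⟨h3, rfl, rfl, rfl, rfl, ?_⟩
    have hk : k < 4 := h3.2.1
    simp only [time, own_lit, own_check, key_lit, key_check, h2, if_true]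
    omega

/-- Distinctness of times is what makes the order by time total on the writes of a location. -/
theorem time_ne_of_write {e e' : Ev} (he : IsName cs e) (he' : IsName cs e')
    (hw : (op (cs.length + 3) e).kind = .write) (hw' : (op (cs.length + 3) e').kind = .write)
    (hr : row e = row e') (hc : col e = col e') (hne : e ≠ e') : time A e ≠ time A e' := by
  cases e <;> cases e' <;> (first | cases hw; done | cases hw'; done | skip) <;>
    simp only [row, col] at hr hc <;> (first | omega | skip)
  case early.early i b y i' b' y' =>
    obtain rfl : i = i' := by omega
    subst hc
    have hb : b ≠ b' := fun h => hne (by rw [h])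
    simp only [time, own_early, key_early]
    cases hA : A i <;> cases b <;> cases b' <;> simp_all
  case early.late i b y i' b' y' =>
    subst hc
    simp only [time, own_early, key_early, own_late, key_late]
    split_ifs <;> omega
  case late.early i b y i' b' y' =>
    subst hc
    simp only [time, own_early, key_early, own_late, key_late]
    split_ifs <;> omega
  case late.late i b y i' b' y' =>
    obtain rfl : i = i' := by omega
    subst hc
    have hb : b ≠ b' := fun h => hne (by rw [h])
    simp only [time, own_late, key_late]
    cases hA : A i <;> cases b <;> cases b' <;> simp_all
  case lit.lit i b j k i' b' j' k' =>
    subst hc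
    obtain ⟨_, hk, c, hc, hl⟩ := he
    obtain ⟨_, hk', c', hc', hl'⟩ := he'
    have hkk : k ≠ k' := by
      rintro rfl
      rw [hc] at hc'
      cases hc'
      exact hne (by rw [← hl.1, ← hl'.1, ← hl.2, ← hl'.2])
    -- The key offsets differ by a nonzero multiple of 10, which a delay of 115 in one of the
    -- threads cannot cancel.
    simp only [time, own_lit, key_lit]
    split_ifs <;> omega
  case tick.tick j k j' k' =>
    subst hc
    have hkk : k ≠ k' := fun h => hne (by rw [h])
    simp only [time, own_tick, key_tick]
    omega

/-- The only event before a read in its thread that is on the same location is the write `early`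
before a `choice`. -/
theorem eq_early_of_key_lt {e r : Ev} (he : IsName cs e) (hr : IsName cs r)
    (hrr : (op (cs.length + 3) r).kind = .read) (ho : own e = own r) (hk : key e < key r)
    (hrow : row e = row r) (hcol : col e = col r) :
    ∃ i b j, r = choice i b j ∧ e = early i b (j + 1) := by
  cases e <;> cases r <;> (first | cases hrr; done | skip) <;>
    simp only [row, col] at hrow hcol <;> (first | omega | skip) <;>
    dsimp at ho hk <;> (first | cases ho; done | omega | skip)
  case early.choice =>
    cases ho
    exact ⟨_, _, _, rfl, by rw [hcol]⟩

/-- A leader reads an `early` write delayed against its own; a trailing thread reads a `late` write,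
which is far later. In either case a `choice` never reads a write older than its own thread's
`early` write. -/
theorem time_early_lt_src {i j : ℕ} {b : Bool} :
    time A (early i b (j + 1)) < time A (src A J (choice i b j)) := by
  by_cases h : A i = b
  · simp only [src, h, if_true, time, own_early, key_early]
    simp
  · have h' : A i = !b := by cases hA : A i <;> cases b <;> simp_all
    simp only [src, h, if_false, time, own_early, key_early, own_late, key_late]
    simp only [h', if_true]
    omega

/-- With rf given by `src` and mo by time, po, rf and mo all increase `time`. This settles
acyclicity and write coherence at once. Read coherence can fail only at a read preceded in its
thread by an event on the same location, which leaves the `choice` events. -/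
theorem relaxedConsistent_of_servesChecks (hJ : ServesChecks cs A J) :
    (clauseExec cs).RelaxedConsistent := by
  have hn := isNaming_threadOf cs
  let n : (clauseExec cs).Event → Ev := nameOf
  have hop : ∀ e, (clauseExec cs).op e = op (cs.length + 3) (n e) := op_nameOf
  have hname : ∀ e, IsName cs (n e) := isName_nameOf cs
  have hpo : ∀ a b, (clauseExec cs).po a b ↔ own (n a) = own (n b) ∧ key (n a) < key (n b) :=
    hn.po_iff
  have hloc : ∀ a b, ((clauseExec cs).op a).loc = ((clauseExec cs).op b).loc ↔
      row (n a) = row (n b) ∧ col (n a) = col (n b) := fun a b => by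
    rw [hop, hop, loc_eq_iff (hname a) (hname b)]
  have hspec : ∀ r, (clauseExec cs).IsRead r → _ := fun r hr =>
    src_spec hJ (hname r) (by rw [← hop]; exact hr)
  have hpot : ∀ a b, (clauseExec cs).po a b → time A (n a) < time A (n b) := fun a b h =>
    time_lt_of_key_lt A ((hpo a b).1 h).1 ((hpo a b).1 h).2
  refine ⟨fun w r => (clauseExec cs).IsRead r ∧ n w = src A J (n r),
    fun a b => (clauseExec cs).IsWrite a ∧ (clauseExec cs).IsWrite b ∧
      ((clauseExec cs).op a).loc = ((clauseExec cs).op b).loc ∧ time A (n a) < time A (n b),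
    ⟨?_, fun h => h.1, ?_, ?_, ?_⟩, ⟨fun h => h.1, fun h => h.2.1, fun h => h.2.2.1, ?_, ?_, ?_⟩,
    ?_, ?_, ?_⟩
  · rintro w r ⟨hr, hw⟩
    rw [PartialExec.IsWrite, hop, hw]
    exact (hspec r hr).2.1
  · rintro w r ⟨hr, hw⟩
    rw [hloc, hw]
    exact ⟨(hspec r hr).2.2.1, (hspec r hr).2.2.2.1⟩
  · rintro w r ⟨hr, hw⟩
    rw [hop, hop, hw]
    exact (hspec r hr).2.2.2.2.1
  · intro r hr
    obtain ⟨w, hw⟩ := exists_event (hspec r hr).1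
    exact ⟨w, ⟨hr, hw⟩, fun w' hw' => hn.nameOf_injective (hw'.2.trans hw.symm)⟩
  · exact fun a h => lt_irrefl _ h.2.2.2
  · exact fun h h' => ⟨h.1, h'.2.1, h.2.2.1.trans h'.2.2.1, h.2.2.2.trans h'.2.2.2⟩
  · intro a b ha hb hab hne
    have h := time_ne_of_write (A := A) (hname a) (hname b) (by rw [← hop]; exact ha)
      (by rw [← hop]; exact hb) ((hloc a b).1 hab).1 ((hloc a b).1 hab).2
      fun h => hne (hn.nameOf_injective h)
    rcases lt_or_gt_of_ne h with h | h
    · exact Or.inl ⟨ha, hb, hab, h⟩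
    · exact Or.inr ⟨hb, ha, hab.symm, h⟩
  · intro e he
    have key : ∀ a b, Relation.TransGen (fun a b => (clauseExec cs).po a b ∨
        ((clauseExec cs).IsRead b ∧ n a = src A J (n b))) a b → time A (n a) < time A (n b) := by
      intro a b h
      have step : ∀ {a b}, ((clauseExec cs).po a b ∨
          ((clauseExec cs).IsRead b ∧ n a = src A J (n b))) → time A (n a) < time A (n b) := by
        rintro a b (h | ⟨hr, hw⟩)
        · exact hpot a b h
        · rw [hw]
          exact (hspec b hr).2.2.2.2.2
      induction h with
      | single h => exact step h
      | tail _ h ih => exact ih.trans (step h)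
    exact lt_irrefl _ (key e e he)
  · rintro x e ⟨a, ⟨_, hmo, _⟩, hab⟩
    exact lt_asymm hmo.2.2.2 (hpot _ _ hab)
  · rintro x r ⟨w, ⟨hr, hw⟩, w', ⟨_, ⟨_, hw'w, hll, hlt⟩, _⟩, e', hrf, hpo'⟩
    have hlw : ((clauseExec cs).op w).loc = ((clauseExec cs).op r).loc := by
      rw [hloc, hw]
      exact ⟨(hspec r hr).2.2.1, (hspec r hr).2.2.2.1⟩
    have hle : ((clauseExec cs).op w').loc = ((clauseExec cs).op e').loc := by
      rcases hrf with _ | ⟨hr', hw'⟩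
      · rfl
      · rw [hloc, hw']
        exact ⟨(hspec e' hr').2.2.1, (hspec e' hr').2.2.2.1⟩
    obtain ⟨hrow, hcol⟩ := (hloc e' r).1 (hle.symm.trans (hll.symm.trans hlw))
    obtain ⟨i, b, j, hr', he'⟩ := eq_early_of_key_lt (hname e') (hname r) (by rw [← hop]; exact hr)
      ((hpo _ _).1 hpo').1 ((hpo _ _).1 hpo').2 hrow hcol
    -- If the event before r is the mo-later write itself, then it is the `early` write and is older
    -- than the source of r. Otherwise it would be a read, but `early` is a write.
    rcases hrf with _ | ⟨hre, _⟩
    · rw [hw, hr', he'] at hlt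
      exact lt_asymm hlt time_early_lt_src
    · rw [PartialExec.IsRead, hop, he'] at hre
      cases hre

theorem relaxedConsistent_of_satisfied (A : Fin N → Bool)
    (hA : ∀ c ∈ cs, ∃ k : Fin 3, A (c k).1 = (c k).2) : (clauseExec cs).RelaxedConsistent := by
  classical
  let A' : ℕ → Bool := fun i => if h : i < N then A ⟨i, h⟩ else false
  have hA' : ∀ i : Fin N, A' i = A i := fun i => by simp [A']
  have hJ : ∀ j, ∃ e, j < cs.length →
      ∃ i b k, e = lit i b j k ∧ A' i = b ∧ IsName cs (lit i b j k) := by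
    intro j
    by_cases hj : j < cs.length
    · obtain ⟨q, hq⟩ := hA cs[j] (List.getElem_mem hj)
      obtain ⟨k, hk, rfl⟩ : ∃ k < 4, slot k = q := by
        fin_cases q
        · exact ⟨3, by omega, rfl⟩
        · exact ⟨2, by omega, rfl⟩
        · exact ⟨0, by omega, rfl⟩
      refine ⟨lit (cs[j] (slot k)).1 (cs[j] (slot k)).2 j k, fun _ => ⟨_, _, _, rfl, ?_, ?_⟩⟩
      · rw [hA', hq]
      · exact ⟨Fin.is_lt _, hk, _, List.getElem?_eq_getElem hj, rfl, rfl⟩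
    · exact ⟨check 0, fun h => absurd h hj⟩
  choose J hJ using hJ
  exact relaxedConsistent_of_servesChecks (A := A') (J := J) fun j hj => hJ j hj

end Sound

/-! ### A consistent execution yields a satisfying assignment -/

section Complete

variable {N : ℕ}

/-- In a consistent execution, the thread of `(i, b)` is behind that of its negation at `j`. -/
def Behind {cs : List (Clause N)} (rf : (clauseExec cs).Event → (clauseExec cs).Event → Prop)
    (i : ℕ) (b : Bool) (j : ℕ) : Prop :=
  ∃ w r, rf w r ∧ nameOf w = late i (!b) (j + 1) ∧ nameOf r = choice i b j

variable {cs : List (Clause N)} {rf mo : (clauseExec cs).Event → (clauseExec cs).Event → Prop}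

theorem clauseExec_po_iff (a b : (clauseExec cs).Event) :
    (clauseExec cs).po a b ↔
      own (nameOf a) = own (nameOf b) ∧ key (nameOf a) < key (nameOf b) :=
  (isNaming_threadOf cs).po_iff a b

theorem clauseExec_op (e : (clauseExec cs).Event) :
    (clauseExec cs).op e = op (cs.length + 3) (nameOf e) := op_nameOf e

theorem clauseExec_loc_iff (a b : (clauseExec cs).Event) :
    ((clauseExec cs).op a).loc = ((clauseExec cs).op b).loc ↔
      row (nameOf a) = row (nameOf b) ∧ col (nameOf a) = col (nameOf b) := by
  rw [clauseExec_op, clauseExec_op, loc_eq_iff (isName_nameOf cs a) (isName_nameOf cs b)]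

theorem exists_source (hrf : (clauseExec cs).IsReadsFrom rf) {r : (clauseExec cs).Event}
    (hr : (op (cs.length + 3) (nameOf r)).kind = .read) :
    ∃ w, rf w r ∧ (op (cs.length + 3) (nameOf w)).kind = .write ∧
      row (nameOf w) = row (nameOf r) ∧ col (nameOf w) = col (nameOf r) ∧
      (op (cs.length + 3) (nameOf w)).val = (op (cs.length + 3) (nameOf r)).val := by
  obtain ⟨w, hw, -⟩ := hrf.existsUnique r (by rw [PartialExec.IsRead, clauseExec_op]; exact hr)
  refine ⟨w, hw, ?_, ((clauseExec_loc_iff _ _).1 (hrf.loc_eq hw)).1,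
    ((clauseExec_loc_iff _ _).1 (hrf.loc_eq hw)).2, ?_⟩
  · rw [← clauseExec_op]
    exact hrf.isWrite hw
  · rw [← clauseExec_op, ← clauseExec_op]
    exact hrf.val_eq hw

/-- The thread with the mo-later `early` write at column j + 1 is behind: by its value, its `choice`
reads from the opponent, and the opponent's `early` write is already overwritten from its point of
view. -/
theorem exists_behind (hrf : (clauseExec cs).IsReadsFrom rf)
    (hmo : (clauseExec cs).IsModificationOrder mo)
    (hco : (clauseExec cs).RelaxedReadCoherent rf mo) {i j : ℕ} (hi : i < N)
    (hj : j ≤ cs.length) : ∃ b, Behind rf i b j := by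
  have hE : ∀ b, ∃ e : (clauseExec cs).Event, nameOf e = early i b (j + 1) := fun b =>
    exists_event (cs := cs) ⟨hi, by omega⟩
  choose E hE using hE
  have hEw : ∀ b, (clauseExec cs).IsWrite (E b) := fun b => by
    rw [PartialExec.IsWrite, clauseExec_op, hE]
    rfl
  have hEl : ∀ b b', ((clauseExec cs).op (E b)).loc = ((clauseExec cs).op (E b')).loc :=
    fun b b' => by
      rw [clauseExec_loc_iff, hE, hE]
      exact ⟨rfl, rfl⟩
  obtain ⟨b, hb⟩ : ∃ b, mo (E (!b)) (E b) := by
    have hne : E true ≠ E false := fun h => by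
      have h1 := hE true
      rw [h, hE] at h1
      cases h1
    rcases hmo.total _ _ (hEw true) (hEw false) (hEl _ _) hne with h | h
    · exact ⟨false, h⟩
    · exact ⟨true, h⟩
  obtain ⟨r, hr⟩ := exists_event (cs := cs) (g := choice i b j) ⟨hi, hj⟩
  obtain ⟨w, hw, hwk, hrow, hcol, hval⟩ := exists_source hrf (r := r) (by rw [hr]; rfl)
  refine ⟨b, w, r, hw, ?_, hr⟩
  have hb' : ∀ c : Bool, c.toNat = (!b).toNat → c = !b := by cases b <;> decide
  rw [hr] at hrow hcol hval
  cases hwn : nameOf w with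
  | early i' b' y =>
    exfalso
    rw [hwn] at hrow hcol hval
    simp only [row, col, op] at hrow hcol hval
    obtain rfl : i' = i := by omega
    subst hcol
    rw [hb' _ hval] at hwn
    obtain rfl : w = E (!b) :=
      (isNaming_threadOf cs).nameOf_injective (hwn.trans (hE _).symm)
    -- The forbidden cycle: r reads from E (!b), which is mo-before E b, which precedes r in program
    -- order; the optional rf step is trivial.
    refine hco ((clauseExec cs).op (E b)).loc r
      ⟨_, hw, E b, ⟨hEl _ _, hb, rfl⟩, E b, Relation.ReflGen.refl, ?_⟩
    rw [clauseExec_po_iff, hE, hr]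
    exact ⟨rfl, by dsimp; omega⟩
  | late i' b' y =>
    rw [hwn] at hrow hcol hval
    simp only [row, col, op] at hrow hcol hval
    obtain rfl : i' = i := by omega
    rw [hb' _ hval, hcol]
  | lit => rw [hwn] at hrow; simp only [row] at hrow; omega
  | tick => rw [hwn] at hrow; simp only [row] at hrow; omega
  | sync => rw [hwn] at hwk; cases hwk
  | choice => rw [hwn] at hwk; cases hwk
  | check => rw [hwn] at hwk; cases hwk

/-- The cycle is `late (j + 1)` of ¬b, `choice j` of b, `late (j + 2)` of b, `choice (j + 1)` of ¬b
and back, alternating rf and po. -/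
theorem Behind.not_succ (hac : (clauseExec cs).PorfAcyclic rf) {i j : ℕ} {b : Bool}
    (h : Behind rf i b j) (h' : Behind rf i (!b) (j + 1)) : False := by
  obtain ⟨w, r, hwr, hw, hr⟩ := h
  obtain ⟨w', r', hwr', hw', hr'⟩ := h'
  rw [Bool.not_not] at hw'
  refine hac w (Relation.TransGen.head (Or.inr hwr) (Relation.TransGen.head (b := w') (Or.inl ?_)
    (Relation.TransGen.head (Or.inr hwr') (Relation.TransGen.single (Or.inl ?_)))))
  · rw [clauseExec_po_iff, hr, hw']
    exact ⟨rfl, by dsimp; omega⟩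
  · rw [clauseExec_po_iff, hr', hw]
    exact ⟨rfl, by dsimp; omega⟩

theorem Behind.of_le (hrf : (clauseExec cs).IsReadsFrom rf)
    (hmo : (clauseExec cs).IsModificationOrder mo) (hac : (clauseExec cs).PorfAcyclic rf)
    (hco : (clauseExec cs).RelaxedReadCoherent rf mo) {i j : ℕ} {b : Bool} (hi : i < N)
    (h : Behind rf i b 0) (hj : j ≤ cs.length) : Behind rf i b j := by
  induction j with
  | zero => exact h
  | succ j ih =>
    obtain ⟨b', hb'⟩ := exists_behind hrf hmo hco hi hj
    by_cases hbb : b' = b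
    · rwa [← hbb]
    · have : b' = !b := by cases b <;> cases b' <;> simp_all
      rw [this] at hb'
      exact ((ih (by omega)).not_succ hac hb').elim

/-- The literal is the one whose write the check reads. Were its thread behind, there would be a
cycle: check j, a tick of round j + 1, the opponent's `sync (j + 1)`, its `late (j + 1)`, `choice
j`, the clause write, check j. It does not matter which of the four ticks `sync` reads. -/
theorem exists_lit_not_behind (hrf : (clauseExec cs).IsReadsFrom rf)
    (hac : (clauseExec cs).PorfAcyclic rf) {j : ℕ} (hj : j < cs.length) :
    ∃ k : Fin 3, ¬ Behind rf (cs[j] k).1 (cs[j] k).2 j := by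
  obtain ⟨r, hr⟩ := exists_event (cs := cs) (g := check j) hj
  obtain ⟨w, hw, hwk, hrow, hcol, -⟩ := exists_source hrf (r := r) (by rw [hr]; rfl)
  rw [hr] at hrow hcol
  cases hwn : nameOf w with
  | lit i b j' k =>
    rw [hwn] at hcol
    obtain rfl : j' = j := hcol
    have hname := isName_nameOf cs w
    rw [hwn] at hname
    obtain ⟨hi, -, c, hc, hl⟩ := hname
    rw [List.getElem?_eq_getElem hj, Option.some.injEq] at hc
    refine ⟨slot k, fun hB => ?_⟩
    rw [hc, hl.1, hl.2] at hB
    obtain ⟨l, q, hlq, hln, hqn⟩ := hB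
    obtain ⟨s, hs⟩ := exists_event (cs := cs) (g := sync i (!b) (j' + 1)) ⟨hi, hj⟩
    obtain ⟨t, ht, htk, hrow', hcol', -⟩ := exists_source hrf (r := s) (by rw [hs]; rfl)
    rw [hs] at hrow' hcol'
    cases htn : nameOf t with
    | tick y k' =>
      rw [htn] at hcol'
      obtain rfl : y = j' + 1 := hcol'
      refine hac r (Relation.TransGen.head (b := t) (Or.inl ?_) (Relation.TransGen.head (Or.inr ht)
        (Relation.TransGen.head (b := l) (Or.inl ?_) (Relation.TransGen.head (Or.inr hlq)
          (Relation.TransGen.head (b := w) (Or.inl ?_) (Relation.TransGen.single (Or.inr hw)))))))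
      · rw [clauseExec_po_iff, hr, htn]
        exact ⟨rfl, by dsimp; omega⟩
      · rw [clauseExec_po_iff, hs, hln]
        exact ⟨rfl, by dsimp; omega⟩
      · rw [clauseExec_po_iff, hqn, hwn]
        exact ⟨rfl, by dsimp; omega⟩
    | early => rw [htn] at hrow'; simp only [row] at hrow'; omega
    | late => rw [htn] at hrow'; simp only [row] at hrow'; omega
    | lit => rw [htn] at hrow'; simp only [row] at hrow'; omega
    | sync => rw [htn] at htk; cases htk
    | choice => rw [htn] at htk; cases htk
    | check => rw [htn] at htk; cases htk
  | early => rw [hwn] at hrow; simp only [row] at hrow; omega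
  | late => rw [hwn] at hrow; simp only [row] at hrow; omega
  | tick => rw [hwn] at hrow; simp only [row] at hrow; omega
  | sync => rw [hwn] at hwk; cases hwk
  | choice => rw [hwn] at hwk; cases hwk
  | check => rw [hwn] at hwk; cases hwk

theorem relaxedConsistent_clauseExec_iff (cs : List (Clause N)) :
    (clauseExec cs).RelaxedConsistent ↔
      ∃ A : Fin N → Bool, ∀ c ∈ cs, ∃ k : Fin 3, A (c k).1 = (c k).2 := by
  classical
  refine ⟨?_, fun ⟨A, hA⟩ => relaxedConsistent_of_satisfied A hA⟩
  rintro ⟨rf, mo, hrf, hmo, hac, -, hco⟩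
  -- Round 0 fixes the assignment and `Behind.of_le` carries it to the later rounds. Both threads of
  -- a variable might be behind in round 0; then no literal of it is used, since neither can serve a
  -- check.
  refine ⟨fun i => decide (¬ Behind rf i true 0), fun c hc => ?_⟩
  obtain ⟨j, hj, rfl⟩ := List.getElem_of_mem hc
  obtain ⟨k, hk⟩ := exists_lit_not_behind hrf hac hj
  refine ⟨k, ?_⟩
  have hlt := (cs[j] k).1.is_lt
  have hall : ∀ b, Behind rf (cs[j] k).1 b 0 → b ≠ (cs[j] k).2 := by
    rintro b hb rfl
    exact hk (hb.of_le hrf hmo hac hco hlt hj.le)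
  obtain ⟨b, hb⟩ := exists_behind hrf hmo hco hlt (Nat.zero_le cs.length)
  cases h : (cs[j] k).2
  · have hb1 := hall b hb
    rw [h] at hb1
    have : b = true := by simpa using hb1
    subst this
    simpa using hb
  · have : ¬ Behind rf (cs[j] k).1 true 0 := fun hB => hall true hB h.symm
    simpa using this

end Complete

/-! ### The shape of the partial execution graph -/

/-- Counts over all threads reduce to sums over variables plus the clock's share. -/
theorem sum_owners (N : ℕ) (f : Option (ℕ × Bool) → ℕ) :
    ((owners N).map f).sum =
      (∑ i ∈ Finset.range N, (f (some (i, true)) + f (some (i, false)))) + f none := by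
  rw [owners, List.map_append, List.sum_append]
  congr 1
  · induction N with
    | zero => simp
    | succ N ih =>
      rw [List.range_succ, List.flatMap_append, List.map_append, List.sum_append, ih,
        Finset.sum_range_succ]
      simp

section Shape

variable {N : ℕ}

/-- Is this the name of a write to the location in the given row and column? -/
def writesAt (r c : ℕ) (e : Ev) : Bool :=
  decide ((op 0 e).kind = .write ∧ row e = r ∧ col e = c)

theorem isName_of_mem {cs : List (Clause N)} {o : Option (ℕ × Bool)} (ho : o ∈ owners N) {e : Ev}
    (he : e ∈ threadOf cs o) : IsName cs e := by
  rw [isName_iff, own_of_mem_threadOf he]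
  exact ⟨ho, he⟩

theorem countP_isWriteTo {cs : List (Clause N)} {o : Option (ℕ × Bool)} (ho : o ∈ owners N)
    {g : Ev} (hg : IsName cs g) :
    ((threadOf cs o).map (op (cs.length + 3))).countP
      (fun p => p.isWriteTo (op (cs.length + 3) g).loc) =
      (threadOf cs o).countP (writesAt (row g) (col g)) := by
  rw [List.countP_map]
  refine List.countP_congr fun e he => ?_
  have h := loc_eq_iff (isName_of_mem ho he) hg
  have hk : (op (cs.length + 3) e).kind = (op 0 e).kind := by cases e <;> rfl
  simp only [Function.comp, MemOp.isWriteTo, writesAt, decide_eq_true_eq, h, hk]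

theorem countP_litEvents_of_ne {i j r c : ℕ} {b : Bool} (C : Clause N) (h : r ≠ 1) :
    (litEvents i b j C).countP (writesAt r c) = 0 := by
  rw [List.countP_eq_zero]
  intro e he
  obtain ⟨k, rfl⟩ := mem_litEvents_of he
  simp [writesAt, row, h.symm]

/-- The number of writes for a clause that the thread of `(i, b)` makes. -/
def litCount (i : ℕ) (b : Bool) (C : Clause N) : ℕ :=
  (if IsLit i b (C 2) then 2 else 0) +
    ((if IsLit i b (C 1) then 1 else 0) + (if IsLit i b (C 0) then 1 else 0))

theorem countP_litEvents_one {i j c : ℕ} {b : Bool} (C : Clause N) :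
    (litEvents i b j C).countP (writesAt 1 c) = if j = c then litCount i b C else 0 := by
  unfold litEvents litCount
  simp only [List.countP_append]
  split_ifs <;> simp_all [writesAt, row, col, op]

theorem countP_litThreadFrom_self {i c : ℕ} {b : Bool} (cs : List (Clause N)) :
    ∀ j, (litThreadFrom i b j cs).countP (writesAt (i + 2) c) =
      (if j + 3 ≤ c ∧ c ≤ j + 2 + cs.length then 1 else 0) +
        (if j + 1 ≤ c ∧ c ≤ j + 2 + cs.length then 1 else 0) := by
  induction cs with
  | nil =>
    intro j
    simp only [litThreadFrom, List.countP_cons, List.countP_nil, writesAt, op, row, col,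
      List.length_nil, true_and, decide_eq_true_eq]
    split_ifs <;> omega
  | cons C cs ih =>
    intro j
    simp only [litThreadFrom, coreEvents, List.countP_append, List.countP_cons, List.countP_nil,
      ih, countP_litEvents_of_ne C (show i + 2 ≠ 1 by omega), writesAt, op, row, col,
      List.length_cons, true_and, decide_eq_true_eq, reduceCtorEq, false_and, if_false]
    split_ifs <;> omega

theorem countP_litThreadFrom_of_ne {i r c : ℕ} {b : Bool} (h1 : r ≠ 1) (h2 : r ≠ i + 2)
    (cs : List (Clause N)) :
    ∀ j, (litThreadFrom i b j cs).countP (writesAt r c) = 0 := by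
  induction cs with
  | nil => intro j; simp [litThreadFrom, writesAt, row, h2.symm]
  | cons C cs ih =>
    intro j
    simp [litThreadFrom, coreEvents, List.countP_append, ih, countP_litEvents_of_ne C h1,
      writesAt, row, op, h2.symm]

theorem countP_litThreadFrom_one {i c : ℕ} {b : Bool} (cs : List (Clause N)) :
    ∀ j, (litThreadFrom i b j cs).countP (writesAt 1 c) =
      if j ≤ c then (cs[c - j]?.map (litCount i b)).getD 0 else 0 := by
  induction cs with
  | nil => intro j; simp [litThreadFrom, writesAt, row]
  | cons C cs ih =>
    intro j
    have h : (coreEvents i b (j + 1)).countP (writesAt 1 c) = 0 := by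
      simp [coreEvents, writesAt, row, op]
    rw [litThreadFrom, List.countP_append, List.countP_append, ih, h, countP_litEvents_one]
    rcases lt_trichotomy j c with hj | rfl | hj
    · have e : c - j = (c - (j + 1)) + 1 := by omega
      rw [e, List.getElem?_cons_succ, if_neg hj.ne, if_pos hj.le, if_pos (show j + 1 ≤ c by omega)]
      omega
    · simp
    · rw [if_neg hj.ne', if_neg (by omega), if_neg (by omega)]

theorem countP_clockFrom_zero {c : ℕ} (cs : List (Clause N)) :
    ∀ j, (clockFrom j cs).countP (writesAt 0 c) =
      if j + 1 ≤ c ∧ c ≤ j + cs.length then 4 else 0 := by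
  induction cs with
  | nil => intro j; simp [clockFrom]
  | cons C cs ih =>
    intro j
    simp only [clockFrom, ticks, List.countP_append, List.countP_cons, List.countP_nil,
      ih, writesAt, op, row, col, List.length_cons, true_and, decide_eq_true_eq, reduceCtorEq,
      false_and, if_false]
    split_ifs <;> omega

theorem countP_clockFrom_of_ne {r c : ℕ} (h : r ≠ 0) (cs : List (Clause N)) :
    ∀ j, (clockFrom j cs).countP (writesAt r c) = 0 := by
  induction cs with
  | nil => intro j; simp [clockFrom]
  | cons C cs ih =>
    intro j
    simp [clockFrom, ticks, ih, writesAt, row, op, h.symm]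

theorem countP_litThread_self {i c : ℕ} {b : Bool} {cs : List (Clause N)}
    (hc : c ≤ cs.length + 2) :
    (litThread i b cs).countP (writesAt (i + 2) c) = 2 := by
  simp only [litThread, coreEvents, List.countP_append, List.countP_cons, List.countP_nil,
    countP_litThreadFrom_self, writesAt, op, row, col, true_and, decide_eq_true_eq, reduceCtorEq,
    false_and, if_false]
  split_ifs <;> omega

theorem countP_litThread_of_ne {i r c : ℕ} {b : Bool} (h1 : r ≠ 1) (h2 : r ≠ i + 2)
    (cs : List (Clause N)) : (litThread i b cs).countP (writesAt r c) = 0 := by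
  simp [litThread, coreEvents, countP_litThreadFrom_of_ne h1 h2, writesAt, op,
    row, h2.symm]

theorem countP_litThread_one {i c : ℕ} {b : Bool} {cs : List (Clause N)} (hc : c < cs.length) :
    (litThread i b cs).countP (writesAt 1 c) = litCount i b cs[c] := by
  simp [litThread, coreEvents, countP_litThreadFrom_one, writesAt, op, row, hc]

theorem countP_clockThread_zero {c : ℕ} {cs : List (Clause N)} (hc : c ≤ cs.length) :
    (clockThread cs).countP (writesAt 0 c) = 4 := by
  simp only [clockThread, ticks, List.countP_append, List.countP_cons, List.countP_nil,
    countP_clockFrom_zero, writesAt, op, row, col, true_and, decide_eq_true_eq]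
  split_ifs <;> omega

theorem countP_clockThread_of_ne {r c : ℕ} (h : r ≠ 0) (cs : List (Clause N)) :
    (clockThread cs).countP (writesAt r c) = 0 := by
  simp [clockThread, ticks, countP_clockFrom_of_ne h, writesAt, row, h.symm]

theorem sum_isLit (l : Fin N × Bool) :
    ∑ i ∈ Finset.range N, ((if IsLit i true l then 1 else 0) + (if IsLit i false l then 1 else 0)) =
      1 := by
  rw [Finset.sum_eq_single_of_mem (l.1 : ℕ) (Finset.mem_range.2 l.1.is_lt)]
  · cases h : l.2 <;> simp [IsLit, h]
  · intro i _ hi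
    simp [IsLit, hi.symm]

theorem sum_litCount (C : Clause N) :
    ∑ i ∈ Finset.range N, (litCount i true C + litCount i false C) = 4 := by
  have h : ∀ i, litCount i true C + litCount i false C =
      2 * ((if IsLit i true (C 2) then 1 else 0) + (if IsLit i false (C 2) then 1 else 0)) +
      (((if IsLit i true (C 1) then 1 else 0) + (if IsLit i false (C 1) then 1 else 0)) +
      ((if IsLit i true (C 0) then 1 else 0) + (if IsLit i false (C 0) then 1 else 0))) := by
    intro i
    unfold litCount
    split_ifs <;> rfl
  simp only [h]
  rw [Finset.sum_add_distrib, Finset.sum_add_distrib, ← Finset.mul_sum, sum_isLit, sum_isLit,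
    sum_isLit]
  rfl

/-- The first part gives four writes per location. The second, that one thread makes two of them,
leaves room for at most three writing threads. -/
theorem sum_countP_threadOf {cs : List (Clause N)} {g : Ev} (hg : IsName cs g) :
    ((owners N).map fun o => (threadOf cs o).countP (writesAt (row g) (col g))).sum = 4 ∧
      ∃ o ∈ owners N, 2 ≤ (threadOf cs o).countP (writesAt (row g) (col g)) := by
  have hvar : ∀ i < N, ∀ y ≤ cs.length + 2,
      ((owners N).map fun o => (threadOf cs o).countP (writesAt (i + 2) y)).sum = 4 ∧
        ∃ o ∈ owners N, 2 ≤ (threadOf cs o).countP (writesAt (i + 2) y) := by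
    intro i hi y hy
    refine ⟨?_, some (i, true), mem_owners_some.2 hi, (countP_litThread_self hy).ge⟩
    rw [sum_owners]
    simp only [threadOf, countP_clockThread_of_ne (show i + 2 ≠ 0 by omega)]
    rw [Finset.sum_eq_single_of_mem i (Finset.mem_range.2 hi), countP_litThread_self hy,
      countP_litThread_self hy]
    intro i' _ hi'
    rw [countP_litThread_of_ne (by omega) (by omega), countP_litThread_of_ne (by omega) (by omega)]
    rfl
  have hzero : ∀ j ≤ cs.length,
      ((owners N).map fun o => (threadOf cs o).countP (writesAt 0 j)).sum = 4 ∧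
        ∃ o ∈ owners N, 2 ≤ (threadOf cs o).countP (writesAt 0 j) := by
    intro j hj
    have h4 : (threadOf cs none).countP (writesAt 0 j) = 4 := countP_clockThread_zero hj
    refine ⟨?_, none, mem_owners_none, by omega⟩
    rw [sum_owners, h4, Finset.sum_eq_zero]
    intro i _
    simp only [threadOf]
    rw [countP_litThread_of_ne (by omega) (by omega), countP_litThread_of_ne (by omega) (by omega)]
    rfl
  have hone : ∀ j, j < cs.length →
      ((owners N).map fun o => (threadOf cs o).countP (writesAt 1 j)).sum = 4 ∧
        ∃ o ∈ owners N, 2 ≤ (threadOf cs o).countP (writesAt 1 j) := by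
    intro j hj
    -- The doubled third literal supplies a thread with two writes, even when the literals are
    -- distinct.
    refine ⟨?_, some ((cs[j] 2).1, (cs[j] 2).2), mem_owners_some.2 (Fin.is_lt _), ?_⟩
    · rw [sum_owners]
      simp only [threadOf, countP_clockThread_of_ne one_ne_zero, countP_litThread_one hj]
      exact sum_litCount _
    · simp only [threadOf, countP_litThread_one hj]
      simp [litCount, IsLit]
  cases g with
  | early i b y => exact hvar i hg.1 y hg.2
  | late i b y => exact hvar i hg.1 y hg.2
  | choice i b j => exact hvar i hg.1 (j + 1) (by have := hg.2; omega)
  | sync i b j => exact hzero j hg.2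
  | tick j k => exact hzero j hg.1
  | check j => exact hone j hg
  | lit i b j k =>
    obtain ⟨_, _, c, hc, _⟩ := hg
    exact hone j (List.getElem?_eq_some_iff.1 hc).1

theorem exists_name_of_mem {cs : List (Clause N)} {p : MemOp}
    (hp : p ∈ (clauseExec cs).threads.flatten) : ∃ g, IsName cs g ∧ op (cs.length + 3) g = p := by
  simp only [clauseExec, namedExec, List.mem_flatten, List.mem_map] at hp
  obtain ⟨_, ⟨o, ho, rfl⟩, hp⟩ := hp
  obtain ⟨g, hg, rfl⟩ := List.mem_map.1 hp
  exact ⟨g, isName_of_mem ho hg, rfl⟩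

theorem hasFourWritesPerLoc_clauseExec (cs : List (Clause N)) :
    (clauseExec cs).HasFourWritesPerLoc := by
  rintro x ⟨p, hp, rfl⟩
  obtain ⟨g, hg, rfl⟩ := exists_name_of_mem hp
  rw [← (sum_countP_threadOf hg).1, List.countP_flatten, clauseExec, namedExec, List.map_map]
  congr 1
  refine List.map_congr_left fun o ho => ?_
  exact countP_isWriteTo ho hg

theorem countP_pos_le_sum {ι : Type} (f : ι → ℕ) (l : List ι) :
    l.countP (fun a => decide (0 < f a)) ≤ (l.map f).sum := by
  induction l with
  | nil => simp
  | cons a l ih =>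
    rw [List.countP_cons, List.map_cons, List.sum_cons]
    split_ifs with h
    · have := of_decide_eq_true h
      omega
    · omega

theorem countP_pos_lt_sum {ι : Type} (f : ι → ℕ) (l : List ι) (h : ∃ a ∈ l, 2 ≤ f a) :
    l.countP (fun a => decide (0 < f a)) < (l.map f).sum := by
  induction l with
  | nil => simp at h
  | cons a l ih =>
    rw [List.countP_cons, List.map_cons, List.sum_cons]
    have hle := countP_pos_le_sum f l
    obtain ⟨a', ha', h2⟩ := h
    rcases List.mem_cons.1 ha' with rfl | hl
    · split_ifs <;> omega
    · have := ih ⟨a', hl, h2⟩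
      split_ifs with h
      · have := of_decide_eq_true h
        omega
      · omega

theorem isThreeWriter_clauseExec (cs : List (Clause N)) : (clauseExec cs).IsThreeWriter := by
  intro x
  by_cases hx : ∃ g, IsName cs g ∧ (op (cs.length + 3) g).loc = x
  · obtain ⟨g, hg, rfl⟩ := hx
    obtain ⟨h4, h2⟩ := sum_countP_threadOf hg
    have h := countP_pos_lt_sum _ _ h2
    rw [h4] at h
    refine le_trans (le_of_eq ?_) (Nat.le_of_lt_succ h)
    rw [clauseExec, namedExec, List.countP_map]
    refine List.countP_congr fun o ho => ?_
    rw [decide_eq_true_eq, ← countP_isWriteTo ho hg, List.countP_pos_iff]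
    simp only [Function.comp, List.any_eq_true]
  · rw [List.countP_eq_zero.2]
    · omega
    · intro T hT
      simp only [List.any_eq_true, not_exists, not_and]
      intro p hp hw
      obtain ⟨g, hg, rfl⟩ := exists_name_of_mem (List.mem_flatten.2 ⟨T, hT, hp⟩)
      simp only [MemOp.isWriteTo, decide_eq_true_eq] at hw
      exact hx ⟨g, hg, hw.2⟩

theorem length_litThreadFrom_bounds {i : ℕ} {b : Bool} (cs : List (Clause N)) :
    ∀ j, 4 * cs.length + 2 ≤ (litThreadFrom i b j cs).length ∧
      (litThreadFrom i b j cs).length ≤ 8 * cs.length + 2 := by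
  induction cs with
  | nil => intro j; simp [litThreadFrom]
  | cons C cs ih =>
    intro j
    have h : (litEvents i b j C).length ≤ 4 := by
      unfold litEvents
      split_ifs <;> simp
    have := ih (j + 1)
    simp only [litThreadFrom, coreEvents, List.length_append, List.length_cons, List.length_nil]
    omega

theorem length_clockFrom (cs : List (Clause N)) :
    ∀ j, (clockFrom j cs).length = 5 * cs.length := by
  induction cs with
  | nil => intro j; rfl
  | cons C cs ih =>
    intro j
    simp only [clockFrom, ticks, List.length_append, List.length_cons, List.length_nil, ih]
    omega

theorem numEvents_clauseExec (cs : List (Clause N)) :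
    (clauseExec cs).numEvents = ((owners N).map fun o => (threadOf cs o).length).sum := by
  rw [PartialExec.numEvents, clauseExec, namedExec, List.map_map]
  congr 1
  refine List.map_congr_left fun o _ => ?_
  simp

theorem length_litThread_bounds (i : ℕ) (b : Bool) (cs : List (Clause N)) :
    4 * cs.length + 8 ≤ (litThread i b cs).length ∧
      (litThread i b cs).length ≤ 8 * cs.length + 8 := by
  have := length_litThreadFrom_bounds (i := i) (b := b) cs 0
  simp only [litThread, coreEvents, List.length_append, List.length_cons, List.length_nil]
  omega

theorem length_clockThread (cs : List (Clause N)) :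
    (clockThread cs).length = 5 * cs.length + 4 := by
  simp only [clockThread, ticks, List.length_append, length_clockFrom, List.length_cons,
    List.length_nil]
  omega

/-- This lower bound is what keeps all location names below the number of events. -/
theorem le_numEvents_clauseExec (cs : List (Clause N)) :
    N * (8 * cs.length + 16) + (5 * cs.length + 4) ≤ (clauseExec cs).numEvents := by
  rw [numEvents_clauseExec, sum_owners]
  refine Nat.add_le_add ?_ (length_clockThread cs).ge
  calc N * (8 * cs.length + 16) = ∑ i ∈ Finset.range N, (8 * cs.length + 16) := by simp
    _ ≤ _ := Finset.sum_le_sum fun i _ => by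
      have h1 := length_litThread_bounds i true cs
      have h2 := length_litThread_bounds i false cs
      simp only [threadOf]
      omega

theorem numEvents_clauseExec_le (cs : List (Clause N)) :
    (clauseExec cs).numEvents ≤ N * (16 * cs.length + 16) + (5 * cs.length + 4) := by
  rw [numEvents_clauseExec, sum_owners]
  refine Nat.add_le_add ?_ (length_clockThread cs).le
  calc _ ≤ ∑ i ∈ Finset.range N, (16 * cs.length + 16) := Finset.sum_le_sum fun i _ => by
        have h1 := length_litThread_bounds i true cs
        have h2 := length_litThread_bounds i false cs
        simp only [threadOf]
        omega
    _ = _ := by simp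

theorem numThreads_clauseExec (cs : List (Clause N)) :
    (clauseExec cs).numThreads = 2 * N + 1 := by
  have h := sum_owners N fun _ => 1
  simp only [List.map_const', List.sum_replicate, smul_eq_mul, mul_one, Finset.sum_const,
    Finset.card_range] at h
  simp only [PartialExec.numThreads, clauseExec, namedExec, List.length_map, h]
  omega

theorem isNormalized_clauseExec (cs : List (Clause N)) : (clauseExec cs).IsNormalized := by
  intro p hp
  obtain ⟨g, hg, rfl⟩ := exists_name_of_mem hp
  have hn := le_numEvents_clauseExec cs
  have hvar : ∀ i < N, ∀ y ≤ cs.length + 2,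
      (i + 2) * (cs.length + 3) + y < (clauseExec cs).numEvents := by
    intro i hi y hy
    nlinarith
  have hb : ∀ b : Bool, b.toNat < (clauseExec cs).numEvents := by
    intro b
    have := b.toNat_le
    nlinarith
  have h5 : 5 * cs.length + 4 ≤ (clauseExec cs).numEvents := by nlinarith
  have h0 : 0 < (clauseExec cs).numEvents := by omega
  cases g with
  | early i b y => exact ⟨hvar i hg.1 y hg.2, hb _⟩
  | late i b y => exact ⟨hvar i hg.1 y hg.2, hb _⟩
  | choice i b j => exact ⟨hvar i hg.1 (j + 1) (by have := hg.2; omega), hb _⟩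
  | sync i b j => exact ⟨by have := hg.2; simp only [op]; omega, h0⟩
  | tick j k => exact ⟨by have := hg.1; simp only [op]; omega, h0⟩
  | check j => exact ⟨by simp only [IsName] at hg; simp only [op]; omega, h0⟩
  | lit i b j k =>
    obtain ⟨_, _, c, hc, _⟩ := hg
    have := (List.getElem?_eq_some_iff.1 hc).1
    exact ⟨by simp only [op]; omega, h0⟩

end Shape

/-! ### Length of the encoded instance -/

theorem length_encode_le {X : PartialExec} (hX : X.IsNormalized) :
    X.encode.length ≤ X.numThreads + X.numEvents * (2 * X.numEvents) := by
  have hop : ∀ o ∈ X.threads.flatten, (PartialExec.encodeOp o).length ≤ 2 * X.numEvents := by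
    intro o ho
    have := hX o ho
    simp only [PartialExec.encodeOp, List.length_cons, List.length_append, List.length_replicate]
    omega
  have hthread : ∀ T : List MemOp, (∀ o ∈ T, (PartialExec.encodeOp o).length ≤ 2 * X.numEvents) →
      (T.flatMap PartialExec.encodeOp).length ≤ T.length * (2 * X.numEvents) := by
    intro T
    induction T with
    | nil => simp
    | cons o T ih =>
      intro h
      have h1 := h o (by simp)
      have h2 := ih fun o ho => h o (by simp [ho])
      rw [List.flatMap_cons, List.length_append, List.length_cons, Nat.succ_mul]
      omega
  have key : ∀ L : List (List MemOp),
      (∀ o ∈ L.flatten, (PartialExec.encodeOp o).length ≤ 2 * X.numEvents) →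
      (L.flatMap fun T => PartialExec.Sym.thread :: T.flatMap PartialExec.encodeOp).length ≤
        L.length + (L.map List.length).sum * (2 * X.numEvents) := by
    intro L
    induction L with
    | nil => simp
    | cons T L ih =>
      intro h
      have h1 := hthread T fun o ho => h o (by simp [ho])
      have h2 := ih fun o ho => h o (by rw [List.flatten_cons]; exact List.mem_append_right _ ho)
      rw [List.flatMap_cons, List.length_append, List.length_cons, List.map_cons, List.sum_cons,
        List.length_cons, Nat.add_mul]
      omega
  exact key X.threads hop

/-! ## Derived program constructs -/

namespace Prog

variable {K A : Type} [DecidableEq K]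

/-- `c` leads from the stacks `S` to `S'` within `t` steps, whatever the register holds. -/
def Does (c : Prog K A) (S S' : K → List A) (t : ℕ) : Prop :=
  ∀ r, ∃ r', Runs c r S r' S' t

theorem Does.mono {c : Prog K A} {S S' : K → List A} {t t' : ℕ} (h : Does c S S' t)
    (ht : t ≤ t') : Does c S S' t' := fun r => by
  obtain ⟨r', h'⟩ := h r
  exact ⟨r', h'.mono ht⟩

theorem Does.seq {c d : Prog K A} {S S' S'' : K → List A} {t t' : ℕ} (h : Does c S S' t)
    (h' : Does d S' S'' t') : Does (c.seq d) S S'' (t + t') := fun r => by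
  obtain ⟨r', h1⟩ := h r
  obtain ⟨r'', h2⟩ := h' r'
  exact ⟨r'', h1.seq h2⟩

theorem Does.seq_runs {c d : Prog K A} {S S' S'' : K → List A} {t t' : ℕ} {r r'' : Option A}
    (h : Does c S S' t) (h' : ∀ r', Runs d r' S' r'' S'' t') :
    Runs (c.seq d) r S r'' S'' (t + t') := by
  obtain ⟨r', h1⟩ := h r
  exact h1.seq (h' r')

theorem does_of_runs {c : Prog K A} {S S' : K → List A} {t : ℕ} {r' : Option A}
    (h : ∀ r, Runs c r S r' S' t) : Does c S S' t := fun r => ⟨r', h r⟩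

theorem Runs.cast {c : Prog K A} {S S' S'' : K → List A} {t : ℕ} {r r' : Option A}
    (h : Runs c r S r' S' t) (hS : S' = S'') : Runs c r S r' S'' t := hS ▸ h

theorem does_push {k : K} {g : Option A → A} {a : A} (S : K → List A) (hg : ∀ r, g r = a) :
    Does (push k g) S (Function.update S k (a :: S k)) 1 := fun r =>
  ⟨r, by rw [← hg r]; exact Runs.push k g r S⟩

theorem runs_pop_cons {k : K} {r : Option A} {S : K → List A} {a : A} {l : List A}
    (h : S k = a :: l) : Runs (pop k) r S (some a) (Function.update S k l) 1 := by
  have := Runs.pop k r S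
  rwa [h] at this

theorem runs_pop_nil {k : K} {r : Option A} {S : K → List A} (h : S k = []) :
    Runs (pop k) r S none S 1 := by
  have := Runs.pop k r S
  rw [h] at this
  rwa [List.tail_nil, List.head?_nil, ← h, Function.update_eq_self] at this

theorem Does.cast {c : Prog K A} {S S' S'' : K → List A} {t : ℕ} (h : Does c S S' t)
    (hS : S' = S'') : Does c S S'' t := hS ▸ h

def skip (k : K) : Prog K A := loop (fun _ => false) (pop k)

theorem runs_skip (k : K) (r : Option A) (S : K → List A) : Runs (skip k) r S r S 1 :=
  Runs.loop_done rfl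

def pushAll (k : K) : List A → Prog K A
  | [] => skip k
  | a :: l => seq (push k fun _ => a) (pushAll k l)

theorem does_pushAll (k : K) (l : List A) :
    ∀ S, Does (pushAll k l) S (Function.update S k (l.reverse ++ S k)) (l.length + 1) := by
  induction l with
  | nil => intro S r; exact ⟨r, by simpa [pushAll] using runs_skip k r S⟩
  | cons a l ih =>
    intro S
    have := (does_push (k := k) (g := fun _ => a) S fun _ => rfl).seq (ih _)
    refine (Does.mono ?_ (show 1 + (l.length + 1) ≤ (a :: l).length + 1 by simp; omega))
    simpa [pushAll] using this

/-- Pop the stack `k` until it is empty and run `c` after each symbol popped. -/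
def forEach (k : K) (c : Prog K A) : Prog K A :=
  seq (pop k) (loop Option.isSome (seq c (pop k)))

/-- The invariant is indexed by what is left on `k`. Each round costs `T` for the body, one step for
the pop and one for the test. -/
theorem runs_loop_forEach {k : K} {c : Prog K A} {T : ℕ} (I : List A → (K → List A) → Prop)
    (hk : ∀ l S, I l S → S k = l)
    (hstep : ∀ a l S, I (a :: l) S → ∃ r' S',
      Runs c (some a) (Function.update S k l) r' S' T ∧ I l S')
    (l : List A) : ∀ S, I l S → ∀ r, ∃ S', I [] S' ∧
      Runs (forEach k c) r S none S' (l.length * (T + 2) + 2) := by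
  have key : ∀ l S, I l S → ∀ r, ∃ r' S1, Runs (pop k) r S r' S1 1 ∧ ∃ S', I [] S' ∧
      Runs (loop Option.isSome (seq c (pop k))) r' S1 none S' (l.length * (T + 2) + 1) := by
    intro l
    induction l with
    | nil =>
      intro S hS r
      refine ⟨none, S, runs_pop_nil (hk _ _ hS), S, hS, ?_⟩
      simpa using Runs.loop_done (p := Option.isSome) (c := seq c (pop k)) (r := none) (S := S) rfl
    | cons a l ih =>
      intro S hS r
      refine ⟨some a, _, runs_pop_cons (hk _ _ hS), ?_⟩
      obtain ⟨r2, S2, h2, hI2⟩ := hstep a l S hS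
      obtain ⟨r3, S3, h3, S', hI', h'⟩ := ih S2 hI2 r2
      refine ⟨S', hI', (Runs.loop_step rfl (h2.seq h3) h').mono ?_⟩
      rw [List.length_cons, Nat.succ_mul]
      omega
  intro S hS r
  obtain ⟨r', S1, h1, S', hI', h'⟩ := key l S hS r
  exact ⟨S', hI', (h1.seq h').mono (by omega)⟩

/-- Move the stack `k` onto `k'`. -/
def moveTo [Inhabited A] (k k' : K) : Prog K A := forEach k (push k' fun r => r.getD default)

theorem runs_moveTo [Inhabited A] {k k' : K} (hkk : k ≠ k') (r : Option A) (S : K → List A) :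
    Runs (moveTo k k') r S none
      (Function.update (Function.update S k []) k' ((S k).reverse ++ S k'))
      ((S k).length * 3 + 2) := by
  have key : ∀ (l : List A) (S : K → List A) (r : Option A), S k = l →
      ∃ r1 S1, Runs (pop k) r S r1 S1 1 ∧
      Runs (loop Option.isSome (seq (push k' fun r => r.getD default) (pop k))) r1 S1 none
        (Function.update (Function.update S k []) k' (l.reverse ++ S k')) (l.length * 3 + 1) := by
    intro l
    induction l with
    | nil =>
      intro S r hS
      refine ⟨none, S, runs_pop_nil hS, ?_⟩
      rw [← hS, Function.update_eq_self, hS, List.reverse_nil, List.nil_append,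
        Function.update_eq_self]
      exact Runs.loop_done rfl
    | cons a l ih =>
      intro S r hS
      refine ⟨some a, _, runs_pop_cons hS, ?_⟩
      have h1 := Runs.push k' (fun r => r.getD default) (some a) (Function.update S k l)
      obtain ⟨r2, S2, h2, h3⟩ := ih (Function.update (Function.update S k l) k' (a :: S k'))
        (some a) (by rw [Function.update_of_ne hkk, Function.update_self])
      rw [Function.update_of_ne hkk.symm] at h1
      have h4 := Runs.loop_step (p := Option.isSome) rfl (h1.seq h2) h3
      refine Runs.mono ?_ (show 1 + 1 + (l.length * 3 + 1) + 1 ≤ _ by rw [List.length_cons]; omega)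
      convert h4 using 1
      rw [Function.update_self, Function.update_comm hkk.symm, Function.update_idem,
        Function.update_idem]
      simp
  obtain ⟨r1, S1, h1, h2⟩ := key (S k) S r rfl
  exact (h1.seq h2).mono (by omega)

/-- Put as many symbols `a` onto `k'` as there are on `k`, using the empty stack `kt`. -/
def copyTo [Inhabited A] (kt k k' : K) (a : A) : Prog K A :=
  seq (forEach k (seq (push kt fun r => r.getD default) (push k' fun _ => a))) (moveTo kt k)

/-- The invariant records the symbols `u` already parked on `kt`. Seven steps per symbol are four
for the copying loop and three for moving it back. -/
theorem runs_copyTo [Inhabited A] {kt k k' : K} (h1 : kt ≠ k) (h2 : kt ≠ k') (h3 : k ≠ k') (a : A)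
    (r : Option A) (S : K → List A) (hS : S kt = []) :
    Runs (copyTo kt k k' a) r S none
      (Function.update S k' (List.replicate (S k).length a ++ S k')) ((S k).length * 7 + 4) := by
  let I : List A → (K → List A) → Prop := fun l S' => ∃ u : List A, u.reverse ++ l = S k ∧
    S' = Function.update (Function.update (Function.update S k l) kt u) k'
      (List.replicate u.length a ++ S k')
  have hstep : ∀ b l S', I (b :: l) S' → ∃ r' S'', Runs (seq (push kt fun r => r.getD default)
      (push k' fun _ => a)) (some b) (Function.update S' k l) r' S'' 2 ∧ I l S'' := by
    rintro b l S' ⟨u, hu, rfl⟩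
    refine ⟨_, _, (Runs.push kt _ _ _).seq (Runs.push k' _ _ _), b :: u, by simpa using hu, ?_⟩
    funext x
    by_cases hx'' : x = k'
    · subst hx''
      simp [h2.symm, h3.symm, List.replicate_succ]
    · by_cases hx' : x = kt
      · subst hx'
        simp [h2, h1]
      · by_cases hx : x = k
        · subst hx
          simp [hx', hx'']
        · simp [hx, hx', hx'']
  obtain ⟨S', ⟨u, hu, rfl⟩, hrun⟩ := runs_loop_forEach (k := k)
    (c := seq (push kt fun r => r.getD default) (push k' fun _ => a)) (T := 2) I
    (fun l S' ⟨u, hu, hS'⟩ => by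
      rw [hS', Function.update_of_ne h3, Function.update_of_ne h1.symm, Function.update_self]) hstep
    (S k) S ⟨[], rfl, by
      rw [Function.update_eq_self, ← hS, Function.update_eq_self, hS]; simp⟩ r
  have hm := runs_moveTo h1 none (Function.update (Function.update (Function.update S k []) kt u)
    k' (List.replicate u.length a ++ S k'))
  rw [Function.update_of_ne h2, Function.update_self] at hm
  have hlen : u.length = (S k).length := by rw [← hu]; simp
  refine Runs.mono ?_ (show (S k).length * (2 + 2) + 2 + (u.length * 3 + 2) ≤ _ by omega)
  refine (hrun.seq hm).cast ?_
  rw [← hlen]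
  funext x
  have hu' : u.reverse = S k := by simpa using hu
  by_cases hx : x = k
  · subst hx
    rw [Function.update_self, Function.update_of_ne h3, Function.update_of_ne h3,
      Function.update_of_ne h1.symm, Function.update_self, List.append_nil, hu']
  · rw [Function.update_of_ne hx]
    by_cases hx' : x = kt
    · subst hx'
      rw [Function.update_self, Function.update_of_ne h2, hS]
    · rw [Function.update_of_ne hx']
      by_cases hx'' : x = k'
      · subst hx''
        rw [Function.update_self, Function.update_self]
      · rw [Function.update_of_ne hx'', Function.update_of_ne hx'', Function.update_of_ne hx',
          Function.update_of_ne hx]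

/-- Empty the stack `k`. -/
def clear (k : K) : Prog K A := seq (pop k) (loop Option.isSome (pop k))

theorem runs_clear (k : K) (r : Option A) (S : K → List A) :
    Runs (clear k) r S none (Function.update S k []) ((S k).length * 2 + 2) := by
  have key : ∀ (l : List A) (S : K → List A) (r : Option A), S k = l →
      ∃ r1 S1, Runs (pop k) r S r1 S1 1 ∧
      Runs (loop Option.isSome (pop k)) r1 S1 none (Function.update S k []) (l.length * 2 + 1) := by
    intro l
    induction l with
    | nil =>
      intro S r hS
      refine ⟨none, S, runs_pop_nil hS, ?_⟩
      rw [← hS, Function.update_eq_self]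
      exact (Runs.loop_done rfl).mono (by omega)
    | cons a l ih =>
      intro S r hS
      refine ⟨some a, _, runs_pop_cons hS, ?_⟩
      obtain ⟨r2, S2, h2, h3⟩ := ih (Function.update S k l) (some a) (Function.update_self ..)
      rw [Function.update_idem] at h3
      refine (Runs.loop_step rfl h2 h3).mono ?_
      rw [List.length_cons]
      omega
  obtain ⟨r1, S1, h1, h2⟩ := key (S k) S r rfl
  exact (h1.seq h2).mono (by omega)

end Prog

/-! ## The program that writes down `clauseExec` -/

/-- The stacks of the program. -/
inductive Stk
  | inp | vars | rev | tmp | wid | bas | cnt | out | cp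
  deriving DecidableEq

instance : Fintype Stk :=
  ⟨{.inp, .vars, .rev, .tmp, .wid, .bas, .cnt, .out, .cp}, fun k => by cases k <;> decide⟩

instance : Fintype ThreeCNF.Sym :=
  ⟨{.var, .clause, .pos, .neg, .idx}, fun k => by cases k <;> decide⟩

instance : Inhabited ThreeCNF.Sym := ⟨.var⟩

/-- The symbols of the output are represented by symbols of the input alphabet. -/
def toSym : PartialExec.Sym → ThreeCNF.Sym
  | .thread => .var
  | .read => .clause
  | .write => .pos
  | .loc => .idx
  | .val => .neg

def ofSym : ThreeCNF.Sym → PartialExec.Sym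
  | .var => .thread
  | .clause => .read
  | .pos => .write
  | .idx => .loc
  | .neg => .val

theorem ofSym_toSym (s : PartialExec.Sym) : ofSym (toSym s) = s := by cases s <;> rfl

def kindSym : OpKind → ThreeCNF.Sym
  | .read => .clause
  | .write => .pos

def opCode (o : MemOp) : List ThreeCNF.Sym := (PartialExec.encodeOp o).map toSym

theorem opCode_mk (kd : OpKind) (x v : ℕ) : opCode ⟨kd, x, v⟩ =
    kindSym kd :: (List.replicate x .idx ++ List.replicate v .neg) := by
  cases kd <;> simp [opCode, PartialExec.encodeOp, toSym, kindSym]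

def evCode (W : ℕ) (es : List Ev) : List ThreeCNF.Sym := es.flatMap fun e => opCode (op W e)

@[simp] theorem evCode_nil (W : ℕ) : evCode W [] = [] := rfl

@[simp] theorem evCode_cons (W : ℕ) (e : Ev) (es : List Ev) :
    evCode W (e :: es) = opCode (op W e) ++ evCode W es := rfl

@[simp] theorem evCode_append (W : ℕ) (es es' : List Ev) :
    evCode W (es ++ es') = evCode W es ++ evCode W es' := by simp [evCode]

/-- The contents of the stacks; `wid`, `bas` and `cnt` hold numbers in unary and `cp` is empty. -/
def st (inp vars rev tmp : List ThreeCNF.Sym) (w b c : ℕ) (out : List ThreeCNF.Sym) :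
    Stk → List ThreeCNF.Sym
  | .inp => inp
  | .vars => vars
  | .rev => rev
  | .tmp => tmp
  | .wid => List.replicate w .idx
  | .bas => List.replicate b .idx
  | .cnt => List.replicate c .idx
  | .out => out
  | .cp => []

section Update

variable (i v r t : List ThreeCNF.Sym) (w b c : ℕ) (o l : List ThreeCNF.Sym) (n : ℕ)

@[simp] theorem update_st_inp :
    Function.update (st i v r t w b c o) .inp l = st l v r t w b c o := by
  funext k; cases k <;> rfl

@[simp] theorem update_st_vars :
    Function.update (st i v r t w b c o) .vars l = st i l r t w b c o := by
  funext k; cases k <;> rfl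

@[simp] theorem update_st_rev :
    Function.update (st i v r t w b c o) .rev l = st i v l t w b c o := by
  funext k; cases k <;> rfl

@[simp] theorem update_st_tmp :
    Function.update (st i v r t w b c o) .tmp l = st i v r l w b c o := by
  funext k; cases k <;> rfl

@[simp] theorem update_st_out :
    Function.update (st i v r t w b c o) .out l = st i v r t w b c l := by
  funext k; cases k <;> rfl

theorem update_st_wid :
    Function.update (st i v r t w b c o) .wid (List.replicate n .idx) = st i v r t n b c o := by
  funext k; cases k <;> rfl

theorem update_st_bas :
    Function.update (st i v r t w b c o) .bas (List.replicate n .idx) = st i v r t w n c o := by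
  funext k; cases k <;> rfl

theorem update_st_cnt :
    Function.update (st i v r t w b c o) .cnt (List.replicate n .idx) = st i v r t w b n o := by
  funext k; cases k <;> rfl

end Update

/-! ### Subprograms that emit operations -/

namespace Prog

def copies (c : Prog Stk ThreeCNF.Sym) : List Stk → Prog Stk ThreeCNF.Sym
  | [] => c
  | k :: ks => seq (copyTo .cp k .out .idx) (copies c ks)

/-- Put an operation on the output; its location is `d` plus the numbers on the stacks `ks`. -/
def emitOp (kd : OpKind) (ks : List Stk) (d v : ℕ) : Prog Stk ThreeCNF.Sym :=
  seq (push .out fun _ => kindSym kd)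
    (copies (pushAll .out (List.replicate d .idx ++ List.replicate v .neg)) ks)

theorem does_copies {c : Prog Stk ThreeCNF.Sym} {l : List ThreeCNF.Sym} {T : ℕ}
    (hc : ∀ S, Does c S (Function.update S .out (l ++ S .out)) T) (ks : List Stk)
    (hks : ∀ k ∈ ks, k ≠ .cp ∧ k ≠ .out) : ∀ S : Stk → List ThreeCNF.Sym, S .cp = [] →
    Does (copies c ks) S (Function.update S .out
      (l ++ (List.replicate (ks.map fun k => (S k).length).sum .idx ++ S .out)))
      ((ks.map fun k => (S k).length).sum * 7 + ks.length * 4 + T) := by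
  induction ks with
  | nil => intro S _; simpa [copies] using hc S
  | cons k ks ih =>
    intro S hS
    obtain ⟨h1, h2⟩ := hks k (by simp)
    have hk := does_of_runs fun r => runs_copyTo (kt := .cp) (k' := .out) h1.symm (by decide) h2
      .idx r S hS
    have h := hk.seq (ih (fun k hk => hks k (by simp [hk])) _
      (by rw [Function.update_of_ne (by decide), hS]))
    have hm : (ks.map fun x => (Function.update S .out
        (List.replicate (S k).length .idx ++ S .out) x).length) =
        ks.map fun x => (S x).length := List.map_congr_left fun x hx => by
      rw [Function.update_of_ne (hks x (by simp [hx])).2]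
    rw [hm, Function.update_self, Function.update_idem] at h
    refine Does.mono ?_ (show (S k).length * 7 + 4 + ((ks.map fun k => (S k).length).sum * 7 +
      ks.length * 4 + T) ≤ _ by
        rw [List.map_cons, List.sum_cons, List.length_cons]
        ring_nf
        exact le_rfl)
    rw [List.map_cons, List.sum_cons, Nat.add_comm, List.replicate_add, List.append_assoc]
    exact h

section Emit

variable {i v r t : List ThreeCNF.Sym} {w b c τ : ℕ} {o : List ThreeCNF.Sym}

/-- A unary location is written by copying the stacks whose lengths add up to it. The constant 20
covers the kind symbol, the offset, the value and the overhead of at most two copies. -/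
theorem does_emitOp (kd : OpKind) (ks : List Stk) (hks : ∀ k ∈ ks, k ≠ .cp ∧ k ≠ .out)
    (hl : ks.length ≤ 2) {x d x' : ℕ} (hd : d ≤ 2) {a : ℕ} (ha : a ≤ 1)
    (hx : (ks.map fun k => (st i v r t w b c o k).length).sum = x)
    (hτ : 7 * x + 20 ≤ τ) (hx' : x + d = x') :
    Does (emitOp kd ks d a) (st i v r t w b c o)
      (st i v r t w b c ((opCode ⟨kd, x', a⟩).reverse ++ o)) τ := by
  have h1 := does_push (k := .out) (g := fun _ => kindSym kd) (st i v r t w b c o) fun _ => rfl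
  have h2 := does_copies (does_pushAll Stk.out
    (List.replicate d ThreeCNF.Sym.idx ++ List.replicate a ThreeCNF.Sym.neg)) ks hks
    (st i v r t w b c (kindSym kd :: o)) rfl
  have hm : (ks.map fun k => (st i v r t w b c (kindSym kd :: o) k).length) =
      ks.map fun k => (st i v r t w b c o k).length := List.map_congr_left fun k hk => by
    have := (hks k hk).2
    cases k <;> first | rfl | exact absurd rfl this
  rw [hm, hx, update_st_out] at h2
  rw [update_st_out] at h1
  have h := (h1.seq h2).mono (t' := τ) (by
    simp only [List.length_append, List.length_replicate]
    omega)
  obtain rfl : x' = x + d := by omega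
  rw [opCode_mk]
  simpa [st, emitOp, List.replicate_add, -List.replicate_append_replicate] using h

end Emit

/-- A write (or read) on location `bas + cnt + d`. -/
def emitVar (kd : OpKind) (d v : ℕ) : Prog Stk ThreeCNF.Sym := emitOp kd [.bas, .cnt] d v

def emitCore (b : Bool) : Prog Stk ThreeCNF.Sym :=
  seq (emitVar .write 2 b.toNat) <| seq (emitOp .read [.cnt] 0 0) <|
    seq (emitVar .read 1 (!b).toNat) (emitVar .write 0 b.toNat)

def emitLit (dbl : Bool) : Prog Stk ThreeCNF.Sym :=
  if dbl then seq (emitOp .write [.wid, .cnt] 0 0) (emitOp .write [.wid, .cnt] 0 0)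
  else emitOp .write [.wid, .cnt] 0 0

section Emit

variable {i v r t : List ThreeCNF.Sym} {W q j τ : ℕ} {b : Bool} {o : List ThreeCNF.Sym}

theorem does_emitVar (kd : OpKind) {d x a : ℕ} (hd : d ≤ 2) (ha : a ≤ 1)
    (hτ : 7 * (W + (q + 2) * W + j) + 20 ≤ τ) (hx : j + d = x) :
    Does (emitVar kd d a) (st i v r t W ((q + 2) * W) j o)
      (st i v r t W ((q + 2) * W) j ((opCode ⟨kd, (q + 2) * W + x, a⟩).reverse ++ o)) τ :=
  does_emitOp kd [.bas, .cnt] (by simp) (by simp) hd ha (x := (q + 2) * W + j) (by simp [st])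
    (by omega) (by omega)

theorem does_emitCore (hτ : 7 * (W + (q + 2) * W + j) + 20 ≤ τ) :
    Does (emitCore b) (st i v r t W ((q + 2) * W) j o)
      (st i v r t W ((q + 2) * W) j ((evCode W (coreEvents q b j)).reverse ++ o)) (4 * τ) := by
  have h1 := does_emitVar (i := i) (v := v) (r := r) (t := t) (o := o) .write (d := 2) (a := b.toNat)
    le_rfl b.toNat_le hτ rfl
  have h2 := does_emitOp (i := i) (v := v) (r := r) (t := t) (w := W) (b := (q + 2) * W) (c := j)
    (o := (opCode ⟨.write, (q + 2) * W + (j + 2), b.toNat⟩).reverse ++ o) (τ := τ) .read [.cnt]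
    (by simp) (by simp) (d := 0) (by omega) (a := 0) (by omega) (x := j) (by simp [st]) (by omega)
    (Nat.add_zero j)
  have h3 := does_emitVar (i := i) (v := v) (r := r) (t := t)
    (o := (opCode ⟨.read, j, 0⟩).reverse ++
      ((opCode ⟨.write, (q + 2) * W + (j + 2), b.toNat⟩).reverse ++ o))
    .read (d := 1) (a := (!b).toNat) (by omega) (Bool.toNat_le _) hτ rfl
  have h4 := does_emitVar (i := i) (v := v) (r := r) (t := t)
    (o := (opCode ⟨.read, (q + 2) * W + (j + 1), (!b).toNat⟩).reverse ++
      ((opCode ⟨.read, j, 0⟩).reverse ++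
        ((opCode ⟨.write, (q + 2) * W + (j + 2), b.toNat⟩).reverse ++ o)))
    .write (d := 0) (a := b.toNat) (by omega) (Bool.toNat_le _) hτ rfl
  have h := (h1.seq (h2.seq (h3.seq h4))).mono (show τ + (τ + (τ + τ)) ≤ 4 * τ by omega)
  simpa [coreEvents, op, emitCore] using h

/-- The writes for clause `j` that belong to one literal. -/
def litCodeOut (W j : ℕ) (dbl : Bool) : List ThreeCNF.Sym :=
  if dbl then opCode ⟨.write, W + j, 0⟩ ++ opCode ⟨.write, W + j, 0⟩ else opCode ⟨.write, W + j, 0⟩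

theorem does_emitLit (dbl : Bool) (hτ : 7 * (W + (q + 2) * W + j) + 20 ≤ τ) :
    Does (emitLit dbl) (st i v r t W ((q + 2) * W) j o)
      (st i v r t W ((q + 2) * W) j ((litCodeOut W j dbl).reverse ++ o)) (2 * τ) := by
  have h : ∀ o, Does (emitOp .write [.wid, .cnt] 0 0) (st i v r t W ((q + 2) * W) j o)
      (st i v r t W ((q + 2) * W) j ((opCode ⟨.write, W + j, 0⟩).reverse ++ o)) τ := fun o =>
    does_emitOp .write [.wid, .cnt] (by simp) (by simp) (by omega) (by omega) (x := W + j)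
      (by simp [st]) (by omega) rfl
  cases dbl
  · simpa [emitLit, litCodeOut] using (h o).mono (show τ ≤ 2 * τ by omega)
  · have := ((h o).seq (h _)).mono (show τ + τ ≤ 2 * τ by omega)
    simpa [emitLit, litCodeOut] using this

end Emit

end Prog

/-! ### How clauses are stored between passes -/

section Codes

variable {N : ℕ}

def signSym (b : Bool) : ThreeCNF.Sym := if b then .pos else .neg

/-- How a literal is stored while the threads of variable `i` are written: the literals of earlier
variables are marked, and the index of the others is relative to `i`. -/
def litCode (i : ℕ) (l : Fin N × Bool) : List ThreeCNF.Sym :=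
  if (l.1 : ℕ) < i then [.var] else List.replicate ((l.1 : ℕ) - i) .idx ++ [signSym l.2]

def clauseCode (i : ℕ) (C : Clause N) : List ThreeCNF.Sym :=
  litCode i (C 2) ++ (litCode i (C 1) ++ (litCode i (C 0) ++ [.clause]))

/-- The variable whose threads are written after the thread of `(i, b)`. -/
def nextVar (i : ℕ) (b : Bool) : ℕ := if b then i else i + 1

theorem length_litCode_le (i : ℕ) (l : Fin N × Bool) : (litCode i l).length ≤ N + 1 := by
  unfold litCode
  have := l.1.is_lt
  split_ifs
  · simp
  · simp
    omega

theorem length_flatMap_clauseCode_le (i : ℕ) (cs : List (Clause N)) :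
    (cs.flatMap (clauseCode i)).length ≤ cs.length * (3 * N + 4) := by
  induction cs with
  | nil => simp
  | cons C cs ih =>
    have h0 := length_litCode_le i (C 0)
    have h1 := length_litCode_le i (C 1)
    have h2 := length_litCode_le i (C 2)
    simp only [List.flatMap_cons, clauseCode, List.length_append, List.length_cons, List.length_nil]
    rw [Nat.succ_mul]
    omega

end Codes

/-! ### Passes that write the literal threads -/

namespace Prog

/-- The register holds the symbol `s`. -/
def isSym (s : ThreeCNF.Sym) (r : Option ThreeCNF.Sym) : Bool := decide (r = some s)

@[simp] theorem isSym_some (s s' : ThreeCNF.Sym) : isSym s (some s') = decide (s' = s) := by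
  simp [isSym]

/-- Move a literal from `rev` to `tmp`, the first symbol being in the register, and write down the
events of the thread of `(i, b)` that belong to it. -/
def litProg (b dbl : Bool) : Prog Stk ThreeCNF.Sym :=
  ite (isSym .idx)
    (seq (if b then push .tmp fun _ => .idx else skip .tmp) <| seq (pop .rev) <|
      seq (loop (isSym .idx) (seq (push .tmp fun _ => .idx) (pop .rev)))
        (push .tmp fun r => r.getD .var))
    (seq (push .tmp fun r => if b then r.getD .var else .var) <|
      ite (isSym (signSym b)) (emitLit dbl) (skip .tmp))

def clauseProg (b : Bool) : Prog Stk ThreeCNF.Sym :=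
  seq (litProg b true) <| seq (pop .rev) <| seq (litProg b false) <| seq (pop .rev) <|
    seq (litProg b false) <| seq (push .tmp fun _ => .clause) <| seq (push .cnt fun _ => .idx) <|
      seq (emitCore b) (seq (pop .rev) (pop .rev))

/-- Write down the thread of `(i, b)`. -/
def threadProg (b : Bool) : Prog Stk ThreeCNF.Sym :=
  seq (push .out fun _ => .var) <| seq (emitVar .write 0 b.toNat) <|
    seq (emitVar .write 1 b.toNat) <| seq (emitCore b) <| seq (pop .rev) <|
      seq (loop Option.isSome (clauseProg b)) <| seq (emitVar .write 1 b.toNat) <|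
        seq (emitVar .write 2 b.toNat) <| seq (clear .cnt) (moveTo .tmp .rev)

/-- Write down the threads of all variables. -/
def varProg : Prog Stk ThreeCNF.Sym :=
  forEach .vars <| seq (threadProg true) <| seq (threadProg false) (copyTo .cp .wid .bas .idx)

section

variable {N : ℕ} {inp v t : List ThreeCNF.Sym} {W B q j τ : ℕ} {o : List ThreeCNF.Sym}

theorem runs_pop_rev (l : List ThreeCNF.Sym) (r : Option ThreeCNF.Sym) :
    Runs (pop .rev) r (st inp v l t W B j o) l.head? (st inp v l.tail t W B j o) 1 := by
  simpa [st] using Runs.pop Stk.rev r (st inp v l t W B j o)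

theorem cons_replicate_append {α : Type*} (a : α) (n : ℕ) (l : List α) :
    a :: (List.replicate n a ++ l) = List.replicate n a ++ a :: l := by
  rw [← List.cons_append, ← List.replicate_succ, List.replicate_succ', List.append_assoc,
    List.singleton_append]

theorem runs_loop_idx {s : ThreeCNF.Sym} (hs : s ≠ .idx) (rest : List ThreeCNF.Sym) (n : ℕ) :
    ∀ t, Runs (loop (isSym .idx) (seq (push .tmp fun _ => .idx) (pop .rev)))
      (List.replicate n ThreeCNF.Sym.idx ++ s :: rest).head?
      (st inp v (List.replicate n ThreeCNF.Sym.idx ++ s :: rest).tail t W B j o)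
      (some s) (st inp v rest (List.replicate n .idx ++ t) W B j o) (n * 3 + 1) := by
  induction n with
  | zero =>
    intro t
    exact Runs.loop_done (by simp [hs])
  | succ n ih =>
    intro t
    have h1 := Runs.push Stk.tmp (fun _ => ThreeCNF.Sym.idx) (some .idx)
      (st inp v (List.replicate n ThreeCNF.Sym.idx ++ s :: rest) t W B j o)
    rw [update_st_tmp] at h1
    have h := Runs.loop_step (p := (isSym .idx)) (by simp) (h1.seq (runs_pop_rev _ _)) (ih (.idx :: t))
    refine Runs.mono ?_ (show 1 + 1 + (n * 3 + 1) + 1 ≤ (n + 1) * 3 + 1 by omega)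
    rw [List.replicate_succ, List.cons_append, List.cons_append, cons_replicate_append _ _ t]
    exact h

theorem signSym_ne_idx (b : Bool) : signSym b ≠ .idx := by cases b <;> simp [signSym]

theorem signSym_ne_var (b : Bool) : signSym b ≠ .var := by cases b <;> simp [signSym]

theorem signSym_inj {b b' : Bool} : signSym b = signSym b' ↔ b = b' := by
  cases b <;> cases b' <;> simp [signSym]

/-- Indices are stored relative to the current variable, so a literal belongs to it exactly when its
code starts with a sign. An earlier variable shows as a mark. A later one starts with `idx`, and one
`idx` is dropped in the pass for b = false, which prepares the next variable. -/
theorem runs_litProg (b dbl : Bool) (l : Fin N × Bool) (rest : List ThreeCNF.Sym)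
    (hτ : 7 * (W + (q + 2) * W + j) + 20 ≤ τ) :
    ∃ r', Runs (litProg b dbl) (litCode q l ++ rest).head?
      (st inp v (litCode q l ++ rest).tail t W ((q + 2) * W) j o) r'
      (st inp v rest ((litCode (nextVar q b) l).reverse ++ t) W ((q + 2) * W) j
        ((if IsLit q b l then litCodeOut W j dbl else []).reverse ++ o)) (3 * N + 2 * τ + 8) := by
  have hN := l.1.is_lt
  rcases Nat.lt_trichotomy (l.1 : ℕ) q with hl | hl | hl
  · have h1 : litCode q l = [.var] := if_pos hl
    have h2 : litCode (nextVar q b) l = [.var] := if_pos (by unfold nextVar; split_ifs <;> omega)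
    have h3 : ¬ IsLit q b l := fun h => hl.ne h.1
    rw [h1, h2, if_neg h3]
    refine ⟨some .var, (Runs.ite_false (by simp) ((Runs.push _ _ _ _).seq
      (Runs.ite_false (by simp [(signSym_ne_var b).symm]) (runs_skip _ _ _)))).cast ?_ |>.mono ?_⟩
    · cases b <;> simp [st]
    · omega
  · have h1 : litCode q l = [signSym l.2] := by simp [litCode, hl]
    have h2 : litCode (nextVar q b) l = [if b then signSym l.2 else .var] := by
      cases b <;> simp [litCode, nextVar, hl]
    have hp := Runs.push Stk.tmp (fun r : Option ThreeCNF.Sym => if b then r.getD .var else .var)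
      (some (signSym l.2)) (st inp v rest t W ((q + 2) * W) j o)
    rw [update_st_tmp] at hp
    rw [h1, h2]
    by_cases hb : l.2 = b
    · have h3 : IsLit q b l := ⟨hl, hb⟩
      rw [if_pos h3]
      obtain ⟨r', hr⟩ := does_emitLit (i := inp) (v := v) (r := rest)
        (t := (if b then signSym l.2 else .var) :: t) (o := o) dbl hτ (some (signSym l.2))
      refine ⟨r', (Runs.ite_false (by simp [signSym_ne_idx]) (hp.seq
        (Runs.ite_true (by simp [hb]) hr))).mono ?_⟩
      omega
    · have h3 : ¬ IsLit q b l := fun h => hb h.2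
      rw [if_neg h3]
      refine ⟨_, (Runs.ite_false (by simp [signSym_ne_idx]) (hp.seq
        (Runs.ite_false (by simp [signSym_inj, hb]) (runs_skip _ _ _)))).mono ?_⟩
      omega
  · obtain ⟨n, hn⟩ : ∃ n, (l.1 : ℕ) - q = n + 1 := ⟨(l.1 : ℕ) - q - 1, by omega⟩
    have h1 : litCode q l = .idx :: (List.replicate n .idx ++ [signSym l.2]) := by
      simp [litCode, hl.not_gt, hn, List.replicate_succ]
    have h2 : litCode (nextVar q b) l =
        List.replicate n .idx ++ ((if b then [.idx] else []) ++ [signSym l.2]) := by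
      cases b
      · have : ¬ (l.1 : ℕ) < q + 1 := by omega
        simp [litCode, nextVar, this, show (l.1 : ℕ) - (q + 1) = n by omega]
      · simp [litCode, nextVar, hl.not_gt, hn, List.replicate_succ']
    have h3 : ¬ IsLit q b l := fun h => hl.ne' h.1
    rw [h1, h2, if_neg h3]
    have ha : Runs (if b then push .tmp fun _ => .idx else skip .tmp) (some .idx)
        (st inp v (List.replicate n ThreeCNF.Sym.idx ++ signSym l.2 :: rest) t W ((q + 2) * W) j o)
        (some .idx) (st inp v (List.replicate n ThreeCNF.Sym.idx ++ signSym l.2 :: rest)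
          ((if b then [.idx] else []) ++ t) W ((q + 2) * W) j o) 1 := by
      cases b
      · exact runs_skip _ _ _
      · have := Runs.push Stk.tmp (fun _ => ThreeCNF.Sym.idx) (some .idx)
          (st inp v (List.replicate n ThreeCNF.Sym.idx ++ signSym l.2 :: rest) t W ((q + 2) * W) j o)
        rwa [update_st_tmp] at this
    have hc := Runs.push Stk.tmp (fun r : Option ThreeCNF.Sym => r.getD .var)
      (some (signSym l.2)) (st inp v rest (List.replicate n .idx ++
        ((if b then [.idx] else []) ++ t)) W ((q + 2) * W) j o)
    rw [update_st_tmp] at hc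
    have h := Runs.ite_true (p := (isSym .idx)) (d := (seq (push .tmp fun r => if b then r.getD .var else .var) <|
      ite (isSym (signSym b)) (emitLit dbl) (skip .tmp))) (by simp) (ha.seq ((runs_pop_rev _ _).seq
      ((runs_loop_idx (signSym_ne_idx l.2) rest n _).seq hc)))
    refine ⟨some (signSym l.2), Runs.mono ?_ (show 1 + (1 + (n * 3 + 1 + 1)) + 1 ≤ _ by omega)⟩
    convert h using 2
    · rfl
    · rfl
    · simp
    · cases b <;> simp [st, cons_replicate_append]
    · rfl

theorem evCode_litEvents (W q : ℕ) (b : Bool) (j : ℕ) (C : Clause N) :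
    evCode W (litEvents q b j C) =
      (if IsLit q b (C 2) then litCodeOut W j true else []) ++
        ((if IsLit q b (C 1) then litCodeOut W j false else []) ++
          (if IsLit q b (C 0) then litCodeOut W j false else [])) := by
  unfold litEvents
  split_ifs <;> simp [litCodeOut, op]

/-- The last two pops discard the end mark of the clause and load the first symbol of the next,
which the enclosing loop tests. -/
theorem runs_clauseProg (b : Bool) (C : Clause N) (rest : List ThreeCNF.Sym)
    (hτ : 7 * (W + (q + 2) * W + (j + 1)) + 20 ≤ τ) :
    Runs (clauseProg b) (clauseCode q C ++ rest).head?
      (st inp v (clauseCode q C ++ rest).tail t W ((q + 2) * W) j o) rest.head?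
      (st inp v rest.tail ((clauseCode (nextVar q b) C).reverse ++ t) W ((q + 2) * W) (j + 1)
        ((evCode W (litEvents q b j C ++ coreEvents q b (j + 1))).reverse ++ o))
      (9 * N + 10 * τ + 30) := by
  have hτ' : 7 * (W + (q + 2) * W + j) + 20 ≤ τ := by omega
  set t1 := (litCode (nextVar q b) (C 2)).reverse ++ t with ht1
  set t2 := (litCode (nextVar q b) (C 1)).reverse ++ t1 with ht2
  set t3 := (litCode (nextVar q b) (C 0)).reverse ++ t2 with ht3
  set o1 := (if IsLit q b (C 2) then litCodeOut W j true else []).reverse ++ o with ho1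
  set o2 := (if IsLit q b (C 1) then litCodeOut W j false else []).reverse ++ o1 with ho2
  set o3 := (if IsLit q b (C 0) then litCodeOut W j false else []).reverse ++ o2 with ho3
  obtain ⟨r1, h1⟩ := runs_litProg (inp := inp) (v := v) (t := t) (o := o) b true (C 2)
    (litCode q (C 1) ++ (litCode q (C 0) ++ (.clause :: rest))) hτ'
  obtain ⟨r2, h2⟩ := runs_litProg (inp := inp) (v := v) (t := t1) (o := o1) b false (C 1)
    (litCode q (C 0) ++ (.clause :: rest)) hτ'
  obtain ⟨r3, h3⟩ := runs_litProg (inp := inp) (v := v) (t := t2) (o := o2) b false (C 0)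
    (.clause :: rest) hτ'
  have h4 := Runs.push Stk.tmp (fun _ => ThreeCNF.Sym.clause) r3
    (st inp v (.clause :: rest) t3 W ((q + 2) * W) j o3)
  have h5 := Runs.push Stk.cnt (fun _ => ThreeCNF.Sym.idx) r3
    (st inp v (.clause :: rest) (.clause :: t3) W ((q + 2) * W) j o3)
  rw [update_st_tmp] at h4
  have e : (ThreeCNF.Sym.idx :: st inp v (.clause :: rest) (.clause :: t3) W ((q + 2) * W) j o3 .cnt)
    = List.replicate (j + 1) .idx := rfl
  rw [e, update_st_cnt] at h5
  obtain ⟨r6, h6⟩ := does_emitCore (i := inp) (v := v) (r := .clause :: rest)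
    (t := .clause :: t3) (o := o3) (b := b) hτ r3
  have h := h1.seq ((runs_pop_rev _ r1).seq (h2.seq ((runs_pop_rev _ r2).seq (h3.seq (h4.seq
    (h5.seq (h6.seq ((runs_pop_rev _ r6).seq (runs_pop_rev _ _)))))))))
  refine Runs.mono ?_ (show (3 * N + 2 * τ + 8) + (1 + ((3 * N + 2 * τ + 8) + (1 +
    ((3 * N + 2 * τ + 8) + (1 + (1 + (4 * τ + (1 + 1)))))))) ≤ _ by omega)
  have e1 : clauseCode q C ++ rest =
      litCode q (C 2) ++ (litCode q (C 1) ++ (litCode q (C 0) ++ (.clause :: rest))) := by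
    simp [clauseCode]
  have e2 : (clauseCode (nextVar q b) C).reverse ++ t = .clause :: t3 := by
    simp [clauseCode, ht1, ht2, ht3]
  have e3 : (evCode W (litEvents q b j C ++ coreEvents q b (j + 1))).reverse ++ o =
      (evCode W (coreEvents q b (j + 1))).reverse ++ o3 := by
    rw [evCode_append, evCode_litEvents, ho3, ho2, ho1]
    simp only [List.reverse_append, List.append_assoc]
  rw [e1, e2, e3]
  exact h

/-- The events of the thread of `(q, b)` for the clauses `cs`, the first of which is clause `j`. -/
def clauseEvents (q : ℕ) (b : Bool) : ℕ → List (Clause N) → List Ev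
  | _, [] => []
  | j, C :: cs => litEvents q b j C ++ (coreEvents q b (j + 1) ++ clauseEvents q b (j + 1) cs)

theorem litThreadFrom_eq (q : ℕ) (b : Bool) (cs : List (Clause N)) : ∀ j,
    litThreadFrom q b j cs = clauseEvents q b j cs ++
      [late q b (j + cs.length + 1), late q b (j + cs.length + 2)] := by
  induction cs with
  | nil => intro j; rfl
  | cons C cs ih =>
    intro j
    rw [litThreadFrom, ih, clauseEvents, List.length_cons,
      show j + (cs.length + 1) = j + 1 + cs.length by omega]
    simp

theorem runs_loop_clauseProg (b : Bool) (cs : List (Clause N)) : ∀ j t o,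
    7 * (W + (q + 2) * W + (j + cs.length)) + 20 ≤ τ →
    Runs (loop Option.isSome (clauseProg b)) (cs.flatMap (clauseCode q)).head?
      (st inp v (cs.flatMap (clauseCode q)).tail t W ((q + 2) * W) j o) none
      (st inp v [] ((cs.flatMap (clauseCode (nextVar q b))).reverse ++ t) W ((q + 2) * W)
        (j + cs.length) ((evCode W (clauseEvents q b j cs)).reverse ++ o))
      (cs.length * (9 * N + 10 * τ + 31) + 1) := by
  induction cs with
  | nil => intro j t o _; exact (Runs.loop_done rfl).mono (by omega)
  | cons C cs ih =>
    intro j t o hτ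
    rw [List.length_cons] at hτ
    have h1 := runs_clauseProg (inp := inp) (v := v) (t := t) (o := o) b C
      (cs.flatMap (clauseCode q)) (show 7 * (W + (q + 2) * W + (j + 1)) + 20 ≤ τ by omega)
    have h2 := ih (j + 1) ((clauseCode (nextVar q b) C).reverse ++ t)
      ((evCode W (litEvents q b j C ++ coreEvents q b (j + 1))).reverse ++ o) (by omega)
    have hs : (clauseCode q C ++ cs.flatMap (clauseCode q)).head?.isSome = true := by
      rw [List.isSome_head?]
      simp [clauseCode]
    refine ((Runs.loop_step hs h1 h2).mono ?_).cast ?_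
    · rw [List.length_cons, Nat.add_one_mul cs.length]
      omega
    · rw [List.length_cons, show j + (cs.length + 1) = j + 1 + cs.length by omega, clauseEvents]
      simp

/-- The pass leaves the recoded clauses reversed on `tmp`; moving them back restores their order for
the next thread. -/
theorem does_threadProg (b : Bool) (cs : List (Clause N))
    (hτ : 7 * (W + (q + 2) * W + cs.length) + 20 ≤ τ) :
    Does (threadProg b) (st inp v (cs.flatMap (clauseCode q)) [] W ((q + 2) * W) 0 o)
      (st inp v (cs.flatMap (clauseCode (nextVar q b))) [] W ((q + 2) * W) 0
        ((.var :: evCode W (litThread q b cs)).reverse ++ o))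
      (cs.length * (18 * N + 10 * τ + 45) + 8 * τ + 8) := by
  have hτ' : 7 * (W + (q + 2) * W + 0) + 20 ≤ τ := by omega
  have ht := length_flatMap_clauseCode_le (nextVar q b) cs
  set t1 := (cs.flatMap (clauseCode (nextVar q b))).reverse ++ [] with ht1
  set l := cs.flatMap (clauseCode q) with hl
  have h0 := does_push (k := Stk.out) (g := fun _ => ThreeCNF.Sym.var)
    (st inp v l [] W ((q + 2) * W) 0 o) fun _ => rfl
  rw [update_st_out] at h0
  have h1 := fun o => does_emitVar (i := inp) (v := v) (r := l) (t := []) (o := o) .write (d := 0)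
    (a := b.toNat) (by omega) b.toNat_le hτ' rfl
  have h2 := fun o => does_emitVar (i := inp) (v := v) (r := l) (t := []) (o := o) .write (d := 1)
    (a := b.toNat) (by omega) b.toNat_le hτ' rfl
  have h3 := fun o => does_emitCore (i := inp) (v := v) (r := l) (t := []) (o := o) (b := b) hτ'
  have h4 := fun o => runs_loop_clauseProg (inp := inp) (v := v) b cs 0 [] o (τ := τ) (W := W)
    (q := q) (by omega)
  have h5 := fun o => does_emitVar (i := inp) (v := v) (r := []) (t := t1) (o := o) .write
    (W := W) (q := q) (j := 0 + cs.length) (τ := τ) (d := 1) (a := b.toNat) (by omega) b.toNat_le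
    (by omega) rfl
  have h6 := fun o => does_emitVar (i := inp) (v := v) (r := []) (t := t1) (o := o) .write
    (W := W) (q := q) (j := 0 + cs.length) (τ := τ) (d := 2) (a := b.toNat) (by omega) b.toNat_le
    (by omega) rfl
  have h7 := fun o => does_of_runs fun r => runs_clear Stk.cnt r
    (st inp v [] t1 W ((q + 2) * W) (0 + cs.length) o)
  have h8 := fun o => does_of_runs fun r => runs_moveTo (show Stk.tmp ≠ .rev by decide) r
    (st inp v [] t1 W ((q + 2) * W) 0 o)
  have e7 := fun o => update_st_cnt inp v [] t1 W ((q + 2) * W) (0 + cs.length) o 0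
  rw [List.replicate_zero] at e7
  simp only [e7] at h7
  simp only [update_st_tmp, update_st_rev] at h8
  have h9 := fun o => (h5 o).seq ((h6 _).seq ((h7 _).seq (h8 _)))
  -- The loop depends on the symbol popped just before it, so this stretch is assembled with
  -- explicit registers before they are forgotten.
  have hmid : ∀ o, Does _ (st inp v l [] W ((q + 2) * W) 0 o) _ _ := fun o r => by
    obtain ⟨r', hr⟩ := h9 ((evCode W (clauseEvents q b 0 cs)).reverse ++ o) none
    exact ⟨r', (runs_pop_rev l r).seq ((h4 o).seq hr)⟩
  have h := h0.seq ((h1 _).seq ((h2 _).seq ((h3 _).seq (hmid _))))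
  refine (h.mono ?_).cast ?_
  · have e1 : (st inp v [] t1 W ((q + 2) * W) (0 + cs.length) [] .cnt).length = cs.length := by
      simp [st]
    have e2 : t1.length = (cs.flatMap (clauseCode (nextVar q b))).length := by simp [ht1]
    have e3 : cs.length * (18 * N + 10 * τ + 45) =
      cs.length * (9 * N + 10 * τ + 31) + cs.length * (3 * N + 4) * 3 + cs.length * 2 := by ring
    simp only [st, List.length_replicate] at e1 e2 ⊢
    omega
  · rw [litThread, litThreadFrom_eq]
    simp [st, op, ht1]

theorem does_copy_wid {r : List ThreeCNF.Sym} :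
    Does (copyTo .cp .wid .bas .idx) (st inp v r t W (q * W) j o)
      (st inp v r t W ((q + 1) * W) j o) (W * 7 + 4) := fun r' => by
  have h := runs_copyTo (show Stk.cp ≠ .wid by decide) (show Stk.cp ≠ .bas by decide)
    (show Stk.wid ≠ .bas by decide) ThreeCNF.Sym.idx r' (st inp v r t W (q * W) j o) rfl
  have e : List.replicate (st inp v r t W (q * W) j o .wid).length ThreeCNF.Sym.idx ++
      st inp v r t W (q * W) j o .bas = List.replicate ((q + 1) * W) .idx := by
    simp [st, Nat.add_one_mul, Nat.add_comm]
  have e' : (st inp v r t W (q * W) j o .wid).length = W := by simp [st]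
  rw [e, update_st_bas, e'] at h
  exact ⟨none, h⟩

/-- The part of the output for variable `i`. -/
def varCode (W : ℕ) (cs : List (Clause N)) (i : ℕ) : List ThreeCNF.Sym :=
  (.var :: evCode W (litThread i true cs)) ++ (.var :: evCode W (litThread i false cs))

/-- The invariant is that, with i variables done, `bas` holds (i + 2) W and the clauses are coded
relative to i. -/
theorem runs_varProg (cs : List (Clause N)) (hv : v.length = N)
    (hτ : 7 * (W + (N + 2) * W + cs.length) + 20 ≤ τ) (r : Option ThreeCNF.Sym) :
    Runs varProg r (st inp v (cs.flatMap (clauseCode 0)) [] W (2 * W) 0 o) none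
      (st inp [] (cs.flatMap (clauseCode N)) [] W ((N + 2) * W) 0
        (((List.range N).flatMap (varCode W cs)).reverse ++ o))
      (N * (2 * (cs.length * (18 * N + 10 * τ + 45) + 8 * τ + 8) + (W * 7 + 4) + 2) + 2) := by
  let I : List ThreeCNF.Sym → (Stk → List ThreeCNF.Sym) → Prop := fun l S => ∃ i,
    i + l.length = N ∧ S = st inp l (cs.flatMap (clauseCode i)) [] W ((i + 2) * W) 0
      (((List.range i).flatMap (varCode W cs)).reverse ++ o)
  obtain ⟨S', ⟨i, hi, rfl⟩, h⟩ := runs_loop_forEach (k := Stk.vars)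
    (c := seq (threadProg true) <| seq (threadProg false) (copyTo .cp .wid .bas .idx))
    (T := 2 * (cs.length * (18 * N + 10 * τ + 45) + 8 * τ + 8) + (W * 7 + 4)) I
    (by rintro l S ⟨i, _, rfl⟩; rfl)
    (by
      rintro a l S ⟨i, hi, rfl⟩
      rw [List.length_cons] at hi
      have hmul : (i + 2) * W ≤ (N + 2) * W := Nat.mul_le_mul_right _ (by omega)
      have hτ' : 7 * (W + (i + 2) * W + cs.length) + 20 ≤ τ := by omega
      rw [update_st_vars]
      have h1 := does_threadProg (inp := inp) (v := l)
        (o := ((List.range i).flatMap (varCode W cs)).reverse ++ o) true cs hτ'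
      have h2 := does_threadProg (inp := inp) (v := l)
        (o := (.var :: evCode W (litThread i true cs)).reverse ++
          (((List.range i).flatMap (varCode W cs)).reverse ++ o)) false cs hτ'
      obtain ⟨r', h⟩ := h1.seq (h2.seq does_copy_wid) (some a)
      refine ⟨r', _, h.mono (by omega), i + 1, by omega, ?_⟩
      simp [nextVar, List.range_succ, varCode, Nat.add_right_comm])
    v (st inp v (cs.flatMap (clauseCode 0)) [] W (2 * W) 0 o) ⟨0, by simpa using hv, by simp⟩ r
  obtain rfl : i = N := hi
  rw [hv] at h
  exact h

end

/-! ### Clock thread, input parsing and the full program -/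

def ticksProg : Prog Stk ThreeCNF.Sym :=
  seq (emitOp .write [.cnt] 0 0) <| seq (emitOp .write [.cnt] 0 0) <|
    seq (emitOp .write [.cnt] 0 0) (emitOp .write [.cnt] 0 0)

def clockStep : Prog Stk ThreeCNF.Sym :=
  seq (ite (isSym .clause)
    (seq (emitOp .read [.wid, .cnt] 0 0) <| seq (push .cnt fun _ => .idx) ticksProg)
    (skip .rev)) (pop .rev)

/-- Write down the clock thread. -/
def clockProg : Prog Stk ThreeCNF.Sym :=
  seq (push .out fun _ => .var) <| seq ticksProg <| seq (pop .rev) <|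
    seq (loop Option.isSome clockStep) (clear .cnt)

def readStep : Prog Stk ThreeCNF.Sym :=
  seq (push .rev fun r => r.getD .var) <|
    seq (ite (isSym .clause) (push .wid fun _ => .idx) (skip .wid)) (pop .inp)

/-- Read the formula: count the variables and the clauses and reverse the list of clauses. -/
def readProg : Prog Stk ThreeCNF.Sym :=
  seq (pop .inp) <|
    seq (loop (isSym .var) (seq (push .vars fun r => r.getD .var) (pop .inp)))
      (loop Option.isSome readStep)

def initProg : Prog Stk ThreeCNF.Sym :=
  seq (pushAll .wid [.idx, .idx, .idx]) <|
    seq (copyTo .cp .wid .bas .idx) (copyTo .cp .wid .bas .idx)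

/-- Replace a formula by the partial execution graph of its clauses. -/
def reduceProg : Prog Stk ThreeCNF.Sym :=
  seq readProg <| seq initProg <| seq varProg <| seq clockProg <| seq (clear .wid) (clear .bas)

section

variable {N : ℕ} {inp v r t : List ThreeCNF.Sym} {W B j τ : ℕ} {o : List ThreeCNF.Sym}

theorem does_ticksProg (hτ : 7 * j + 20 ≤ τ) :
    Does ticksProg (st inp v r t W B j o)
      (st inp v r t W B j ((evCode W (ticks j)).reverse ++ o)) (4 * τ) := by
  have h : ∀ o, Does (emitOp .write [.cnt] 0 0) (st inp v r t W B j o)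
      (st inp v r t W B j ((opCode ⟨.write, j, 0⟩).reverse ++ o)) τ := fun o =>
    does_emitOp .write [.cnt] (by simp) (by simp) (by omega) (by omega) (x := j)
      (by simp [st]) (by omega) rfl
  have h' := ((h o).seq ((h _).seq ((h _).seq (h _)))).mono (show τ + (τ + (τ + τ)) ≤ 4 * τ by omega)
  simpa [ticksProg, ticks, op] using h'

theorem runs_clockStep_skip (l : List ThreeCNF.Sym) {s : ThreeCNF.Sym} (hs : s ≠ .clause) :
    Runs clockStep (some s) (st inp v l t W B j o) l.head? (st inp v l.tail t W B j o) 3 :=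
  (Runs.ite_false (by simp [hs]) (runs_skip _ _ _)).seq (runs_pop_rev _ _)

theorem runs_clockStep (l : List ThreeCNF.Sym) (hτ : 7 * (W + (j + 1)) + 20 ≤ τ) :
    Runs clockStep (some .clause) (st inp v l t W B j o) l.head?
      (st inp v l.tail t W B (j + 1) ((evCode W (check j :: ticks (j + 1))).reverse ++ o))
      (5 * τ + 3) := by
  have h1 := does_emitOp (i := inp) (v := v) (r := l) (t := t) (w := W) (b := B) (c := j) (o := o)
    (τ := τ) .read [.wid, .cnt] (by simp) (by simp) (d := 0) (by omega) (a := 0) (by omega)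
    (x := W + j) (by simp [st]) (by omega) rfl
  have h2 := does_push (k := Stk.cnt) (g := fun _ => ThreeCNF.Sym.idx)
    (st inp v l t W B j ((opCode ⟨.read, W + j, 0⟩).reverse ++ o)) fun _ => rfl
  have e : (ThreeCNF.Sym.idx :: st inp v l t W B j ((opCode ⟨.read, W + j, 0⟩).reverse ++ o) .cnt)
    = List.replicate (j + 1) .idx := rfl
  rw [e, update_st_cnt] at h2
  obtain ⟨r', h⟩ := h1.seq (h2.seq (does_ticksProg (τ := τ) (by omega))) (some .clause)
  have h' := (Runs.ite_true (p := isSym .clause) (d := skip .rev) (by simp) h).seq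
    (runs_pop_rev _ _)
  refine (h'.mono (by omega)).cast ?_
  simp [op]

/-- After the last variable only marks remain, but the end marks still let the clock count the
clauses. -/
theorem clauseCode_numVars (C : Clause N) : clauseCode N C = [.var, .var, .var, .clause] := by
  have h : ∀ l : Fin N × Bool, litCode N l = [.var] := fun l => if_pos l.1.is_lt
  simp [clauseCode, h]

theorem runs_loop_clockStep (cs : List (Clause N)) : ∀ j o,
    7 * (W + (j + cs.length)) + 20 ≤ τ →
    Runs (loop Option.isSome clockStep) (cs.flatMap (clauseCode N)).head?
      (st inp v (cs.flatMap (clauseCode N)).tail t W B j o) none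
      (st inp v [] t W B (j + cs.length) ((evCode W (clockFrom j cs)).reverse ++ o))
      (cs.length * (5 * τ + 16) + 1) := by
  induction cs with
  | nil => intro j o _; exact (Runs.loop_done rfl).mono (by omega)
  | cons C cs ih =>
    intro j o hτ
    rw [List.length_cons] at hτ
    have h1 := runs_clockStep (inp := inp) (v := v) (t := t) (B := B) (o := o)
      (cs.flatMap (clauseCode N)) (show 7 * (W + (j + 1)) + 20 ≤ τ by omega)
    have h2 := Runs.loop_step (p := Option.isSome) rfl h1 (ih (j + 1) _ (by omega))
    have h0 := fun l => runs_clockStep_skip (inp := inp) (v := v) (t := t) (W := W) (B := B)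
      (j := j) (o := o) l (s := .var) (by simp)
    have h := Runs.loop_step (p := Option.isSome) rfl (h0 (.var :: .var :: .clause :: _))
      (Runs.loop_step rfl (h0 (.var :: .clause :: _)) (Runs.loop_step rfl (h0 (.clause :: _)) h2))
    rw [List.flatMap_cons, clauseCode_numVars]
    refine (h.mono ?_).cast ?_
    · rw [List.length_cons, Nat.add_one_mul cs.length]
      omega
    · rw [List.length_cons, show j + (cs.length + 1) = j + 1 + cs.length by omega, clockFrom]
      simp

theorem does_clockProg (cs : List (Clause N)) (hτ : 7 * (W + cs.length) + 20 ≤ τ) :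
    Does clockProg (st inp v (cs.flatMap (clauseCode N)) t W B 0 o)
      (st inp v [] t W B 0 ((.var :: evCode W (clockThread cs)).reverse ++ o))
      (cs.length * (5 * τ + 18) + 4 * τ + 5) := by
  set l := cs.flatMap (clauseCode N)
  have h0 := does_push (k := Stk.out) (g := fun _ => ThreeCNF.Sym.var)
    (st inp v l t W B 0 o) fun _ => rfl
  rw [update_st_out] at h0
  have h2 := fun o => runs_loop_clockStep (inp := inp) (v := v) (t := t) (B := B) (τ := τ) (W := W)
    cs 0 o (by omega)
  have h3 := fun o => runs_clear Stk.cnt none (st inp v [] t W B (0 + cs.length) o)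
  have e := fun o => update_st_cnt inp v [] t W B (0 + cs.length) o 0
  rw [List.replicate_zero] at e
  simp only [e] at h3
  have hmid : ∀ o, Does _ (st inp v l t W B 0 o) _ _ := fun o r =>
    ⟨none, (runs_pop_rev l r).seq ((h2 o).seq (h3 _))⟩
  have h := h0.seq ((does_ticksProg (τ := τ) (by omega)).seq (hmid _))
  refine (h.mono ?_).cast ?_
  · have e3 : cs.length * (5 * τ + 18) = cs.length * (5 * τ + 16) + cs.length * 2 := by ring
    simp only [st, List.length_replicate]
    omega
  · simp [clockThread, st]

theorem runs_pop_inp (l : List ThreeCNF.Sym) (x : Option ThreeCNF.Sym) :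
    Runs (pop .inp) x (st l v r t W B j o) l.head? (st l.tail v r t W B j o) 1 := by
  simpa [st] using Runs.pop Stk.inp x (st l v r t W B j o)

theorem runs_loop_var (l : List ThreeCNF.Sym) (hl : l.head? ≠ some .var) (n : ℕ) : ∀ v,
    Runs (loop (isSym .var) (seq (push .vars fun r => r.getD .var) (pop .inp)))
      (List.replicate n ThreeCNF.Sym.var ++ l).head? (st (List.replicate n ThreeCNF.Sym.var ++ l).tail v r t W B j o)
      l.head? (st l.tail (List.replicate n .var ++ v) r t W B j o) (n * 3 + 1) := by
  induction n with
  | zero => intro v; exact Runs.loop_done (by simpa [isSym] using hl)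
  | succ n ih =>
    intro v
    have h1 := Runs.push Stk.vars (fun r : Option ThreeCNF.Sym => r.getD .var) (some .var)
      (st (List.replicate n .var ++ l) v r t W B j o)
    rw [update_st_vars] at h1
    have h := Runs.loop_step (p := isSym .var) (by simp) (h1.seq (runs_pop_inp _ _)) (ih (.var :: v))
    refine Runs.mono ?_ (show 1 + 1 + (n * 3 + 1) + 1 ≤ (n + 1) * 3 + 1 by omega)
    rw [List.replicate_succ, List.cons_append, List.cons_append, cons_replicate_append _ _ v]
    exact h

theorem runs_readStep (s : ThreeCNF.Sym) (l : List ThreeCNF.Sym) :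
    Runs readStep (some s) (st l v r t W B j o) l.head?
      (st l.tail v (s :: r) t (W + if s = .clause then 1 else 0) B j o) 4 := by
  have h1 := Runs.push Stk.rev (fun r : Option ThreeCNF.Sym => r.getD .var) (some s)
    (st l v r t W B j o)
  rw [update_st_rev] at h1
  by_cases hs : s = .clause
  · have h2 := Runs.push Stk.wid (fun _ => ThreeCNF.Sym.idx) (some s)
      (st l v (s :: r) t W B j o)
    have e : (ThreeCNF.Sym.idx :: st l v (s :: r) t W B j o .wid) = List.replicate (W + 1) .idx := rfl
    rw [e, update_st_wid] at h2
    rw [if_pos hs]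
    exact h1.seq ((Runs.ite_true (by simp [hs]) h2).seq (runs_pop_inp _ _))
  · rw [if_neg hs]
    exact h1.seq ((Runs.ite_false (by simp [hs]) (runs_skip _ _ _)).seq (runs_pop_inp _ _))

theorem runs_loop_readStep (l : List ThreeCNF.Sym) : ∀ r W,
    Runs (loop Option.isSome readStep) l.head? (st l.tail v r t W B j o) none
      (st [] v (l.reverse ++ r) t (W + l.count .clause) B j o) (l.length * 5 + 1) := by
  induction l with
  | nil => intro r W; exact Runs.loop_done rfl
  | cons s l ih =>
    intro r W
    have h := Runs.loop_step (p := Option.isSome) rfl (runs_readStep (W := W) s l) (ih (s :: r) _)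
    refine (h.mono ?_).cast ?_
    · rw [List.length_cons]
      omega
    · rw [List.count_cons]
      simp [Nat.add_right_comm, ← Nat.add_assoc]

end

/-! ### Correctness of the full program -/

/-- The part of the input for the clauses. -/
def clausesCode {N : ℕ} (cs : List (Clause N)) : List ThreeCNF.Sym :=
  cs.flatMap ThreeCNF.encodeClause

theorem reverse_encodeClause {N : ℕ} (C : Clause N) :
    (ThreeCNF.encodeClause C).reverse = clauseCode 0 C := by
  simp [ThreeCNF.encodeClause, ThreeCNF.encodeLiteral, clauseCode, litCode, signSym]

/-- Reading the input onto a stack reverses it, and this is exactly the stored form relative to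
variable 0. The program therefore builds the graph of the reversed clause list, which is harmless
for satisfiability. -/
theorem reverse_clausesCode {N : ℕ} (cs : List (Clause N)) :
    (clausesCode cs).reverse = cs.reverse.flatMap (clauseCode 0) := by
  rw [clausesCode, List.reverse_flatMap]
  congr 1
  funext C
  exact reverse_encodeClause C

theorem count_clausesCode {N : ℕ} (cs : List (Clause N)) :
    (clausesCode cs).count .clause = cs.length := by
  have h : ∀ l : Fin N × Bool, (ThreeCNF.encodeLiteral l).count .clause = 0 := fun l => by
    rw [ThreeCNF.encodeLiteral]
    cases l.2 <;> simp [List.count_replicate]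
  unfold clausesCode
  induction cs with
  | nil => rfl
  | cons C cs ih => simp [ThreeCNF.encodeClause, h, ih, Nat.add_comm]

theorem head?_clausesCode {N : ℕ} (cs : List (Clause N)) :
    (clausesCode cs).head? ≠ some .var := by
  cases cs <;> simp [clausesCode, ThreeCNF.encodeClause]

section

variable {N : ℕ} {cs : List (Clause N)}

theorem runs_readProg : Runs readProg none
    (st (List.replicate N .var ++ clausesCode cs) [] [] [] 0 0 0 []) none
    (st [] (List.replicate N .var) (cs.reverse.flatMap (clauseCode 0)) [] cs.length 0 0 [])
    (N * 3 + cs.length * (3 * N + 4) * 5 + 3) := by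
  have h := (runs_pop_inp (List.replicate N .var ++ clausesCode cs) none).seq
    ((runs_loop_var (r := []) (t := []) (W := 0) (B := 0) (j := 0) (o := [])
      (clausesCode cs) (head?_clausesCode cs) N []).seq (runs_loop_readStep (clausesCode cs) [] 0))
  have hl := length_flatMap_clauseCode_le 0 cs.reverse
  rw [← reverse_clausesCode, List.length_reverse, List.length_reverse] at hl
  refine (h.mono ?_).cast ?_
  · omega
  · rw [count_clausesCode, reverse_clausesCode]
    simp

theorem does_initProg {v r t o : List ThreeCNF.Sym} {W j : ℕ} :
    Does initProg (st [] v r t W 0 j o) (st [] v r t (W + 3) (2 * (W + 3)) j o)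
      (14 * (W + 3) + 12) := by
  have h1 := does_pushAll Stk.wid [ThreeCNF.Sym.idx, .idx, .idx] (st [] v r t W 0 j o)
  have e : [ThreeCNF.Sym.idx, .idx, .idx].reverse ++ st [] v r t W 0 j o .wid =
    List.replicate (W + 3) .idx := rfl
  rw [e, update_st_wid] at h1
  have h2 := does_copy_wid (inp := []) (v := v) (r := r) (t := t) (W := W + 3) (j := j) (o := o)
    (q := 0)
  have h3 := does_copy_wid (inp := []) (v := v) (r := r) (t := t) (W := W + 3) (j := j) (o := o)
    (q := 1)
  rw [Nat.zero_mul] at h2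
  refine (h1.seq (h2.seq h3)).mono ?_
  simp only [List.length_cons, List.length_nil]
  omega

/-- The output of `reduceProg`. -/
def execCode (cs : List (Clause N)) : List ThreeCNF.Sym :=
  (List.range N).flatMap (varCode (cs.length + 3) cs) ++
    (.var :: evCode (cs.length + 3) (clockThread cs))

/-- Programs use a single alphabet, so the output is written with renamed symbols and translated
back during the transfer to the decider. -/
theorem toSym_encode_clauseExec : (clauseExec cs).encode.map toSym = execCode cs := by
  have h : ∀ o, ((PartialExec.Sym.thread :: ((threadOf cs o).map (op (cs.length + 3))).flatMap
      PartialExec.encodeOp).map toSym) = .var :: evCode (cs.length + 3) (threadOf cs o) := by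
    intro o
    simp [List.map_flatMap, List.flatMap_map, evCode, toSym]
    rfl
  rw [PartialExec.encode, clauseExec, namedExec, List.flatMap_map, List.map_flatMap]
  simp only [h]
  rw [owners, List.flatMap_append, List.flatMap_assoc, execCode]
  congr 1
  · simp [threadOf]
    rfl
  · simp [threadOf]

theorem runs_reduceProg {τ : ℕ}
    (hτ : 7 * (cs.length + 3 + (N + 2) * (cs.length + 3) + cs.length) + 20 ≤ τ) :
    Runs reduceProg none
      (Function.update (fun _ => []) .inp (List.replicate N .var ++ clausesCode cs)) none
      (Function.update (fun _ => []) .out (execCode cs.reverse).reverse)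
      ((N * 3 + cs.length * (3 * N + 4) * 5 + 3) + ((14 * (cs.length + 3) + 12) +
        ((N * (2 * (cs.length * (18 * N + 10 * τ + 45) + 8 * τ + 8) + ((cs.length + 3) * 7 + 4) + 2)
          + 2) + ((cs.length * (5 * τ + 18) + 4 * τ + 5) + (((cs.length + 3) * 2 + 2) +
            ((N + 2) * (cs.length + 3) * 2 + 2)))))) := by
  have e0 : ∀ k l, Function.update (fun _ : Stk => ([] : List ThreeCNF.Sym)) k l =
      Function.update (st [] [] [] [] 0 0 0 []) k l := fun k l => by
    congr 1
    funext k
    cases k <;> rfl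
  rw [e0, e0, update_st_inp, update_st_out]
  have h3 := runs_varProg (W := cs.length + 3) (τ := τ) (inp := []) (v := List.replicate N .var) (o := []) cs.reverse (by simp)
    (by rwa [List.length_reverse])
  have h4 := does_clockProg (inp := []) (v := []) (t := []) (W := cs.length + 3)
    (B := (N + 2) * (cs.length + 3)) (o := ((List.range N).flatMap
      (varCode (cs.length + 3) cs.reverse)).reverse ++ []) (τ := τ) cs.reverse
    (by rw [List.length_reverse]; omega)
  have e5 := fun o => update_st_wid [] [] [] [] (cs.length + 3) ((N + 2) * (cs.length + 3)) 0 o 0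
  have e6 := fun o => update_st_bas [] [] [] [] 0 ((N + 2) * (cs.length + 3)) 0 o 0
  have h5 := fun o r => runs_clear Stk.wid r
    (st [] [] [] [] (cs.length + 3) ((N + 2) * (cs.length + 3)) 0 o)
  have h6 := fun o r => runs_clear Stk.bas r
    (st [] [] [] [] 0 ((N + 2) * (cs.length + 3)) 0 o)
  simp only [List.replicate_zero] at e5 e6
  simp only [e5] at h5
  simp only [e6] at h6
  have h := runs_readProg.seq (does_initProg.seq_runs fun r' =>
    (h3 r').seq (h4.seq_runs fun r' => (h5 _ r').seq (h6 _ none)))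
  refine (h.mono ?_).cast ?_
  · simp only [st, List.length_replicate, List.length_reverse, le_refl]
  · simp [execCode]

end

end Prog

/-! ## The lower bound -/

theorem DecidesInTime.mono {α Γ : Type} {enc : α → List Γ} {dom : Set α} {P : α → Prop}
    {T T' : α → ℝ} (h : DecidesInTime enc dom P T) (hT : ∀ a ∈ dom, T a ≤ T' a) :
    DecidesInTime enc dom P T' := by
  obtain ⟨M, hM⟩ := h
  refine ⟨M, fun a ha => ?_⟩
  obtain ⟨t, ht, hb⟩ := hM a ha
  exact ⟨t, ht.trans (hT a ha), hb⟩

/-- A bound for the running time of `Prog.reduceProg`. -/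
def reduceTime (N m : ℕ) : ℕ := 1000 * (N + m + 4) ^ 4

theorem runs_reduceProg_encode (φ : ThreeCNF) : Prog.Runs Prog.reduceProg none
    (Function.update (fun _ => []) .inp φ.encode) none
    (Function.update (fun _ => []) .out (Prog.execCode φ.clauses.reverse).reverse)
    (reduceTime φ.numVars φ.clauses.length) := by
  refine (Prog.runs_reduceProg (N := φ.numVars) (cs := φ.clauses)
    (τ := 9 * (φ.numVars + φ.clauses.length + 4) ^ 2) ?_).mono ?_
  all_goals
    generalize φ.clauses.length = m
    generalize φ.numVars = N
  · nlinarith [Nat.zero_le (N * m), Nat.zero_le (N ^ 2), Nat.zero_le (m ^ 2)]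
  · unfold reduceTime
    zify
    -- The difference of the two sides is expanded into a polynomial in N and m whose nonnegativity
    -- is visible term by term.
    rw [← sub_nonneg]
    ring_nf
    positivity

theorem numEvents_clauseExec_le_sq {N : ℕ} (cs : List (Clause N)) :
    (clauseExec cs).numEvents ≤ 16 * (N + cs.length + 4) ^ 2 := by
  refine (numEvents_clauseExec_le cs).trans ?_
  generalize cs.length = m
  zify
  rw [← sub_nonneg]
  ring_nf
  positivity

theorem length_encode_clauseExec_le {N : ℕ} (cs : List (Clause N)) :
    (clauseExec cs).encode.length ≤ 520 * (N + cs.length + 4) ^ 4 := by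
  refine (length_encode_le (isNormalized_clauseExec cs)).trans ?_
  rw [numThreads_clauseExec]
  have h := numEvents_clauseExec_le_sq cs
  calc 2 * N + 1 + (clauseExec cs).numEvents * (2 * (clauseExec cs).numEvents)
      ≤ 2 * N + 1 + 16 * (N + cs.length + 4) ^ 2 * (2 * (16 * (N + cs.length + 4) ^ 2)) := by gcongr
    _ ≤ _ := by
      generalize cs.length = m
      zify
      rw [← sub_nonneg]
      ring_nf
      positivity

/-- Consistency testing in time `T` gives an algorithm for 3-SAT. -/
theorem decidesInTime_satisfiable {T : PartialExec → ℝ}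
    (h : DecidesInTime PartialExec.encode
      {X | X.IsThreeWriter ∧ X.HasFourWritesPerLoc ∧ X.IsNormalized}
      PartialExec.RelaxedConsistent T) :
    DecidesInTime ThreeCNF.encode Set.univ ThreeCNF.Satisfiable fun φ =>
      2000 * ((φ.numVars + φ.clauses.length + 4 : ℕ) : ℝ) ^ 4 + T (clauseExec φ.clauses.reverse) := by
  have h1 := DecidesInTime.of_reduction (enc := ThreeCNF.encode) (dom := Set.univ)
    (P := ThreeCNF.Satisfiable) h (fun φ => clauseExec φ.clauses.reverse)
    (fun φ _ => ⟨isThreeWriter_clauseExec _, hasFourWritesPerLoc_clauseExec _,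
      isNormalized_clauseExec _⟩)
    (fun φ _ => by
      rw [relaxedConsistent_clauseExec_iff, ThreeCNF.Satisfiable]
      simp only [List.mem_reverse])
    Prog.reduceProg .inp .out ofSym (fun φ => (Prog.execCode φ.clauses.reverse).reverse)
    (fun φ => reduceTime φ.numVars φ.clauses.length) (fun φ _ => runs_reduceProg_encode φ)
    (fun φ _ => by
      rw [List.reverse_reverse, ← Prog.toSym_encode_clauseExec, List.map_map]
      exact (List.map_congr_left fun s _ => ofSym_toSym s).trans (List.map_id _))
  refine h1.mono fun φ _ => ?_
  gcongr
  have h2 := length_encode_clauseExec_le φ.clauses.reverse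
  rw [List.length_reverse] at h2
  have h3 : 1 ≤ (φ.numVars + φ.clauses.length + 4) ^ 4 := Nat.one_le_pow _ _ (by omega)
  have h4 : reduceTime φ.numVars φ.clauses.length +
      ((clauseExec φ.clauses.reverse).encode.length + 1) ≤
      2000 * (φ.numVars + φ.clauses.length + 4) ^ 4 := by
    unfold reduceTime
    omega
  exact_mod_cast h4

theorem exists_bound_of_isLittleO {f : ℕ → ℝ} (hf : f =o[atTop] fun k : ℕ => (k : ℝ)) {δ : ℝ}
    (hδ : 0 < δ) : ∃ B : ℝ, ∀ N : ℕ, f (2 * N + 1) ≤ δ * N + B := by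
  obtain ⟨k, hk⟩ := eventually_atTop.1 (hf.bound (show 0 < δ / 3 by positivity))
  -- The sum absorbs the finitely many N < k. For the others, (δ/3)(2N + 1) ≤ δN + δ.
  refine ⟨∑ i ∈ Finset.range k, |f (2 * i + 1)| + δ, fun N => ?_⟩
  have hsum : 0 ≤ ∑ i ∈ Finset.range k, |f (2 * i + 1)| :=
    Finset.sum_nonneg fun i _ => abs_nonneg _
  have hN : (0 : ℝ) ≤ δ * N := by positivity
  by_cases h : N < k
  · have h1 := Finset.single_le_sum (f := fun i => |f (2 * i + 1)|) (fun i _ => abs_nonneg _)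
      (Finset.mem_range.2 h)
    have h2 := le_abs_self (f (2 * N + 1))
    linarith
  · have h1 := hk (2 * N + 1) (by omega)
    rw [Real.norm_eq_abs, Real.norm_eq_abs, Nat.abs_cast] at h1
    have h2 := le_abs_self (f (2 * N + 1))
    push_cast at h1
    nlinarith

end RelaxedTesting

open RelaxedTesting in
theorem mainTheorem8 (hETH : RelaxedTesting.ExponentialTimeHypothesis) :
    ¬ ∃ (f : ℕ → ℝ) (C : ℝ) (c : ℕ),
      f =o[atTop] (fun k : ℕ => (k : ℝ)) ∧
      RelaxedTesting.DecidesInTime RelaxedTesting.PartialExec.encode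
        {X | X.IsThreeWriter ∧ X.HasFourWritesPerLoc ∧ X.IsNormalized}
        RelaxedTesting.PartialExec.RelaxedConsistent
        (fun X => C * (2 : ℝ) ^ (f X.numThreads) * ((X.numEvents + 1 : ℕ) : ℝ) ^ c) := by
  rintro ⟨f, C, c, hf, h⟩
  obtain ⟨δ, hδ, hno⟩ := hETH
  obtain ⟨B, hB⟩ := exists_bound_of_isLittleO hf hδ
  -- With s = N + m + 1, the reduction costs at most 2000 (4s)^4 = 512000 s^4, and the graph has
  -- fewer than 272 s^2 events. The factor 2^B comes from the o(k) bound at k = 2N + 1, and |C| is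
  -- needed because C may be negative.
  refine hno (512000 + |C| * 2 ^ B * 272 ^ c) (2 * c + 4)
    ((decidesInTime_satisfiable h).mono fun φ _ => ?_)
  have hE := numEvents_clauseExec_le_sq φ.clauses.reverse
  rw [List.length_reverse] at hE
  rw [numThreads_clauseExec]
  set N := φ.numVars
  set s : ℕ := N + φ.clauses.length + 1 with hs
  have hu : N + φ.clauses.length + 4 ≤ 4 * s := by omega
  have hE' : (clauseExec φ.clauses.reverse).numEvents + 1 ≤ 272 * s ^ 2 := by
    have h1 := Nat.pow_le_pow_left hu 2
    have h2 : 1 ≤ s ^ 2 := Nat.one_le_pow _ _ (by omega)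
    rw [mul_pow] at h1
    linarith
  have hs1 : (1 : ℝ) ≤ s := by exact_mod_cast (show 1 ≤ s by omega)
  have hexp : (1 : ℝ) ≤ 2 ^ (δ * N) := Real.one_le_rpow one_le_two (by positivity)
  have hfst : (2000 : ℝ) * ((N + φ.clauses.length + 4 : ℕ) : ℝ) ^ 4 ≤
      512000 * (2 ^ (δ * N) * s ^ (2 * c + 4)) := by
    calc (2000 : ℝ) * ((N + φ.clauses.length + 4 : ℕ) : ℝ) ^ 4
        ≤ 2000 * ((4 * s : ℕ) : ℝ) ^ 4 := by gcongr
      _ = 512000 * (1 * (s : ℝ) ^ 4) := by push_cast; ring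
      _ ≤ 512000 * (2 ^ (δ * N) * s ^ (2 * c + 4)) := by
        gcongr
        omega
  have hpow : (2 : ℝ) ^ f (2 * N + 1) ≤ 2 ^ B * 2 ^ (δ * N) := by
    rw [← Real.rpow_add two_pos]
    exact Real.rpow_le_rpow_of_exponent_le one_le_two (by linarith [hB N])
  have hsnd : C * (2 : ℝ) ^ f (2 * N + 1) *
      (((clauseExec φ.clauses.reverse).numEvents + 1 : ℕ) : ℝ) ^ c ≤
      |C| * 2 ^ B * 272 ^ c * (2 ^ (δ * N) * s ^ (2 * c + 4)) := by
    calc C * (2 : ℝ) ^ f (2 * N + 1) *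
          (((clauseExec φ.clauses.reverse).numEvents + 1 : ℕ) : ℝ) ^ c
        ≤ |C| * (2 ^ B * 2 ^ (δ * N)) * ((272 * s ^ 2 : ℕ) : ℝ) ^ c := by
          gcongr
          exact le_abs_self C
      _ = |C| * 2 ^ B * 272 ^ c * (2 ^ (δ * N) * s ^ (2 * c)) := by push_cast; ring
      _ ≤ _ := by
        gcongr
        omega
  calc _ ≤ 512000 * (2 ^ (δ * N) * (s : ℝ) ^ (2 * c + 4)) +
        |C| * 2 ^ B * 272 ^ c * (2 ^ (δ * N) * s ^ (2 * c + 4)) := add_le_add hfst hsnd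
    _ = _ := by ring
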